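/- Let $l\ge 1$, $\mathcal Y=\{1,\dots,l\}$, $\mathcal Z=\mathbb R$, and let $\Omega_1\subset\mathbb R^{m_1}$, $\Omega_2\subset\mathbb R^{m_2}$ be bounded domains (open and connected). For $\vec\varepsilon\in\Omega_1$ let $\Pi^{\vec\varepsilon}=(\pi^{\vec\varepsilon}_{ij})$ be an $l\times l$ stochastic matrix whose entries are real analytic in $\vec\varepsilon$, with stationary probability vector $\pi^{\vec\varepsilon}$. For $\vec\theta\in\Omega_2$ and $y\in\mathcal Y$ let $q^{\vec\theta}(\cdot|y)$ be a probability density on $\mathcal Z$ such that, for every $(y,z)$, $q^{\vec\theta}(z|y)$ is real analytic in $\vec\theta\in\Omega_2$. Let $Z$ be the output process of the memoryless channel with transition densities $q^{\vec\theta}(z|y)$ when the input is the stationary Markov chain with transition matrix $\Pi^{\vec\varepsilon}$ and stationary vector $\pi^{\vec\varepsilon}$, so that $n+1$ consecutive outputs $z_0,\dots,z_n$ have the joint density $$p^{\vec\varepsilon,\vec\theta}(z_0,\dots,z_n)=\sum_{y_0,\dots,y_n\in\mathcal Y}\pi^{\vec\varepsilon}_{y_0}\prod_{i=0}^{n-1}\pi^{\vec\varepsilon}_{y_iy_{i+1}}\prod_{i=0}^{n}q^{\vec\theta}(z_i|y_i).$$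 The entropy rate of $Z$ is $$H^{\vec\varepsilon,\vec\theta}(Z)=\lim_{n\to\infty}\frac{-1}{n+1}\int_{\mathbb R^{n+1}}p^{\vec\varepsilon,\vec\theta}\log p^{\vec\varepsilon,\vec\theta}\,dz_0\cdots dz_n$$ when the integrals are finite and the limit exists. Fix $(\vec\varepsilon_0,\vec\theta_0)\in\Omega_1\times\Omega_2$. Write $\mathbb C^{m_2}_{\vec\theta_0}(r)$ for the open ball of radius $r$ around $\vec\theta_0$ in $\mathbb C^{m_2}$ (Euclidean norm), and use the same notation $q^{\vec\theta}(z|y)$ for the complex analytic extension, near $\vec\theta_0$, of the real analytic function $\vec\theta\mapsto q^{\vec\theta}(z|y)$. Assume: (a) all entries of $\Pi^{\vec\varepsilon_0}$ are positive; (b) $q^{\vec\theta_0}(z|y)>0$ for all $y\in\mathcal Y$, $z\in\mathcal Z$; (c) there is $r>0$ such that, for all $(y,z)$, $q^{\vec\theta}(z|y)$ is analytic in $\vec\theta\in\mathbb C^{m_2}_{\vec\theta_0}(r)$; for all $y$, $q^{\vec\theta}(z|y)$ is jointly continuous on $\mathcal Z\times\mathbb C^{m_2}_{\vec\theta_0}(r)$;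 and the three integrals $$\int\breve q(z)\,dz,\qquad\int\breve q(z)\log\hat q(z)\,dz,\qquad\int\breve q(z)\log\breve q(z)\,dz$$ are finite (converge absolutely), where $\breve q(z)=\sup|q^{\vec\theta}(z|y)|$ and $\hat q(z)=\inf|q^{\vec\theta}(z|y)|$, both over $y\in\mathcal Y$ and $\vec\theta\in\mathbb C^{m_2}_{\vec\theta_0}(r)$. Suppose in addition that for every $\delta>0$ there is $r>0$ such that for all $(y,z)\in\mathcal Y\times\mathcal Z$ and all $\vec\theta\in\mathbb C^{m_2}_{\vec\theta_0}(r)$ $$|\Im q^{\vec\theta}(z|y)|<\delta\,|\Re q^{\vec\theta}(z|y)|,\qquad\left|\log\frac{q^{\vec\theta}(z|y)}{q^{\vec\theta_0}(z|y)}\right|\le\delta ,$$ with $\log$ the principal branch. Then for all $(\vec\varepsilon,\vec\theta)$ in a neighborhood of $(\vec\varepsilon_0,\vec\theta_0)$ in $\mathbb R^{m_1}\times\mathbb R^{m_2}$ the entropy rate $H^{\vec\varepsilon,\vec\theta}(Z)$ exists (all the integrals and the limit are finite), and $(\vec\varepsilon,\vec\theta)\mapsto H^{\vec\varepsilon,\vec\theta}(Z)$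 is jointly real analytic at $(\vec\varepsilon_0,\vec\theta_0)$. -/

import Mathlib

open Filter Topology MeasureTheory

namespace HiddenMarkov

/-- The inclusion of `ℝᵐ` in `ℂᵐ` (both with the Euclidean norm). -/
noncomputable def toComplex {m : ℕ} (x : EuclideanSpace ℝ (Fin m)) : EuclideanSpace ℂ (Fin m) :=
  WithLp.toLp 2 (fun i => (x i : ℂ))

/-- `p` is a stationary probability vector of the matrix `P`. -/
def IsStationary {l : ℕ} (P : Matrix (Fin l) (Fin l) ℝ) (p : Fin l → ℝ) : Prop :=
  p ∈ stdSimplex ℝ (Fin l) ∧ Matrix.vecMul p P = p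

/-- `f` is a probability density function on `ℝ`. -/
def IsDensity (f : ℝ → ℝ) : Prop :=
  (∀ z, 0 ≤ f z) ∧ Integrable f ∧ ∫ z, f z = 1

/-- The probability that the Markov chain with initial vector `p` and transition matrix `P`
follows the path `y 0, …, y n`. -/
noncomputable def pathProb {l : ℕ} (p : Fin l → ℝ) (P : Matrix (Fin l) (Fin l) ℝ) (n : ℕ)
    (y : Fin (n + 1) → Fin l) : ℝ :=
  p (y 0) * ∏ i : Fin n, P (y i.castSucc) (y i.succ)

/-- The joint density of `n + 1` consecutive outputs of the memoryless channel with
conditional densities `q y` (`z ↦ q(z|y)`), the input being the Markov chain `(p, P)`. -/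
noncomputable def outputDensity {l : ℕ} (p : Fin l → ℝ) (P : Matrix (Fin l) (Fin l) ℝ)
    (q : Fin l → ℝ → ℝ) (n : ℕ) (z : Fin (n + 1) → ℝ) : ℝ :=
  ∑ y : Fin (n + 1) → Fin l, pathProb p P n y * ∏ i, q (y i) (z i)

/-- The integrand `p(z) log p(z)` of the entropy of `n + 1` consecutive outputs. -/
noncomputable def entropyIntegrand {l : ℕ} (p : Fin l → ℝ) (P : Matrix (Fin l) (Fin l) ℝ)
    (q : Fin l → ℝ → ℝ) (n : ℕ) (z : Fin (n + 1) → ℝ) : ℝ :=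
  outputDensity p P q n z * Real.log (outputDensity p P q n z)

/-- The (differential) entropy of `n + 1` consecutive outputs. -/
noncomputable def blockEntropy {l : ℕ} (p : Fin l → ℝ) (P : Matrix (Fin l) (Fin l) ℝ)
    (q : Fin l → ℝ → ℝ) (n : ℕ) : ℝ :=
  -∫ z : Fin (n + 1) → ℝ, entropyIntegrand p P q n z

/-- All block entropies are well defined and finite, and the limit that defines the entropy rate
exists. -/
def HasEntropyRate {l : ℕ} (p : Fin l → ℝ) (P : Matrix (Fin l) (Fin l) ℝ)
    (q : Fin l → ℝ → ℝ) (h : ℝ) : Prop :=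
  (∀ n, Integrable (entropyIntegrand p P q n)) ∧
    Tendsto (fun n : ℕ => blockEntropy p P q n / ((n : ℝ) + 1)) atTop (𝓝 h)

/-- The entropy rate `H(Z)` of the output process (meaningful when the limit exists). -/
noncomputable def entropyRate {l : ℕ} (p : Fin l → ℝ) (P : Matrix (Fin l) (Fin l) ℝ)
    (q : Fin l → ℝ → ℝ) : ℝ :=
  limUnder atTop (fun n : ℕ => blockEntropy p P q n / ((n : ℝ) + 1))

/-- `F` is the complex-analytic extension of the real function `f` near the real point `x₀`. -/
def IsComplexExtensionAt {m : ℕ} (f : EuclideanSpace ℝ (Fin m) → ℝ)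
    (F : EuclideanSpace ℂ (Fin m) → ℂ) (x₀ : EuclideanSpace ℝ (Fin m)) : Prop :=
  AnalyticAt ℂ F (toComplex x₀) ∧ ∀ᶠ x in 𝓝 x₀, F (toComplex x) = (f x : ℂ)

/-- `sup |q^θ(z|y)|` over all inputs `y` and all `θ` in the complex `r`-ball around `θ₀`. -/
noncomputable def qSup {l m : ℕ} (qc : EuclideanSpace ℂ (Fin m) → Fin l → ℝ → ℂ)
    (θ₀ : EuclideanSpace ℝ (Fin m)) (r : ℝ) (z : ℝ) : ENNReal :=
  ⨆ y : Fin l, ⨆ θ ∈ Metric.ball (toComplex θ₀) r, ‖qc θ y z‖ₑ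

/-- `inf |q^θ(z|y)|` over all inputs `y` and all `θ` in the complex `r`-ball around `θ₀`. -/
noncomputable def qInf {l m : ℕ} (qc : EuclideanSpace ℂ (Fin m) → Fin l → ℝ → ℂ)
    (θ₀ : EuclideanSpace ℝ (Fin m)) (r : ℝ) (z : ℝ) : ENNReal :=
  ⨅ y : Fin l, ⨅ θ ∈ Metric.ball (toComplex θ₀) r, ‖qc θ y z‖ₑ

/-- The regularity of the complexified channel densities on the complex `r`-ball around `θ₀`:
analyticity in `θ`, joint continuity, and finiteness of the three integrals. Here `log 0 = -∞` and
`log ∞ = ∞`, and an integral is finite if that of the absolute value of the integrand is. -/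
structure RegularOn {l m : ℕ} (qc : EuclideanSpace ℂ (Fin m) → Fin l → ℝ → ℂ)
    (θ₀ : EuclideanSpace ℝ (Fin m)) (r : ℝ) : Prop where
  analytic : ∀ y z, AnalyticOnNhd ℂ (fun θ => qc θ y z) (Metric.ball (toComplex θ₀) r)
  continuous : ∀ y, ContinuousOn
    (fun a : ℝ × EuclideanSpace ℂ (Fin m) => qc a.2 y a.1)
    (Set.univ ×ˢ Metric.ball (toComplex θ₀) r)
  sup_finite : ∫⁻ z : ℝ, qSup qc θ₀ r z < ⊤
  sup_log_inf_finite :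
    ∫⁻ z : ℝ, qSup qc θ₀ r z * (ENNReal.log (qInf qc θ₀ r z)).abs < ⊤
  sup_log_sup_finite :
    ∫⁻ z : ℝ, qSup qc θ₀ r z * (ENNReal.log (qSup qc θ₀ r z)).abs < ⊤

end HiddenMarkov

/-! By the chain rule, the block entropy is minus the sum of the expected logarithms `condInt` of
the conditional density of the last output given the earlier ones
(`IsPositiveModel.blockEntropy_eq`). The entropy rate is therefore minus the limit of `condInt`,
through Cesàro means. By stationarity, consecutive terms can be integrated against the same density.
Their difference then measures only how much the conditional log-density changes when the oldest
output is forgotten, and positive matrices forget exponentially fast.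

All of this survives a small complex perturbation. Vectors stay in a narrow complex cone about
positive vectors (`exists_near_mul`, `exists_near_fwd`), and two such vectors still approach each
other projectively (`exists_contraction`, `exists_near_fwd_tail`). Conditional densities thus keep
positive real part and have holomorphic logarithms. The complex joint weights have total mass
growing at most like `(1 + pertSize β) ^ (2 * n)`, which is slower than the contraction
(`norm_condInt_succ_sub_le`, `convRate`). Hence `condInt` converges uniformly on a complex ball.
Each term is holomorphic, because it is an integral with an integrable majorant, so the limit is
analytic (`analyticAt_condLim`).

The complex parameters are the entries of the transition matrix, taken as free variables, and `θ`.
`normRows` and `statVec` restore row sums and stationarity at complex points, and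
`eq_one_of_eq_one_on_real` carries the total mass one of the densities over to complex `θ`.
Composition with the real analytic map `ε ↦ P ε` gives the theorem. -/

namespace HiddenMarkov

/-! ### Bounded functions holomorphic on complex lines are analytic. -/

section GateauxHolomorphic

open Metric Set

universe u

variable {E : Type*} [NormedAddCommGroup E] [NormedSpace ℂ E]
  {F : Type u} [NormedAddCommGroup F] [NormedSpace ℂ F]

/-- A bounded holomorphic function on a disc is Lipschitz on the concentric disc of half the
radius. -/
theorem norm_sub_le_of_differentiableOn_ball {f : ℂ → F} {c : ℂ} {r M : ℝ}
    (hr : 0 < r) (hd : DifferentiableOn ℂ f (ball c r)) (hM : ∀ z ∈ ball c r, ‖f z‖ ≤ M)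
    {z w : ℂ} (hz : z ∈ ball c (r / 2)) (hw : w ∈ ball c (r / 2)) :
    ‖f w - f z‖ ≤ 4 * M / r * ‖w - z‖ := by
  refine (convex_ball c (r / 2)).norm_image_sub_le_of_norm_deriv_le
    (fun x hx => ?_) (fun x hx => ?_) hz hw
  · exact hd.differentiableAt (isOpen_ball.mem_nhds (ball_subset_ball (by linarith) hx))
  · have hsub : closedBall x (r / 4) ⊆ ball c r := fun y hy => by
      have h1 := mem_closedBall.1 hy
      have h2 := mem_ball.1 hx
      exact mem_ball.2 (by linarith [dist_triangle y x c])
    have := Complex.norm_deriv_le_of_forall_mem_sphere_norm_le (C := M) (by positivity : 0 < r / 4)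
      (hd.diffContOnCl_ball hsub) (fun y hy => hM y (hsub (sphere_subset_closedBall hy)))
    calc _ ≤ M / (r / 4) := this
      _ = 4 * M / r := by field_simp

/-- `f` is holomorphic along the intersection of `U` with every complex line. -/
def GateauxHolomorphicOn (f : E → F) (U : Set E) : Prop :=
  ∀ a v : E, DifferentiableOn ℂ (fun t : ℂ => f (a + t • v)) {t : ℂ | a + t • v ∈ U}

theorem GateauxHolomorphicOn.mono {f : E → F} {U V : Set E} (h : GateauxHolomorphicOn f U)
    (hVU : V ⊆ U) : GateauxHolomorphicOn f V :=
  fun a v => (h a v).mono fun _ ht => hVU ht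

theorem _root_.DifferentiableOn.gateauxHolomorphicOn {f : E → F} {U : Set E}
    (h : DifferentiableOn ℂ f U) : GateauxHolomorphicOn f U :=
  fun a v => h.comp (by fun_prop) fun _ ht => ht

theorem GateauxHolomorphicOn.norm_sub_le {f : E → F} {x y : E} {r M : ℝ} (hr : 0 < r)
    (h : GateauxHolomorphicOn f (ball x r)) (hM : ∀ z ∈ ball x r, ‖f z‖ ≤ M)
    (hy : y ∈ ball x (r / 2)) : ‖f y - f x‖ ≤ 4 * M / r * ‖y - x‖ := by
  rcases eq_or_ne y x with rfl | hne
  · simp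
  have hpos : 0 < ‖y - x‖ := norm_pos_iff.2 (sub_ne_zero.2 hne)
  set v : E := ((‖y - x‖⁻¹ : ℝ) : ℂ) • (y - x) with hv
  have hv1 : ‖v‖ = 1 := by
    rw [hv, norm_smul, Complex.norm_real, norm_inv, norm_norm, inv_mul_cancel₀ hpos.ne']
  have hmem : ∀ t ∈ ball (0 : ℂ) r, x + t • v ∈ ball x r := fun t ht => by
    simpa [norm_smul, hv1] using ht
  have key := norm_sub_le_of_differentiableOn_ball (f := fun t : ℂ => f (x + t • v)) (c := 0)
    hr ((h x v).mono hmem) (fun t ht => hM _ (hmem t ht)) (z := 0) (w := (‖y - x‖ : ℂ))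
    (by simpa using hr) (by simpa [dist_eq_norm] using hy)
  have hyv : x + ((‖y - x‖ : ℝ) : ℂ) • v = y := by
    rw [hv, smul_smul, ← Complex.ofReal_mul, mul_inv_cancel₀ hpos.ne']
    simp
  simp only [hyv, zero_smul, add_zero, sub_zero, Complex.norm_real, norm_norm] at key
  exact key

theorem GateauxHolomorphicOn.continuousAt {f : E → F} {x : E} {r M : ℝ} (hr : 0 < r)
    (h : GateauxHolomorphicOn f (ball x r)) (hM : ∀ z ∈ ball x r, ‖f z‖ ≤ M) :
    ContinuousAt f x := by
  rw [ContinuousAt, tendsto_iff_norm_sub_tendsto_zero]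
  have hlim : Tendsto (fun y => 4 * M / r * ‖y - x‖) (𝓝 x) (𝓝 0) := by
    have : Tendsto (fun y => 4 * M / r * ‖y - x‖) (𝓝 x) (𝓝 (4 * M / r * ‖x - x‖)) :=
      Continuous.tendsto (by fun_prop) x
    simpa using this
  refine squeeze_zero' (.of_forall fun _ => norm_nonneg _) ?_ hlim
  filter_upwards [ball_mem_nhds x (half_pos hr)] with y hy using h.norm_sub_le hr hM hy

theorem GateauxHolomorphicOn.continuousOn {f : E → F} {U : Set E} {M : ℝ} (hU : IsOpen U)
    (h : GateauxHolomorphicOn f U) (hM : ∀ z ∈ U, ‖f z‖ ≤ M) : ContinuousOn f U := fun x hx => by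
  obtain ⟨r, hr, hrU⟩ := Metric.isOpen_iff.1 hU x hx
  exact ((h.mono hrU).continuousAt hr fun z hz => hM z (hrU hz)).continuousWithinAt

/-- A bounded map into `C(K, F)` is holomorphic as soon as it is pointwise holomorphic. -/
theorem differentiableOn_continuousMap {K : Type*} [TopologicalSpace K] [CompactSpace K]
    [CompleteSpace F] {φ : ℂ → C(K, F)} {U : Set ℂ} {M : ℝ} (hU : IsOpen U)
    (hM : ∀ t ∈ U, ‖φ t‖ ≤ M) (hd : ∀ ζ, DifferentiableOn ℂ (fun t => φ t ζ) U) :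
    DifferentiableOn ℂ φ U := by
  intro c hc
  obtain ⟨R, hR, hRU⟩ := Metric.isOpen_iff.1 hU c hc
  have hM0 : 0 ≤ M := (norm_nonneg _).trans (hM c hc)
  have hlip : ∀ z ∈ ball c (R / 2), ∀ w ∈ ball c (R / 2),
      ‖φ w - φ z‖ ≤ 4 * M / R * ‖w - z‖ := fun z hz w hw => by
    refine (ContinuousMap.norm_le _ (by positivity)).2 fun ζ => ?_
    exact norm_sub_le_of_differentiableOn_ball (f := fun t => φ t ζ) hR ((hd ζ).mono hRU)
      (fun t ht => ((φ t).norm_coe_le_norm ζ).trans (hM t (hRU ht))) hz hw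
  have hcont : ContinuousOn φ (ball c (R / 2)) := fun z hz => by
    refine ContinuousAt.continuousWithinAt ?_
    rw [ContinuousAt, tendsto_iff_norm_sub_tendsto_zero]
    have hlim : Tendsto (fun y => 4 * M / R * ‖y - z‖) (𝓝 z) (𝓝 0) := by
      have : Tendsto (fun y => 4 * M / R * ‖y - z‖) (𝓝 z) (𝓝 (4 * M / R * ‖z - z‖)) :=
        Continuous.tendsto (by fun_prop) z
      simpa using this
    refine squeeze_zero' (.of_forall fun _ => norm_nonneg _) ?_ hlim
    filter_upwards [isOpen_ball.mem_nhds hz] with y hy using hlip z hz y hy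
  have hsub : closedBall c (R / 4) ⊆ ball c (R / 2) := closedBall_subset_ball (by linarith)
  have hR4 : 0 < R / 4 := by positivity
  let R' : NNReal := ⟨R / 4, hR4.le⟩
  have hR' : (R' : ℝ) = R / 4 := rfl
  have hint : CircleIntegrable φ c R' := by
    refine (ContinuousOn.circleIntegrable hR4.le ?_)
    exact hcont.mono (sphere_subset_closedBall.trans hsub)
  -- The Cauchy integral of `φ` is analytic as a map into `C(K, F)`. Evaluation at `ζ` commutes with
  -- it, so the scalar Cauchy formula identifies it with `φ`.
  have hps := hasFPowerSeriesOn_cauchy_integral hint (by exact_mod_cast hR4)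
  refine DifferentiableAt.differentiableWithinAt ?_
  refine (hps.analyticAt.differentiableAt).congr_of_eventuallyEq ?_
  filter_upwards [ball_mem_nhds c hR4] with w hw
  ext ζ
  have hcau : ((2 * Real.pi * Complex.I : ℂ)⁻¹ • ∮ z in C(c, R / 4), (z - w)⁻¹ • φ z ζ) = φ w ζ :=
    DiffContOnCl.two_pi_i_inv_smul_circleIntegral_sub_inv_smul
      ((hd ζ).diffContOnCl_ball ((hsub.trans (ball_subset_ball (by linarith))).trans hRU)) hw
  have hcomm : (∮ z in C(c, R / 4), (z - w)⁻¹ • φ z ζ)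
      = (∮ z in C(c, R / 4), (z - w)⁻¹ • φ z) ζ := by
    have hint' : CircleIntegrable (fun z => (z - w)⁻¹ • φ z) c (R / 4) := by
      refine ContinuousOn.circleIntegrable hR4.le (ContinuousOn.fun_smul ?_
        (hcont.mono (sphere_subset_closedBall.trans hsub)))
      refine ContinuousOn.inv₀ (by fun_prop) fun z hz => sub_ne_zero.2 ?_
      rintro rfl
      exact (mem_sphere.1 hz).not_lt (mem_ball.1 hw)
    have := (ContinuousMap.evalCLM ℂ ζ : C(K, F) →L[ℂ] F).intervalIntegral_comp_comm
      (hint'.out)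
    simpa [circleIntegral] using this
  rw [← hcau, hcomm, hR']
  simp

/-- Bounded Gateaux holomorphic functions on a polydisc are analytic at its centre. -/
theorem GateauxHolomorphicOn.analyticAt_pi (m : ℕ) : ∀ {F : Type u} [NormedAddCommGroup F]
    [NormedSpace ℂ F] [CompleteSpace F] {f : (Fin m → ℂ) → F} {R M : ℝ}, 0 < R →
    GateauxHolomorphicOn f (ball 0 R) → (∀ x ∈ ball 0 R, ‖f x‖ ≤ M) → AnalyticAt ℂ f 0 := by
  induction m with
  | zero =>
    intro F _ _ _ f R M _ _ _
    have : f = fun _ => f 0 := funext fun x => by rw [Subsingleton.elim x 0]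
    rw [this]
    exact analyticAt_const
  | succ m ih =>
    intro F _ _ _ f R M hR hf hM
    have hM0 : 0 ≤ M := (norm_nonneg _).trans (hM 0 (by simpa using hR))
    have hcont := hf.continuousOn isOpen_ball hM
    have hr : 0 < R / 2 := by positivity
    set S := sphere (0 : ℂ) (R / 2) with hS
    have hmem : ∀ {w : ℂ} {e : Fin m → ℂ}, ‖w‖ < R → e ∈ ball (0 : Fin m → ℂ) R →
        (Fin.cons w e : Fin (m + 1) → ℂ) ∈ ball (0 : Fin (m + 1) → ℂ) R := fun {w e} hw he => by
      rw [mem_ball_zero_iff, pi_norm_lt_iff hR] at he ⊢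
      exact Fin.cases (by simpa using hw) (by simpa using he)
    have hSn : ∀ ζ : S, ‖(ζ : ℂ)‖ = R / 2 := fun ζ => mem_sphere_zero_iff_norm.1 ζ.2
    have hconsc : ∀ e : Fin m → ℂ, e ∈ ball (0 : Fin m → ℂ) R →
        Continuous fun ζ : S => f (Fin.cons (ζ : ℂ) e) := fun e he => by
      refine hcont.comp_continuous ?_ fun ζ => hmem (by rw [hSn]; linarith) he
      refine continuous_pi (Fin.cases ?_ fun i => ?_)
      · simpa using continuous_subtype_val
      · simpa using continuous_const
    classical
    -- The first variable is moved into the target space as a point of the circle `S`. This is why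
    -- the induction quantifies over all Banach spaces `F`. The value `0` is never used inside the
    -- ball.
    let G : (Fin m → ℂ) → C(S, F) := fun e =>
      if h : Continuous fun ζ : S => f (Fin.cons (ζ : ℂ) e) then ⟨_, h⟩ else 0
    have hGapp : ∀ e ∈ ball (0 : Fin m → ℂ) R, ∀ ζ : S, G e ζ = f (Fin.cons (ζ : ℂ) e) :=
      fun e he ζ => by simp [G, hconsc e he]
    have hGM : ∀ e ∈ ball (0 : Fin m → ℂ) R, ‖G e‖ ≤ M := fun e he =>
      (ContinuousMap.norm_le _ hM0).2 fun ζ => by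
        rw [hGapp e he]
        exact hM _ (hmem (by rw [hSn]; linarith) he)
    have hG : AnalyticAt ℂ G 0 := by
      refine ih hR (fun a v => ?_) hGM
      refine differentiableOn_continuousMap (isOpen_ball.preimage (by fun_prop))
        (fun t ht => hGM _ ht) fun ζ => ?_
      have := hf (Fin.cons (ζ : ℂ) a) (Fin.cons 0 v)
      have heq : ∀ t : ℂ, (Fin.cons (ζ : ℂ) a + t • Fin.cons 0 v : Fin (m + 1) → ℂ)
          = Fin.cons (ζ : ℂ) (a + t • v) := fun t => by
        refine funext (Fin.cases ?_ fun i => ?_) <;> simp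
      simp only [heq] at this
      refine (this.mono fun t ht => hmem (by rw [hSn]; linarith) ht).congr fun t ht => ?_
      exact hGapp _ ht ζ
    have hkc : ∀ w : ℂ, w ∈ ball (0 : ℂ) (R / 4) →
        Continuous fun ζ : S => ((2 * Real.pi : ℂ)⁻¹ * ζ) * ((ζ : ℂ) - w)⁻¹ := fun w hw => by
      refine Continuous.mul (by fun_prop) (Continuous.inv₀ (by fun_prop) fun ζ => ?_)
      rw [sub_ne_zero]
      intro h
      have := hSn ζ
      rw [h] at this
      rw [mem_ball_zero_iff] at hw
      linarith
    -- The Cauchy kernel in the angular variable: `dζ / (2πi) = ζ dθ / (2π)` on the circle.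
    let k : ℂ → C(S, ℂ) := fun w =>
      if h : Continuous fun ζ : S => ((2 * Real.pi : ℂ)⁻¹ * ζ) * ((ζ : ℂ) - w)⁻¹
        then ⟨_, h⟩ else 0
    have hkapp : ∀ w ∈ ball (0 : ℂ) (R / 4), ∀ ζ : S,
        k w ζ = ((2 * Real.pi : ℂ)⁻¹ * ζ) * ((ζ : ℂ) - w)⁻¹ := fun w hw ζ => by
      simp only [k, dif_pos (hkc w hw), ContinuousMap.coe_mk]
    have hdist : ∀ w ∈ ball (0 : ℂ) (R / 4), ∀ ζ : S, R / 4 ≤ ‖(ζ : ℂ) - w‖ := fun w hw ζ => by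
      have := norm_sub_norm_le (ζ : ℂ) w
      rw [hSn] at this
      rw [mem_ball_zero_iff] at hw
      linarith
    have hk : AnalyticAt ℂ k 0 := by
      have : DifferentiableOn ℂ k (ball 0 (R / 4)) := by
        refine differentiableOn_continuousMap (M := (2 * Real.pi)⁻¹ * (R / 2) * (R / 4)⁻¹)
          isOpen_ball (fun w hw => ?_) fun ζ => ?_
        · refine (ContinuousMap.norm_le _ (by positivity)).2 fun ζ => ?_
          rw [hkapp w hw, norm_mul, norm_mul, norm_inv, norm_inv, hSn]
          have h1 : ‖(2 * Real.pi : ℂ)‖ = 2 * Real.pi := by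
            simp [abs_of_pos Real.pi_pos]
          rw [h1]
          gcongr
          exact hdist w hw ζ
        · refine DifferentiableOn.congr
            (f := fun w => ((2 * Real.pi : ℂ)⁻¹ * ζ) * ((ζ : ℂ) - w)⁻¹) ?_
            fun w hw => hkapp w hw ζ
          refine DifferentiableOn.const_mul (DifferentiableOn.inv (by fun_prop) fun w hw => ?_) _
          have := hdist w hw ζ
          exact norm_pos_iff.1 (by linarith)
      exact this.analyticAt (ball_mem_nhds _ (by positivity))
    let circ : ℝ → S := fun θ => ⟨circleMap 0 (R / 2) θ, circleMap_mem_sphere _ hr.le θ⟩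
    have hcirc : Continuous circ := (continuous_circleMap 0 (R / 2)).subtype_mk _
    have hii : ∀ g : C(S, F), IntervalIntegrable (fun θ => g (circ θ)) volume 0 (2 * Real.pi) :=
      fun g => (g.continuous.comp hcirc).intervalIntegrable _ _
    have hii2 : ∀ (k : C(S, ℂ)) (g : C(S, F)),
        IntervalIntegrable (fun θ => k (circ θ) • g (circ θ)) volume 0 (2 * Real.pi) :=
      fun k g => ((k.continuous.comp hcirc).smul (g.continuous.comp hcirc)).intervalIntegrable _ _
    -- With this bounded bilinear pairing Cauchy's formula reads `f x = B (k (x 0)) (G (Fin.tail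
    -- x))`, a composition of analytic maps.
    let B : C(S, ℂ) →L[ℂ] C(S, F) →L[ℂ] F := LinearMap.mkContinuous₂
      (LinearMap.mk₂ ℂ (fun k g => ∫ θ in (0 : ℝ)..2 * Real.pi, k (circ θ) • g (circ θ))
        (fun k k' g => by
          simp only [ContinuousMap.add_apply, add_smul]
          exact intervalIntegral.integral_add (hii2 k g) (hii2 k' g))
        (fun c k g => by
          simp only [ContinuousMap.smul_apply, smul_assoc]
          exact intervalIntegral.integral_smul c _)
        (fun k g g' => by
          simp only [ContinuousMap.add_apply, smul_add]
          exact intervalIntegral.integral_add (hii2 k g) (hii2 k g'))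
        (fun c k g => by
          simp only [ContinuousMap.smul_apply, smul_comm _ c]
          exact intervalIntegral.integral_smul c _))
      (2 * Real.pi) fun k g => by
        have := intervalIntegral.norm_integral_le_of_norm_le_const (a := 0) (b := 2 * Real.pi)
          (f := fun θ => k (circ θ) • g (circ θ)) (C := ‖k‖ * ‖g‖) fun θ _ => by
            rw [norm_smul]
            gcongr
            exacts [k.norm_coe_le_norm _, g.norm_coe_le_norm _]
        simp only [LinearMap.mk₂_apply]
        refine this.trans (le_of_eq ?_)
        rw [sub_zero, abs_of_pos (by positivity)]
        ring
    have hB : AnalyticAt ℂ (fun x : Fin (m + 1) → ℂ => B (k (x 0)) (G (Fin.tail x))) 0 := by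
      have h0 : AnalyticAt ℂ (fun x : Fin (m + 1) → ℂ => x 0) 0 :=
        (ContinuousLinearMap.proj (R := ℂ) (φ := fun _ : Fin (m + 1) => ℂ) 0).analyticAt 0
      have h1 : AnalyticAt ℂ (fun x : Fin (m + 1) → ℂ => (Fin.tail x : Fin m → ℂ)) 0 :=
        (ContinuousLinearMap.pi fun i : Fin m =>
          ContinuousLinearMap.proj (R := ℂ) (φ := fun _ : Fin (m + 1) => ℂ) i.succ).analyticAt 0
      have hk' : AnalyticAt ℂ (fun x : Fin (m + 1) → ℂ => k (x 0)) 0 :=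
        AnalyticAt.fun_comp (g := k) (f := fun x : Fin (m + 1) → ℂ => x 0) (by simpa using hk) h0
      have hG' : AnalyticAt ℂ (fun x : Fin (m + 1) → ℂ => G (Fin.tail x)) 0 :=
        AnalyticAt.fun_comp (g := G) (f := fun x : Fin (m + 1) → ℂ => (Fin.tail x : Fin m → ℂ))
          (by rwa [show Fin.tail (0 : Fin (m + 1) → ℂ) = 0 from rfl]) h1
      exact AnalyticAt.fun_comp (B.analyticAt_bilinear _) (hk'.prod hG')
    refine hB.congr ?_
    filter_upwards [ball_mem_nhds (0 : Fin (m + 1) → ℂ) (by positivity : 0 < R / 4)] with x hx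
    rw [mem_ball_zero_iff, pi_norm_lt_iff (by positivity)] at hx
    have htail : (Fin.tail x : Fin m → ℂ) ∈ ball (0 : Fin m → ℂ) R := by
      rw [mem_ball_zero_iff, pi_norm_lt_iff hR]
      exact fun i => (hx i.succ).trans (by linarith)
    have hx0 : x 0 ∈ ball (0 : ℂ) (R / 4) := mem_ball_zero_iff.2 (hx 0)
    have hd : DiffContOnCl ℂ (fun w => f (Fin.cons w (Fin.tail x))) (ball 0 (R / 2)) := by
      refine DifferentiableOn.diffContOnCl_ball (U := ball 0 R) ?_
        (closedBall_subset_ball (by linarith))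
      have := hf (Fin.cons 0 (Fin.tail x)) (Fin.cons 1 0)
      have heq : ∀ t : ℂ, (Fin.cons 0 (Fin.tail x) + t • Fin.cons 1 0 : Fin (m + 1) → ℂ)
          = Fin.cons t (Fin.tail x) := fun t => by
        refine funext (Fin.cases ?_ fun i => ?_) <;> simp
      simp only [heq] at this
      exact this.mono fun t ht => hmem (mem_ball_zero_iff.1 ht) htail
    have hcau := hd.two_pi_i_inv_smul_circleIntegral_sub_inv_smul (w := x 0)
      (ball_subset_ball (by linarith) hx0)
    rw [Fin.cons_self_tail] at hcau
    rw [← hcau]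
    simp only [B, LinearMap.mkContinuous₂_apply, LinearMap.mk₂_apply, circleIntegral]
    rw [← intervalIntegral.integral_smul]
    refine intervalIntegral.integral_congr fun θ _ => ?_
    simp only [hkapp _ hx0, hGapp _ htail, circ, deriv_circleMap, smul_smul]
    congr 1
    have : (Real.pi : ℂ) ≠ 0 := by exact_mod_cast Real.pi_ne_zero
    field_simp

/-- Bounded Gateaux holomorphic functions on a ball of a finite dimensional space are analytic at
its centre. -/
theorem GateauxHolomorphicOn.analyticAt [FiniteDimensional ℂ E] [CompleteSpace F] {f : E → F}
    {x : E} {R M : ℝ} (hR : 0 < R) (hf : GateauxHolomorphicOn f (ball x R))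
    (hM : ∀ y ∈ ball x R, ‖f y‖ ≤ M) : AnalyticAt ℂ f x := by
  let e : E ≃L[ℂ] (Fin (Module.finrank ℂ E) → ℂ) :=
    ContinuousLinearEquiv.ofFinrankEq (by simp)
  let g : (Fin (Module.finrank ℂ E) → ℂ) → F := fun w => f (x + e.symm w)
  have hpre : (fun w => x + e.symm w) ⁻¹' ball x R ∈ 𝓝 (0 : Fin (Module.finrank ℂ E) → ℂ) := by
    refine (Continuous.continuousAt (by fun_prop)).preimage_mem_nhds ?_
    simpa using ball_mem_nhds x hR
  obtain ⟨r, hr, hrsub⟩ := Metric.mem_nhds_iff.1 hpre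
  have hg : AnalyticAt ℂ g 0 := by
    refine GateauxHolomorphicOn.analyticAt_pi _ hr (fun a v => ?_) fun w hw => hM _ (hrsub hw)
    have := hf (x + e.symm a) (e.symm v)
    refine (this.mono fun t ht => ?_).congr fun t _ => ?_
    · have := hrsub ht
      simpa [add_assoc] using this
    · simp [g, add_assoc]
  have hcomp : AnalyticAt ℂ (fun y => g (e (y - x))) x := by
    refine AnalyticAt.fun_comp (g := g) (f := fun y => e (y - x)) (by simpa using hg) ?_
    exact AnalyticAt.fun_comp (g := e) (f := fun y => y - x)
      ((e : E →L[ℂ] (Fin (Module.finrank ℂ E) → ℂ)).analyticAt _)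
      (analyticAt_id.sub analyticAt_const)
  refine hcomp.congr (.of_forall fun y => ?_)
  simp [g]

/-- A uniform limit of Gateaux holomorphic functions is Gateaux holomorphic. -/
theorem GateauxHolomorphicOn.of_tendstoUniformlyOn [CompleteSpace F] {f : ℕ → E → F} {g : E → F}
    {U : Set E} (hU : IsOpen U) (hf : ∀ n, GateauxHolomorphicOn (f n) U)
    (h : TendstoUniformlyOn f g atTop U) : GateauxHolomorphicOn g U := fun a v => by
  refine TendstoLocallyUniformlyOn.differentiableOn (φ := atTop)
    (F := fun n (t : ℂ) => f n (a + t • v)) ?_ (.of_forall fun n => hf n a v)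
    (hU.preimage (by fun_prop))
  refine TendstoUniformlyOn.tendstoLocallyUniformlyOn ?_
  exact h.comp (fun t : ℂ => a + t • v)

/-- Holomorphy of integrals depending on a complex parameter. -/
theorem differentiableOn_integral {α : Type*} [MeasurableSpace α] {μ : Measure α}
    {f : ℂ → α → ℂ} {U : Set ℂ} {g : α → ℝ} (hU : IsOpen U)
    (hd : ∀ z, DifferentiableOn ℂ (fun t => f t z) U)
    (hm : ∀ t ∈ U, AEStronglyMeasurable (f t) μ)
    (hb : ∀ t ∈ U, ∀ z, ‖f t z‖ ≤ g z) (hg : Integrable g μ) :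
    DifferentiableOn ℂ (fun t => ∫ z, f t z ∂μ) U := by
  intro c hc
  obtain ⟨R, hR, hRU⟩ := Metric.isOpen_iff.1 hU c hc
  have hder : ∀ z, HasDerivAt (fun t => f t z) (deriv (fun t => f t z) c) c := fun z =>
    ((hd z).differentiableAt (hU.mem_nhds hc)).hasDerivAt
  -- The derivative is a limit of measurable difference quotients along the null sequence `s`.
  have hmeas : AEStronglyMeasurable (fun z => deriv (fun t => f t z) c) μ := by
    let s : ℕ → ℂ := fun n => ((R / 2 / ((n : ℝ) + 1) : ℝ) : ℂ)
    have hs0 : ∀ n, s n ≠ 0 := fun n => by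
      simp only [s]
      exact_mod_cast (by positivity : R / 2 / ((n : ℝ) + 1) ≠ 0)
    have hslim : Tendsto s atTop (𝓝[≠] 0) := by
      refine tendsto_nhdsWithin_iff.2 ⟨?_, .of_forall hs0⟩
      have : Tendsto (fun n : ℕ => R / 2 / ((n : ℝ) + 1)) atTop (𝓝 0) :=
        tendsto_const_nhds.div_atTop (tendsto_natCast_atTop_atTop.atTop_add tendsto_const_nhds)
      simpa only [s, Function.comp_def, Complex.ofReal_zero] using
        (Complex.continuous_ofReal.tendsto 0).comp this
    have hsU : ∀ n, c + s n ∈ U := fun n => hRU <| by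
      simp only [s, mem_ball, dist_self_add_left, Complex.norm_real]
      rw [Real.norm_of_nonneg (by positivity)]
      have : R / 2 / ((n : ℝ) + 1) ≤ R / 2 :=
        div_le_self (by positivity) (by linarith [n.cast_nonneg (α := ℝ)])
      linarith
    refine aestronglyMeasurable_of_tendsto_ae (f := fun n z => (s n)⁻¹ • (f (c + s n) z - f c z))
      atTop (fun n => ((hm _ (hsU n)).sub (hm c hc)).const_smul (s n)⁻¹) (.of_forall fun z => ?_)
    exact (hder z).tendsto_slope_zero.comp hslim
  have hg0 : ∀ z, 0 ≤ g z := fun z => (norm_nonneg _).trans (hb c hc z)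
  -- The bound `4 * g z / R` is the Lipschitz constant given by Cauchy's estimate on half the disc,
  -- so no majorant of the derivative has to be assumed.
  refine ((hasDerivAt_integral_of_dominated_loc_of_lip (μ := μ) (F := f)
    (bound := fun z => 4 * g z / R) (ball_mem_nhds c (half_pos hR)) ?_ ?_ hmeas
    (.of_forall fun z => ?_) ?_ (.of_forall hder)).2.differentiableAt).differentiableWithinAt
  · filter_upwards [hU.mem_nhds hc] with t ht using hm t ht
  · exact hg.mono' (hm c hc) (.of_forall fun z => hb c hc z)
  · refine LipschitzOnWith.of_dist_le_mul fun x hx y hy => ?_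
    have := norm_sub_le_of_differentiableOn_ball (f := fun t => f t z) hR ((hd z).mono hRU)
      (fun t ht => hb t (hRU ht) z) hy hx
    rw [dist_eq_norm, dist_eq_norm, Real.coe_nnabs, abs_of_nonneg (by have := hg0 z; positivity)]
    exact this
  · simpa [mul_div_assoc] using (hg.div_const R).const_mul 4

theorem GateauxHolomorphicOn.integral {α : Type*} [MeasurableSpace α] {μ : Measure α}
    {f : E → α → ℂ} {U : Set E} {g : α → ℝ} (hU : IsOpen U)
    (hd : ∀ z, DifferentiableOn ℂ (fun x => f x z) U)
    (hm : ∀ x ∈ U, AEStronglyMeasurable (f x) μ)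
    (hb : ∀ x ∈ U, ∀ z, ‖f x z‖ ≤ g z) (hg : Integrable g μ) :
    GateauxHolomorphicOn (fun x => ∫ z, f x z ∂μ) U := fun a v =>
  differentiableOn_integral (hU.preimage (by fun_prop)) (fun z => (hd z).gateauxHolomorphicOn a v)
    (fun _ ht => hm _ ht) (fun _ ht z => hb _ ht z) hg

end GateauxHolomorphic

/-! ### Complex cones about positive vectors and their contraction. -/

section Contraction

variable {ι : Type*} [Fintype ι]

/-- The hypothesis, used with one `c` for all coordinates of a vector, says that the vector lies in
a complex cone of relative width `s` about a positive one. This notion of closeness ignores complex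
scaling and recurs throughout. -/
theorem norm_le_of_norm_sub_le {u c : ℂ} {a s : ℝ} (ha : 0 ≤ a) (h : ‖u - c * a‖ ≤ s * ‖c‖ * a) :
    ‖u‖ ≤ (1 + s) * ‖c‖ * a := by
  have h1 : ‖c * a‖ = ‖c‖ * a := by rw [norm_mul, Complex.norm_real, Real.norm_of_nonneg ha]
  have := norm_sub_norm_le u (c * a)
  linarith

theorem le_norm_of_norm_sub_le {u c : ℂ} {a s : ℝ} (ha : 0 ≤ a) (h : ‖u - c * a‖ ≤ s * ‖c‖ * a) :
    (1 - s) * ‖c‖ * a ≤ ‖u‖ := by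
  have h1 : ‖c * a‖ = ‖c‖ * a := by rw [norm_mul, Complex.norm_real, Real.norm_of_nonneg ha]
  have := norm_sub_norm_le (c * a) u
  rw [norm_sub_rev] at this
  linarith

theorem norm_mul_sub_mul_le {u v c : ℂ} {a b s δ : ℝ} (ha : 0 ≤ a) (hb : 0 ≤ b)
    (hu : ‖u - c * a‖ ≤ s * ‖c‖ * a) (hv : ‖v - b‖ ≤ δ * b) (hs : 0 ≤ s) :
    ‖u * v - c * (a * b : ℝ)‖ ≤ (s + δ * (1 + s)) * ‖c‖ * (a * b) := by
  have h1 : u * v - c * (a * b : ℝ) = (u - c * a) * b + u * (v - b) := by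
    push_cast; ring
  calc ‖u * v - c * (a * b : ℝ)‖ ≤ ‖u - c * a‖ * b + ‖u‖ * ‖v - b‖ := by
        rw [h1]
        refine (norm_add_le _ _).trans (le_of_eq ?_)
        rw [norm_mul, norm_mul, Complex.norm_real, Real.norm_of_nonneg hb]
    _ ≤ s * ‖c‖ * a * b + (1 + s) * ‖c‖ * a * (δ * b) := by
        gcongr
        exact norm_le_of_norm_sub_le ha hu
    _ = _ := by ring

theorem norm_sum_sub_le {x : ι → ℂ} {b : ι → ℝ} {c : ℂ} {s : ℝ}
    (h : ∀ i, ‖x i - c * b i‖ ≤ s * ‖c‖ * b i) :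
    ‖∑ i, x i - c * (∑ i, b i : ℝ)‖ ≤ s * ‖c‖ * ∑ i, b i := by
  push_cast
  rw [Finset.mul_sum, ← Finset.sum_sub_distrib, Finset.mul_sum]
  exact (norm_sum_le _ _).trans (Finset.sum_le_sum fun i _ => h i)

/-- Doeblin averaging: multiplication by a matrix with entries in `[β, 1]` replaces a vector that
is dominated by `b` by one which is closer to a multiple of the image of `b`. -/
theorem exists_average [Nonempty ι] {b : ι → ℝ} {P : Matrix ι ι ℝ} {β : ℝ} (hb : ∀ i, 0 < b i)
    (hβ0 : 0 ≤ β) (hβ : ∀ i j, β ≤ P i j) (hP1 : ∀ i j, P i j ≤ 1) {e : ι → ℂ} {t : ℝ}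
    (he : ∀ i, ‖e i‖ ≤ t * b i) :
    ∃ m : ℂ, ‖m‖ ≤ t ∧ ∀ j, ‖∑ i, e i * P i j - β * m * (∑ i, b i * P i j : ℝ)‖
      ≤ (1 - β) * t * ∑ i, b i * P i j := by
  set S := ∑ i, b i with hS
  have hSpos : 0 < S := Finset.sum_pos (fun i _ => hb i) Finset.univ_nonempty
  -- The witness is the average of the ratios `e i / b i` with weights `b i`.
  refine ⟨(∑ i, e i) / S, ?_, fun j => ?_⟩
  · rw [norm_div, Complex.norm_real, Real.norm_of_nonneg hSpos.le, div_le_iff₀ hSpos, hS,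
      Finset.mul_sum]
    exact (norm_sum_le _ _).trans (Finset.sum_le_sum fun i _ => he i)
  · set Sj := ∑ i, b i * P i j with hSj
    have hle : Sj ≤ S := Finset.sum_le_sum fun i _ => mul_le_of_le_one_right (hb i).le (hP1 i j)
    -- Subtracting the common part `β * (Sj / S)` leaves nonnegative weights, since `Sj ≤ S`. Their
    -- sum against `b` is `(1 - β) * Sj`, the source of the contraction.
    have hnn : ∀ i, 0 ≤ P i j - β * (Sj / S) := fun i => by
      have : β * (Sj / S) ≤ β * 1 := by
        gcongr
        exact (div_le_one hSpos).2 hle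
      linarith [hβ i j]
    have heq : ∑ i, e i * P i j - β * ((∑ i, e i) / S) * (Sj : ℂ)
        = ∑ i, e i * ((P i j - β * (Sj / S) : ℝ) : ℂ) := by
      push_cast
      simp only [mul_sub, Finset.sum_sub_distrib, ← Finset.sum_mul]
      ring
    rw [heq]
    calc _ ≤ ∑ i, t * b i * (P i j - β * (Sj / S)) := by
          refine (norm_sum_le _ _).trans (Finset.sum_le_sum fun i _ => ?_)
          rw [norm_mul, Complex.norm_real, Real.norm_of_nonneg (hnn i)]
          exact mul_le_mul_of_nonneg_right (he i) (hnn i)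
      _ = t * (Sj - β * (Sj / S) * S) := by
          rw [hSj, hS, Finset.mul_sum, ← Finset.sum_sub_distrib, Finset.mul_sum]
          exact Finset.sum_congr rfl fun i _ => by ring
      _ = (1 - β) * t * Sj := by
          field_simp

/-- Invariance of the complex cone around the positive vectors under perturbations of a positive
matrix. -/
theorem exists_near_mul [Nonempty ι] {a w : ι → ℝ} {P : Matrix ι ι ℝ} {β s δ : ℝ}
    {M : Matrix ι ι ℂ} {u : ι → ℂ} {c : ℂ}
    (ha : ∀ i, 0 < a i) (hw : ∀ i, 0 < w i) (hβ0 : 0 < β) (hβ : ∀ i j, β ≤ P i j)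
    (hP1 : ∀ i j, P i j ≤ 1) (hs0 : 0 ≤ s) (hs1 : s < 1)
    (hδ : δ * (1 + s) ≤ β * s * (1 - s))
    (hM : ∀ i j, ‖M i j - (w i * P i j : ℝ)‖ ≤ δ * (w i * P i j)) (hc : c ≠ 0)
    (hu : ∀ i, ‖u i - c * a i‖ ≤ s * ‖c‖ * a i) :
    ∃ c' : ℂ, c' ≠ 0 ∧ ∀ j, ‖∑ i, u i * M i j - c' * (∑ i, a i * (w i * P i j) : ℝ)‖
      ≤ s * ‖c'‖ * ∑ i, a i * (w i * P i j) := by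
  have hb : ∀ i, 0 < a i * w i := fun i => mul_pos (ha i) (hw i)
  have hβ1 : β ≤ 1 := (hβ (Classical.arbitrary ι) (Classical.arbitrary ι)).trans (hP1 _ _)
  obtain ⟨m, hm, hm'⟩ := exists_average (e := fun i => (u i - c * a i) * w i) (t := s * ‖c‖) hb
    hβ0.le hβ hP1 fun i => by
      rw [norm_mul, Complex.norm_real, Real.norm_of_nonneg (hw i).le, ← mul_assoc]
      exact mul_le_mul_of_nonneg_right (hu i) (hw i).le
  have hcpos : 0 < ‖c‖ := norm_pos_iff.2 hc
  have hlow : ‖c‖ * (1 - β * s) ≤ ‖c + β * m‖ := by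
    have h1 := norm_sub_norm_le c (-(β * m))
    rw [sub_neg_eq_add, norm_neg, norm_mul, Complex.norm_real, Real.norm_of_nonneg hβ0.le] at h1
    have h2 : β * ‖m‖ ≤ β * (s * ‖c‖) := by gcongr
    linarith
  have hpos : 0 < 1 - β * s := by nlinarith
  refine ⟨c + β * m, norm_pos_iff.1 ((mul_pos hcpos hpos).trans_le hlow), fun j => ?_⟩
  have hassoc : ∀ i, a i * w i * P i j = a i * (w i * P i j) := fun i => mul_assoc _ _ _
  have key := hm' j
  simp only [hassoc] at key
  set Sj := ∑ i, a i * (w i * P i j) with hSj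
  have hwP : ∀ i, 0 ≤ w i * P i j := fun i => mul_nonneg (hw i).le (hβ0.le.trans (hβ i j))
  have hSj0 : 0 ≤ Sj := Finset.sum_nonneg fun i _ => mul_nonneg (ha i).le (hwP i)
  have heq : ∑ i, u i * M i j - (c + β * m) * (Sj : ℂ)
      = (∑ i, (u i - c * a i) * w i * P i j - β * m * (Sj : ℂ))
        + ∑ i, u i * (M i j - (w i * P i j : ℝ)) := by
    have : ∑ i, u i * M i j - c * (Sj : ℂ) = ∑ i, (u i - c * a i) * w i * P i j
        + ∑ i, u i * (M i j - (w i * P i j : ℝ)) := by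
      rw [hSj]
      push_cast
      rw [Finset.mul_sum, ← Finset.sum_sub_distrib, ← Finset.sum_add_distrib]
      exact Finset.sum_congr rfl fun i _ => by ring
    linear_combination this
  have hsec : ‖∑ i, u i * (M i j - (w i * P i j : ℝ))‖ ≤ (1 + s) * ‖c‖ * δ * Sj := by
    rw [hSj, Finset.mul_sum]
    refine (norm_sum_le _ _).trans (Finset.sum_le_sum fun i _ => ?_)
    rw [norm_mul]
    calc _ ≤ ((1 + s) * ‖c‖ * a i) * (δ * (w i * P i j)) :=
          mul_le_mul (norm_le_of_norm_sub_le (ha i).le (hu i)) (hM i j) (norm_nonneg _)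
            (by have := ha i; positivity)
      _ = _ := by ring
  rw [heq]
  calc _ ≤ (1 - β) * (s * ‖c‖) * Sj + (1 + s) * ‖c‖ * δ * Sj :=
        (norm_add_le _ _).trans (add_le_add key hsec)
    _ = ((1 - β) * s + δ * (1 + s)) * (‖c‖ * Sj) := by ring
    -- Averaging shrinks `s` to `(1 - β) * s`, while the new multiplier may be smaller by the factor
    -- `1 - β * s`. The remaining room is `β * s * (1 - s)`, exactly what `hδ` allots to the matrix
    -- error.
    _ ≤ (s * (1 - β * s)) * (‖c‖ * Sj) := by
        gcongr
        nlinarith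
    _ = s * (‖c‖ * (1 - β * s)) * Sj := by ring
    _ ≤ s * ‖c + β * m‖ * Sj := by gcongr

/-- Contraction of the projective distance of two complex vectors, one of which is close to a
positive vector, under perturbations of a positive matrix. -/
theorem exists_contraction [Nonempty ι] {a w : ι → ℝ} {P : Matrix ι ι ℝ} {β σ t ρ : ℝ}
    {M : Matrix ι ι ℂ} {u u' : ι → ℂ} {c d : ℂ}
    (ha : ∀ i, 0 < a i) (hw : ∀ i, 0 < w i) (hβ0 : 0 < β) (hβ : ∀ i j, β ≤ P i j)
    (hP1 : ∀ i j, P i j ≤ 1) (hσ0 : 0 ≤ σ) (hσ1 : σ < 1)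
    (hc : c ≠ 0) (hd : d ≠ 0)
    (hM : ∀ i j, ‖u i * M i j - c * (a i * (w i * P i j) : ℝ)‖
      ≤ σ * ‖c‖ * (a i * (w i * P i j)))
    (ht0 : 0 ≤ t) (ht1 : t < 1) (hu : ∀ i, ‖u' i - d * u i‖ ≤ t * ‖d‖ * ‖u i‖) (hρ0 : 0 ≤ ρ)
    (hρ : 1 - β + 2 * σ ≤ ρ * (1 - σ) * (1 - β * t)) :
    ∃ d' : ℂ, d' ≠ 0 ∧ ∀ j, ‖∑ i, u' i * M i j - d' * ∑ i, u i * M i j‖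
      ≤ ρ * t * ‖d'‖ * ‖∑ i, u i * M i j‖ := by
  have hb : ∀ i, 0 < a i * w i := fun i => mul_pos (ha i) (hw i)
  have hβ1 : β ≤ 1 := (hβ (Classical.arbitrary ι) (Classical.arbitrary ι)).trans (hP1 _ _)
  have hratio : ∀ i, ‖(u' i - d * u i) / u i‖ ≤ t * ‖d‖ := fun i => by
    rw [norm_div]
    exact div_le_of_le_mul₀ (norm_nonneg _) (by positivity) (hu i)
  -- If `u i = 0`, the hypothesis forces `u' i = 0`, so the conventional value of division by zero
  -- is harmless.
  have hmulu : ∀ i, (u' i - d * u i) / u i * u i = u' i - d * u i := fun i => by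
    rcases eq_or_ne (u i) 0 with h0 | h0
    · have := hu i
      rw [h0, norm_zero, mul_zero, mul_zero, sub_zero] at this
      simp [h0, norm_le_zero_iff.1 this]
    · exact div_mul_cancel₀ _ h0
  obtain ⟨m, hm, hm'⟩ := exists_average (e := fun i => (u' i - d * u i) / u i * (a i * w i : ℝ))
    (t := t * ‖d‖) hb hβ0.le hβ hP1 fun i => by
      rw [norm_mul, Complex.norm_real, Real.norm_of_nonneg (hb i).le]
      exact mul_le_mul_of_nonneg_right (hratio i) (hb i).le
  have hdpos : 0 < ‖d‖ := norm_pos_iff.2 hd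
  have hlow : ‖d‖ * (1 - β * t) ≤ ‖d + β * m‖ := by
    have h1 := norm_sub_norm_le d (-(β * m))
    rw [sub_neg_eq_add, norm_neg, norm_mul, Complex.norm_real, Real.norm_of_nonneg hβ0.le] at h1
    have h2 : β * ‖m‖ ≤ β * (t * ‖d‖) := by gcongr
    linarith
  have hpos : 0 < 1 - β * t := by nlinarith
  refine ⟨d + β * m, norm_pos_iff.1 ((mul_pos hdpos hpos).trans_le hlow), fun j => ?_⟩
  have hassoc : ∀ i, a i * w i * P i j = a i * (w i * P i j) := fun i => mul_assoc _ _ _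
  have key := hm' j
  simp only [hassoc] at key
  have hsum := norm_sum_sub_le fun i => hM i j
  have hlow2 := le_norm_of_norm_sub_le (Finset.sum_nonneg fun i _ => by
    have := hβ0.le.trans (hβ i j); have := ha i; have := hw i; positivity) hsum
  set Sj := ∑ i, a i * (w i * P i j) with hSj
  have hSj0 : 0 ≤ Sj := Finset.sum_nonneg fun i _ => by
    have := hβ0.le.trans (hβ i j); have := ha i; have := hw i; positivity
  set v := ∑ i, u i * M i j with hv
  -- Averaging needs positive weights, so the complex weights `u i * M i j` are compared with `c *
  -- (a i * (w i * P i j))`. The comparison is paid for twice, in the sum of ratios and in `v`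
  -- against `c * Sj`; hence the `2 * σ` in `hρ`.
  have heq : ∑ i, u' i * M i j - (d + β * m) * v
      = c * (∑ i, (u' i - d * u i) / u i * (a i * w i : ℝ) * P i j - β * m * (Sj : ℂ))
        + ∑ i, (u' i - d * u i) / u i * (u i * M i j - c * (a i * (w i * P i j) : ℝ))
        - β * m * (v - c * Sj) := by
    have : ∑ i, u' i * M i j - d * v
        = c * (∑ i, (u' i - d * u i) / u i * (a i * w i : ℝ) * P i j)
        + ∑ i, (u' i - d * u i) / u i * (u i * M i j - c * (a i * (w i * P i j) : ℝ)) := by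
      rw [hv, Finset.mul_sum, ← Finset.sum_sub_distrib, Finset.mul_sum, ← Finset.sum_add_distrib]
      refine Finset.sum_congr rfl fun i _ => ?_
      push_cast
      linear_combination -(M i j) * hmulu i
    linear_combination this
  have h1 : ‖c * (∑ i, (u' i - d * u i) / u i * (a i * w i : ℝ) * P i j - β * m * (Sj : ℂ))‖
      ≤ ‖c‖ * ((1 - β) * (t * ‖d‖) * Sj) := by
    rw [norm_mul]
    gcongr
  have h2 : ‖∑ i, (u' i - d * u i) / u i * (u i * M i j - c * (a i * (w i * P i j) : ℝ))‖
      ≤ t * ‖d‖ * (σ * ‖c‖) * Sj := by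
    rw [hSj, Finset.mul_sum]
    refine (norm_sum_le _ _).trans (Finset.sum_le_sum fun i _ => ?_)
    rw [norm_mul, mul_assoc (t * ‖d‖)]
    exact mul_le_mul (hratio i) (hM i j) (norm_nonneg _) (by positivity)
  have h3 : ‖β * m * (v - c * Sj)‖ ≤ 1 * (t * ‖d‖) * (σ * ‖c‖ * Sj) := by
    rw [norm_mul, norm_mul, Complex.norm_real, Real.norm_of_nonneg hβ0.le]
    gcongr
  rw [heq]
  calc _ ≤ ‖c‖ * ((1 - β) * (t * ‖d‖) * Sj) + t * ‖d‖ * (σ * ‖c‖) * Sj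
        + 1 * (t * ‖d‖) * (σ * ‖c‖ * Sj) :=
        (norm_sub_le _ _).trans (add_le_add ((norm_add_le _ _).trans (add_le_add h1 h2)) h3)
    _ = (1 - β + 2 * σ) * (t * ‖d‖ * (‖c‖ * Sj)) := by ring
    _ ≤ (ρ * (1 - σ) * (1 - β * t)) * (t * ‖d‖ * (‖c‖ * Sj)) := by gcongr
    _ = ρ * t * (‖d‖ * (1 - β * t)) * ((1 - σ) * ‖c‖ * Sj) := by ring
    _ ≤ ρ * t * ‖d + β * m‖ * ‖v‖ := by
        have : 0 ≤ (1 - σ) * ‖c‖ * Sj := mul_nonneg (mul_nonneg (by linarith) (norm_nonneg _)) hSj0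
        gcongr

/-- The quotient of two linear functionals of a vector close to a positive vector. -/
theorem norm_div_sub_le {f g c : ℂ} {F G σ : ℝ} (hF : 0 < F) (hG : 0 < G)
    (hσ : σ ≤ 1 / 5) (hc : c ≠ 0) (hf : ‖f - c * F‖ ≤ σ * ‖c‖ * F)
    (hg : ‖g - c * G‖ ≤ σ * ‖c‖ * G) : ‖f / g - (F / G : ℝ)‖ ≤ 1 / 2 * (F / G) := by
  have hcpos : 0 < ‖c‖ := norm_pos_iff.2 hc
  have hglow := le_norm_of_norm_sub_le hG.le hg
  have hgpos : 0 < ‖g‖ := lt_of_lt_of_le (by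
    have : 0 < 1 - σ := by linarith
    positivity) hglow
  have hg0 : g ≠ 0 := norm_pos_iff.1 hgpos
  have hG0 : (G : ℂ) ≠ 0 := by exact_mod_cast hG.ne'
  have heq : f / g - (F / G : ℝ) = ((f - c * F) * G - (g - c * G) * F) / (g * G) := by
    push_cast
    field_simp
    ring
  rw [heq, norm_div, div_le_iff₀ (by simp [hG.ne', hg0])]
  calc _ ≤ ‖f - c * F‖ * G + ‖g - c * G‖ * F := by
        refine (norm_sub_le _ _).trans (le_of_eq ?_)
        rw [norm_mul, norm_mul, Complex.norm_real, Complex.norm_real, Real.norm_of_nonneg hF.le,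
          Real.norm_of_nonneg hG.le]
    _ ≤ σ * ‖c‖ * F * G + σ * ‖c‖ * G * F := by gcongr
    _ = (2 * σ) * (F * ‖c‖ * G) := by ring
    -- The condition `2 * σ ≤ (1 - σ) / 2` is `σ ≤ 1 / 5`.
    _ ≤ (1 / 2 * (1 - σ)) * (F * ‖c‖ * G) := by
        exact mul_le_mul_of_nonneg_right (by linarith) (by positivity)
    _ = 1 / 2 * F * ((1 - σ) * ‖c‖ * G) := by ring
    _ ≤ 1 / 2 * F * ‖g‖ := by gcongr
    _ = 1 / 2 * (F / G) * ‖g * G‖ := by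
        rw [norm_mul, Complex.norm_real, Real.norm_of_nonneg hG.le]
        field_simp

theorem re_pos_of_norm_sub_le {R : ℂ} {H : ℝ} (hH : 0 < H) (h : ‖R - H‖ ≤ 1 / 2 * H) :
    0 < R.re := by
  have := (Complex.abs_re_le_norm (R - H)).trans h
  rw [Complex.sub_re, Complex.ofReal_re, abs_le] at this
  linarith

/-- The real part of the logarithm is within `log 2` of `log H`, the argument is at most `π`, and `π
+ log 2 < 5`. -/
theorem norm_log_le_of_norm_sub_le {R : ℂ} {H : ℝ} (hH : 0 < H) (h : ‖R - H‖ ≤ 1 / 2 * H) :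
    ‖Complex.log R‖ ≤ 5 + |Real.log H| := by
  have h' : ‖R - 1 * H‖ ≤ 1 / 2 * ‖(1 : ℂ)‖ * H := by simpa using h
  have hup := norm_le_of_norm_sub_le hH.le h'
  have hlow := le_norm_of_norm_sub_le hH.le h'
  simp only [norm_one, mul_one] at hup hlow
  have hRpos : 0 < ‖R‖ := lt_of_lt_of_le (by linarith) hlow
  have harg := Complex.abs_arg_le_pi R
  have hpi := Real.pi_lt_d2
  have hl2 := Real.log_two_lt_d9
  have h1 : Real.log ‖R‖ ≤ Real.log 2 + Real.log H := by
    rw [← Real.log_mul (by norm_num) hH.ne']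
    exact Real.log_le_log hRpos (by linarith)
  have h2 : Real.log H - Real.log 2 ≤ Real.log ‖R‖ := by
    rw [← Real.log_div hH.ne' (by norm_num)]
    exact Real.log_le_log (by linarith) (by linarith)
  have h3 : |Real.log ‖R‖| ≤ Real.log 2 + |Real.log H| := by
    rw [abs_le]
    constructor
    · linarith [neg_abs_le (Real.log H)]
    · linarith [le_abs_self (Real.log H)]
  have := Complex.norm_le_abs_re_add_abs_im (Complex.log R)
  rw [Complex.log_re, Complex.log_im] at this
  linarith

/-- The logarithms of two close quotients are close. -/
theorem norm_log_sub_log_le {f g f' g' d : ℂ} {t : ℝ} (ht0 : 0 ≤ t) (ht : t ≤ 1 / 16)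
    (hd : d ≠ 0) (hre : 0 < (f / g).re)
    (hf : ‖f' - d * f‖ ≤ 2 * t * ‖d‖ * ‖f‖) (hg : ‖g' - d * g‖ ≤ 2 * t * ‖d‖ * ‖g‖) :
    ‖Complex.log (f' / g') - Complex.log (f / g)‖ ≤ 8 * t := by
  have hR0 : f / g ≠ 0 := fun h => by simp [h] at hre
  have hf0 : f ≠ 0 := fun h => hR0 (by simp [h])
  have hg0 : g ≠ 0 := fun h => hR0 (by simp [h])
  have haux : ∀ {h h' : ℂ}, h ≠ 0 → ‖h' - d * h‖ ≤ 2 * t * ‖d‖ * ‖h‖ →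
      ‖h' / (d * h) - 1‖ ≤ 2 * t := fun {h h'} h0 hh => by
    have : h' / (d * h) - 1 = (h' - d * h) / (d * h) := by field_simp
    rw [this, norm_div, div_le_iff₀ (by simp [hd, h0]), norm_mul]
    linarith
  set x := f' / (d * f) - 1 with hx
  set y := g' / (d * g) - 1 with hy
  have hxn : ‖x‖ ≤ 2 * t := haux hf0 hf
  have hyn : ‖y‖ ≤ 2 * t := haux hg0 hg
  have hy1 : 1 - 2 * t ≤ ‖1 + y‖ := by
    have := norm_sub_norm_le (1 : ℂ) (-y)
    rw [norm_neg, norm_one, sub_neg_eq_add] at this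
    linarith
  have hy0 : 1 + y ≠ 0 := norm_pos_iff.1 (by linarith)
  -- The multiplier `d` cancels in the quotient, which leaves `f' / g' = f / g * (1 + ω)`.
  set ω := (x - y) / (1 + y) with hω
  have hωn : ‖ω‖ ≤ 5 * t := by
    rw [hω, norm_div, div_le_iff₀ (by linarith)]
    have := norm_sub_le x y
    nlinarith
  have hω2 : ‖ω‖ ≤ 1 / 2 := by linarith
  have hre2 : 0 < (1 + ω).re := by
    have := (Complex.abs_re_le_norm ω).trans hω2
    rw [abs_le] at this
    rw [Complex.add_re, Complex.one_re]
    linarith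
  have heq : f' / g' = f / g * (1 + ω) := by
    have h1 : f' = d * f * (1 + x) := by rw [hx]; field_simp; ring
    have h2 : g' = d * g * (1 + y) := by rw [hy]; field_simp; ring
    rw [h1, h2, hω]
    field_simp
    ring
  have harg1 := Complex.abs_arg_lt_pi_div_two_iff.2 (Or.inl hre)
  have harg2 := Complex.abs_arg_lt_pi_div_two_iff.2 (Or.inl hre2)
  rw [abs_lt] at harg1 harg2
  -- Both factors lie in the right half plane, so their arguments add without leaving the principal
  -- branch.
  rw [heq, Complex.log_mul hR0 (fun h => by simp [h] at hre2)
    ⟨by linarith, by linarith⟩, add_sub_cancel_left]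
  calc _ ≤ 3 / 2 * ‖ω‖ := Complex.norm_log_one_add_half_le_self hω2
    _ ≤ 8 * t := by linarith

end Contraction

/-! ### Forward recursion for the joint weights of states and outputs. -/

section Forward

variable {ι R : Type*} [Fintype ι] [CommSemiring R]

/-- The forward vector: its `i`-th entry is the joint weight of the outputs `z 0, …, z (n-1)` and
of the `n`-th state being `i`. -/
def fwd (p : ι → R) (P : Matrix ι ι R) (q : ι → ℝ → R) : (n : ℕ) → (Fin n → ℝ) → ι → R
  | 0, _ => p
  | n + 1, z => fun j =>
      ∑ i, fwd p P q n (Fin.init z) i * (q i (z (Fin.last n)) * P i j)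

/-- The joint weight of the outputs `z 0, …, z n`. -/
def dens (p : ι → R) (P : Matrix ι ι R) (q : ι → ℝ → R) (n : ℕ) (z : Fin (n + 1) → ℝ) : R :=
  ∑ i, fwd p P q n (Fin.init z) i * q i (z (Fin.last n))

variable (p : ι → R) (P : Matrix ι ι R) (q : ι → ℝ → R)

@[simp] theorem fwd_zero (z : Fin 0 → ℝ) : fwd p P q 0 z = p := rfl

theorem fwd_succ (n : ℕ) (z : Fin (n + 1) → ℝ) (j : ι) : fwd p P q (n + 1) z j =
    ∑ i, fwd p P q n (Fin.init z) i * (q i (z (Fin.last n)) * P i j) := rfl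

/-- The oldest output is absorbed into the initial vector. Histories with and without it therefore
differ only in their initial vectors. -/
theorem fwd_succ_tail (n : ℕ) (z : Fin (n + 1) → ℝ) : fwd p P q (n + 1) z =
    fwd (fun j => ∑ i, p i * (q i (z 0) * P i j)) P q n (Fin.tail z) := by
  induction n with
  | zero => rfl
  | succ n ih =>
    funext j
    rw [fwd_succ, fwd_succ]
    refine Finset.sum_congr rfl fun i _ => ?_
    rw [ih (Fin.init z), Fin.tail_init_eq_init_tail]
    rfl

theorem dens_succ_tail (n : ℕ) (z : Fin (n + 2) → ℝ) : dens p P q (n + 1) z =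
    dens (fun j => ∑ i, p i * (q i (z 0) * P i j)) P q n (Fin.tail z) := by
  simp only [dens]
  refine Finset.sum_congr rfl fun i _ => ?_
  rw [fwd_succ_tail, Fin.tail_init_eq_init_tail]
  rfl

/-- The forward vector already contains the transition out of the last emitting state, and summing
over its target erases that transition. -/
theorem sum_fwd_succ (hP : ∀ i, ∑ j, P i j = 1) (n : ℕ) (z : Fin (n + 1) → ℝ) :
    ∑ j, fwd p P q (n + 1) z j = dens p P q n z := by
  simp only [fwd_succ, dens]
  rw [Finset.sum_comm]
  refine Finset.sum_congr rfl fun i _ => ?_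
  rw [← Finset.mul_sum, ← Finset.mul_sum, hP, mul_one]

theorem fwd_linear {κ : Type*} (s : Finset κ) (c : κ → R) (v : κ → ι → R) (n : ℕ)
    (z : Fin n → ℝ) (j : ι) : fwd (fun i => ∑ k ∈ s, c k * v k i) P q n z j =
      ∑ k ∈ s, c k * fwd (v k) P q n z j := by
  induction n generalizing j with
  | zero => rfl
  | succ n ih =>
    simp only [fwd_succ, ih, Finset.sum_mul, Finset.mul_sum]
    rw [Finset.sum_comm]
    exact Finset.sum_congr rfl fun k _ => Finset.sum_congr rfl fun i _ => by ring

theorem dens_linear {κ : Type*} (s : Finset κ) (c : κ → R) (v : κ → ι → R) (n : ℕ)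
    (z : Fin (n + 1) → ℝ) : dens (fun i => ∑ k ∈ s, c k * v k i) P q n z =
      ∑ k ∈ s, c k * dens (v k) P q n z := by
  simp only [dens, fwd_linear, Finset.sum_mul, Finset.mul_sum]
  rw [Finset.sum_comm]
  exact Finset.sum_congr rfl fun k _ => Finset.sum_congr rfl fun i _ => by ring

theorem fwd_map {S : Type*} [CommSemiring S] (f : R →+* S) (n : ℕ) (z : Fin n → ℝ) (j : ι) :
    f (fwd p P q n z j) = fwd (fun i => f (p i)) (fun i j => f (P i j)) (fun i z => f (q i z))
      n z j := by
  induction n generalizing j with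
  | zero => rfl
  | succ n ih =>
    simp only [fwd_succ, map_sum, map_mul, ih]
    rfl

theorem dens_map {S : Type*} [CommSemiring S] (f : R →+* S) (n : ℕ) (z : Fin (n + 1) → ℝ) :
    f (dens p P q n z) = dens (fun i => f (p i)) (fun i j => f (P i j)) (fun i z => f (q i z))
      n z := by
  simp only [dens, map_sum, map_mul, fwd_map]

end Forward

/-! ### Positive models, complex perturbations and loss of memory. -/

section Perturbation

variable {ι : Type*} [Fintype ι]

/-- A stationary hidden Markov model with positive transition probabilities (bounded below by `β`)
and positive output densities. -/
structure IsPositiveModel (β : ℝ) (p₀ : ι → ℝ) (P₀ : Matrix ι ι ℝ) (q₀ : ι → ℝ → ℝ) : Prop where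
  pos : 0 < β
  le_transition : ∀ i j, β ≤ P₀ i j
  row_sum : ∀ i, ∑ j, P₀ i j = 1
  stationary : ∀ j, ∑ i, p₀ i * P₀ i j = p₀ j
  sum_init : ∑ i, p₀ i = 1
  init_nonneg : ∀ i, 0 ≤ p₀ i
  density_pos : ∀ i z, 0 < q₀ i z

/-- The entries of the complex model `(p, P, q)` are close, in the relative sense, to those of the
positive model `(p₀, P₀, q₀)`. -/
structure IsPerturbation (δ : ℝ) (p₀ : ι → ℝ) (P₀ : Matrix ι ι ℝ) (q₀ : ι → ℝ → ℝ)
    (p : ι → ℂ) (P : Matrix ι ι ℂ) (q : ι → ℝ → ℂ) : Prop where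
  init : ∀ i, ‖p i - p₀ i‖ ≤ δ * p₀ i
  transition : ∀ i j, ‖P i j - P₀ i j‖ ≤ δ * P₀ i j
  density : ∀ i z, ‖q i z - q₀ i z‖ ≤ δ * q₀ i z

variable {β δ : ℝ} {p₀ : ι → ℝ} {P₀ : Matrix ι ι ℝ} {q₀ : ι → ℝ → ℝ}
  {p : ι → ℂ} {P : Matrix ι ι ℂ} {q : ι → ℝ → ℂ}

namespace IsPositiveModel

variable (h : IsPositiveModel β p₀ P₀ q₀)
include h

theorem nonempty : Nonempty ι := by
  by_contra hne
  rw [not_nonempty_iff] at hne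
  simpa using h.sum_init

theorem transition_pos (i j : ι) : 0 < P₀ i j := h.pos.trans_le (h.le_transition i j)

theorem transition_le_one (i j : ι) : P₀ i j ≤ 1 := by
  rw [← h.row_sum i]
  exact Finset.single_le_sum (fun j _ => (h.transition_pos i j).le) (Finset.mem_univ j)

theorem le_one : β ≤ 1 := by
  obtain ⟨i⟩ := h.nonempty
  exact (h.le_transition i i).trans (h.transition_le_one i i)

theorem le_init (j : ι) : β ≤ p₀ j := by
  rw [← h.stationary j]
  calc β = ∑ i, p₀ i * β := by rw [← Finset.sum_mul, h.sum_init, one_mul]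
    _ ≤ _ := Finset.sum_le_sum fun i _ =>
      mul_le_mul_of_nonneg_left (h.le_transition i j) (h.init_nonneg i)

theorem init_pos (i : ι) : 0 < p₀ i := h.pos.trans_le (h.le_init i)

theorem init_le_one (i : ι) : p₀ i ≤ 1 := by
  rw [← h.sum_init]
  exact Finset.single_le_sum (fun j _ => h.init_nonneg j) (Finset.mem_univ i)

theorem fwd_pos (n : ℕ) (z : Fin n → ℝ) (j : ι) : 0 < fwd p₀ P₀ q₀ n z j := by
  have := h.nonempty
  induction n generalizing j with
  | zero => exact h.init_pos j
  | succ n ih =>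
    exact Finset.sum_pos (fun i _ => mul_pos (ih _ i)
      (mul_pos (h.density_pos _ _) (h.transition_pos _ _))) Finset.univ_nonempty

theorem sum_fwd_pos (n : ℕ) (z : Fin n → ℝ) : 0 < ∑ j, fwd p₀ P₀ q₀ n z j := by
  have := h.nonempty
  exact Finset.sum_pos (fun i _ => h.fwd_pos n z i) Finset.univ_nonempty

theorem dens_pos (n : ℕ) (z : Fin (n + 1) → ℝ) : 0 < dens p₀ P₀ q₀ n z := by
  have := h.nonempty
  exact Finset.sum_pos (fun i _ => mul_pos (h.fwd_pos n _ i) (h.density_pos _ _))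
    Finset.univ_nonempty

theorem dens_le_mul (n : ℕ) (z : Fin (n + 1) → ℝ) : dens p₀ P₀ q₀ n z ≤
    (∑ j, fwd p₀ P₀ q₀ n (Fin.init z) j) * ∑ i, q₀ i (z (Fin.last n)) := by
  rw [dens, Finset.sum_mul]
  refine Finset.sum_le_sum fun i _ => mul_le_mul_of_nonneg_left ?_ (h.fwd_pos n _ i).le
  exact Finset.single_le_sum (f := fun i => q₀ i (z (Fin.last n)))
    (fun i _ => (h.density_pos i _).le) (Finset.mem_univ i)

theorem sum_density_nonneg (x : ℝ) : 0 ≤ ∑ i, q₀ i x :=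
  Finset.sum_nonneg fun i _ => (h.density_pos i x).le

theorem sum_fwd_le (n : ℕ) (z : Fin n → ℝ) :
    ∑ j, fwd p₀ P₀ q₀ n z j ≤ ∏ k, ∑ i, q₀ i (z k) := by
  induction n with
  | zero => simp [h.sum_init]
  | succ n ih =>
    rw [sum_fwd_succ _ _ _ h.row_sum, Fin.prod_univ_castSucc]
    exact (h.dens_le_mul n z).trans
      (mul_le_mul_of_nonneg_right (ih (Fin.init z)) (h.sum_density_nonneg _))

theorem dens_le (n : ℕ) (z : Fin (n + 1) → ℝ) :
    dens p₀ P₀ q₀ n z ≤ ∏ k, ∑ i, q₀ i (z k) := by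
  rw [← sum_fwd_succ _ _ _ h.row_sum]
  exact h.sum_fwd_le _ _

/-- The conditional density is a weighted mean of the values `q₀ i (z (Fin.last n))`, hence lies
between the smallest and the largest of them. -/
theorem abs_log_quotient_le (n : ℕ) (z : Fin (n + 1) → ℝ) :
    |Real.log (dens p₀ P₀ q₀ n z / ∑ j, fwd p₀ P₀ q₀ n (Fin.init z) j)|
      ≤ ∑ i, |Real.log (q₀ i (z (Fin.last n)))| := by
  have := h.nonempty
  have hG := h.sum_fwd_pos n (Fin.init z)
  have hsingle : ∀ i, |Real.log (q₀ i (z (Fin.last n)))|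
      ≤ ∑ i, |Real.log (q₀ i (z (Fin.last n)))| := fun i =>
    Finset.single_le_sum (f := fun i => |Real.log (q₀ i (z (Fin.last n)))|)
      (fun i _ => abs_nonneg _) (Finset.mem_univ i)
  obtain ⟨a, ha⟩ := Finite.exists_max fun i => q₀ i (z (Fin.last n))
  obtain ⟨b, hb⟩ := Finite.exists_min fun i => q₀ i (z (Fin.last n))
  have hup : dens p₀ P₀ q₀ n z / ∑ j, fwd p₀ P₀ q₀ n (Fin.init z) j ≤ q₀ a (z (Fin.last n)) := by
    rw [div_le_iff₀ hG, dens, Finset.mul_sum]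
    refine Finset.sum_le_sum fun i _ => ?_
    rw [mul_comm]
    exact mul_le_mul_of_nonneg_right (ha i) (h.fwd_pos n _ i).le
  have hlow : q₀ b (z (Fin.last n)) ≤ dens p₀ P₀ q₀ n z / ∑ j, fwd p₀ P₀ q₀ n (Fin.init z) j := by
    rw [le_div_iff₀ hG, dens, Finset.mul_sum]
    refine Finset.sum_le_sum fun i _ => ?_
    rw [mul_comm]
    exact mul_le_mul_of_nonneg_left (hb i) (h.fwd_pos n _ i).le
  have h1 := Real.log_le_log (div_pos (h.dens_pos n z) hG) hup
  have h2 := Real.log_le_log (h.density_pos _ _) hlow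
  rw [abs_le]
  constructor
  · linarith [hsingle b, neg_abs_le (Real.log (q₀ b (z (Fin.last n))))]
  · linarith [hsingle a, le_abs_self (Real.log (q₀ a (z (Fin.last n))))]

theorem pow_le_one (k : ℕ) : β ^ k ≤ 1 := pow_le_one₀ h.pos.le h.le_one

end IsPositiveModel

namespace IsPerturbation

variable (hp : IsPerturbation δ p₀ P₀ q₀ p P q)

include hp in
theorem norm_density_mul_transition_sub_le (h : IsPositiveModel β p₀ P₀ q₀) (hδ0 : 0 ≤ δ)
    (hδ1 : δ ≤ 1) (i j : ι) (x : ℝ) :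
    ‖q i x * P i j - (q₀ i x * P₀ i j : ℝ)‖ ≤ 3 * δ * (q₀ i x * P₀ i j) := by
  have h1 := norm_mul_sub_mul_le (c := 1) (s := δ) (h.density_pos i x).le (h.transition_pos i j).le
    (by simpa using hp.density i x) (hp.transition i j) hδ0
  simp only [one_mul, norm_one, mul_one] at h1
  refine h1.trans (mul_le_mul_of_nonneg_right (by nlinarith)
    (mul_nonneg (h.density_pos i x).le (h.transition_pos i j).le))

include hp in
theorem norm_density_le (h : IsPositiveModel β p₀ P₀ q₀) (i : ι) (x : ℝ) :
    ‖q i x‖ ≤ (1 + δ) * q₀ i x := by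
  have := norm_le_of_norm_sub_le (c := 1) (h.density_pos i x).le (by simpa using hp.density i x)
  simpa using this

include hp in
theorem norm_transition_le (h : IsPositiveModel β p₀ P₀ q₀) (i j : ι) :
    ‖P i j‖ ≤ (1 + δ) * P₀ i j := by
  have := norm_le_of_norm_sub_le (c := 1) (h.transition_pos i j).le
    (by simpa using hp.transition i j)
  simpa using this

include hp in
-- Each letter costs two factors `1 + δ`, one for the transition and one for the density. The
-- initial vector is free because rows of `P` are also used as initial vectors, through
-- `norm_row_le`.
theorem norm_fwd_le (h : IsPositiveModel β p₀ P₀ q₀) {v : ι → ℂ} {K : ℝ}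
    (hv : ∀ j, ‖v j‖ ≤ K * p₀ j) (n : ℕ) (z : Fin n → ℝ) (j : ι) :
    ‖fwd v P q n z j‖ ≤ K * (1 + δ) ^ (2 * n) * fwd p₀ P₀ q₀ n z j := by
  induction n generalizing j with
  | zero => simpa using hv j
  | succ n ih =>
    rw [fwd_succ, fwd_succ, Finset.mul_sum]
    refine (norm_sum_le _ _).trans (Finset.sum_le_sum fun i _ => ?_)
    rw [norm_mul, norm_mul]
    calc _ ≤ (K * (1 + δ) ^ (2 * n) * fwd p₀ P₀ q₀ n (Fin.init z) i)
          * (((1 + δ) * q₀ i (z (Fin.last n))) * ((1 + δ) * P₀ i j)) := by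
          refine mul_le_mul (ih _ i) ?_ (by positivity) ((norm_nonneg _).trans (ih _ i))
          exact mul_le_mul (hp.norm_density_le h _ _) (hp.norm_transition_le h _ _) (norm_nonneg _)
            ((norm_nonneg _).trans (hp.norm_density_le h _ _))
      _ = _ := by ring

include hp in
theorem norm_dens_le (h : IsPositiveModel β p₀ P₀ q₀) {v : ι → ℂ} {K : ℝ}
    (hv : ∀ j, ‖v j‖ ≤ K * p₀ j) (n : ℕ) (z : Fin (n + 1) → ℝ) :
    ‖dens v P q n z‖ ≤ K * (1 + δ) ^ (2 * n + 1) * dens p₀ P₀ q₀ n z := by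
  rw [dens, dens, Finset.mul_sum]
  refine (norm_sum_le _ _).trans (Finset.sum_le_sum fun i _ => ?_)
  rw [norm_mul]
  calc _ ≤ (K * (1 + δ) ^ (2 * n) * fwd p₀ P₀ q₀ n (Fin.init z) i)
        * ((1 + δ) * q₀ i (z (Fin.last n))) :=
        mul_le_mul (hp.norm_fwd_le h hv _ _ i) (hp.norm_density_le h _ _) (norm_nonneg _)
          ((norm_nonneg _).trans (hp.norm_fwd_le h hv _ _ i))
    _ = _ := by ring

include hp in
theorem norm_init_le (h : IsPositiveModel β p₀ P₀ q₀) (j : ι) : ‖p j‖ ≤ (1 + δ) * p₀ j := by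
  have := norm_le_of_norm_sub_le (c := 1) (h.init_pos j).le (by simpa using hp.init j)
  simpa using this

include hp in
theorem norm_row_le (h : IsPositiveModel β p₀ P₀ q₀) (hδ0 : 0 ≤ δ) (i j : ι) :
    ‖P i j‖ ≤ (1 + δ) / β * p₀ j := by
  have h1 := hp.norm_transition_le h i j
  have h2 := h.transition_le_one i j
  have h3 : 1 ≤ β⁻¹ * p₀ j := by
    rw [inv_mul_eq_div, one_le_div h.pos]
    exact h.le_init j
  calc ‖P i j‖ ≤ (1 + δ) * P₀ i j := h1
    _ ≤ (1 + δ) * (β⁻¹ * p₀ j) := by gcongr; linarith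
    _ = _ := by ring

end IsPerturbation

/-- The size of the perturbations of a positive model with lower bound `β` that are admitted. -/
noncomputable def pertSize (β : ℝ) : ℝ := β ^ 4 / 200

variable (h : IsPositiveModel β p₀ P₀ q₀) (hp : IsPerturbation (pertSize β) p₀ P₀ q₀ p P q)

include h in
theorem IsPositiveModel.pertSize_pos : 0 < pertSize β := by
  have := h.pos
  unfold pertSize
  positivity

include h in
theorem IsPositiveModel.pertSize_le : pertSize β ≤ β ^ 3 / 200 := by
  have h1 := h.le_one
  have : β ^ 4 ≤ β ^ 3 := pow_le_pow_of_le_one h.pos.le h1 (by norm_num)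
  unfold pertSize
  linarith

include h hp in
-- The cone of width `s = β ^ 3 / 16` is invariant by `exists_near_mul`. The available room `β * s *
-- (1 - s)` is of order `β ^ 4`, which dictates the size of `pertSize`.
theorem exists_near_fwd (n : ℕ) (z : Fin n → ℝ) : ∃ c : ℂ, c ≠ 0 ∧
    ∀ i, ‖fwd p P q n z i - c * fwd p₀ P₀ q₀ n z i‖ ≤ β ^ 3 / 16 * ‖c‖ * fwd p₀ P₀ q₀ n z i := by
  have := h.nonempty
  have hβ := h.pos
  have hδ := h.pertSize_le
  have hδ0 := h.pertSize_pos
  have h3 := h.pow_le_one 3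
  have hβ3 : 0 < β ^ 3 := by positivity
  have hδ1 : pertSize β ≤ 1 := by linarith
  induction n with
  | zero =>
    refine ⟨1, one_ne_zero, fun i => ?_⟩
    simp only [fwd_zero, one_mul, norm_one, mul_one]
    exact (hp.init i).trans (mul_le_mul_of_nonneg_right (by linarith) (h.init_pos i).le)
  | succ n ih =>
    obtain ⟨c, hc, hcu⟩ := ih (Fin.init z)
    refine exists_near_mul (M := fun i j => q i (z (Fin.last n)) * P i j)
      (w := fun i => q₀ i (z (Fin.last n))) (δ := 3 * pertSize β)
      (h.fwd_pos n _) (fun i => h.density_pos i _) h.pos h.le_transition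
      h.transition_le_one (by positivity) (by linarith) ?_
      (fun i j => hp.norm_density_mul_transition_sub_le h hδ0.le hδ1 i j _) hc hcu
    unfold pertSize
    have h4 : 0 < β ^ 4 := by positivity
    have h7 : β ^ 4 * β ^ 3 ≤ β ^ 4 * 1 := by gcongr
    nlinarith

include h hp in
-- Both vectors are images under the same matrix product, started before and after the oldest
-- letter. Their initial projective distance is at most `1 - β ^ 2 / 2`, and each further letter
-- contracts it by `1 - β ^ 3 / 8`.
theorem exists_near_fwd_tail (n : ℕ) (z : Fin (n + 1) → ℝ) : ∃ d : ℂ, d ≠ 0 ∧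
    ∀ i, ‖fwd p P q n (Fin.tail z) i - d * fwd p P q (n + 1) z i‖
      ≤ (1 - β ^ 3 / 8) ^ n * (1 - β ^ 2 / 2) * ‖d‖ * ‖fwd p P q (n + 1) z i‖ := by
  have := h.nonempty
  have hβ := h.pos
  have hβ1 := h.le_one
  have hδ := h.pertSize_le
  have hδ0 := h.pertSize_pos
  have h3 := h.pow_le_one 3
  have h2 := h.pow_le_one 2
  have hβ3 : 0 < β ^ 3 := by positivity
  have hβ2 : 0 < β ^ 2 := by positivity
  have hδ1 : pertSize β ≤ 1 := by linarith
  have hρ0 : 0 ≤ 1 - β ^ 3 / 8 := by linarith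
  have hρ1 : 1 - β ^ 3 / 8 ≤ 1 := by linarith
  induction n with
  | zero =>
    set x := z 0 with hx
    set S := ∑ i, p₀ i * q₀ i x with hS
    have hw : ∀ i, 0 < p₀ i * q₀ i x := fun i => mul_pos (h.init_pos i) (h.density_pos i x)
    have hSpos : 0 < S := Finset.sum_pos (fun i _ => hw i) Finset.univ_nonempty
    have hD : 0 < (β * S)⁻¹ := by positivity
    -- The unperturbed image `a` lies in `[β * S, S]`, so this scaling puts it in `[1, β⁻¹]`, above
    -- `p₀ j ∈ [β, 1]`. The relative difference is then at most `1 - β ^ 2`, and half of `β ^ 2` is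
    -- kept for the perturbation.
    refine ⟨((β * S)⁻¹ : ℝ), by exact_mod_cast hD.ne', fun j => ?_⟩
    have hfwd : fwd p P q (0 + 1) z j = ∑ i, p i * (q i x * P i j) := rfl
    set a := ∑ i, p₀ i * (q₀ i x * P₀ i j) with ha
    have hlow : β * S ≤ a := by
      rw [hS, ha, Finset.mul_sum]
      refine Finset.sum_le_sum fun i _ => ?_
      have := mul_le_mul_of_nonneg_left (h.le_transition i j) (hw i).le
      linarith
    have hup : a ≤ S := by
      rw [hS, ha]
      refine Finset.sum_le_sum fun i _ => ?_
      have := mul_le_mul_of_nonneg_left (h.transition_le_one i j) (hw i).le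
      linarith
    have hDa1 : 1 ≤ (β * S)⁻¹ * a := by
      rw [inv_mul_eq_div, one_le_div (by positivity)]
      exact hlow
    have hDa2 : β * ((β * S)⁻¹ * a) ≤ 1 := by
      have : β * ((β * S)⁻¹ * a) = a / S := by field_simp
      rw [this, div_le_one hSpos]
      exact hup
    have happ : ‖∑ i, p i * (q i x * P i j) - a‖ ≤ 7 * pertSize β * a := by
      have := norm_sum_sub_le (c := 1) (s := 7 * pertSize β)
        (b := fun i => p₀ i * (q₀ i x * P₀ i j))
        (x := fun i => p i * (q i x * P i j)) fun i => ?_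
      · rw [one_mul, norm_one, mul_one] at this
        exact this
      · have hpos : 0 ≤ q₀ i x * P₀ i j :=
          mul_nonneg (h.density_pos i x).le (h.transition_pos i j).le
        have h1 := norm_mul_sub_mul_le (c := 1) (s := pertSize β) (δ := 3 * pertSize β)
          (h.init_pos i).le hpos (by simpa using hp.init i)
          (hp.norm_density_mul_transition_sub_le h hδ0.le hδ1 i j x) hδ0.le
        refine h1.trans ?_
        have : 0 ≤ p₀ i * (q₀ i x * P₀ i j) := mul_nonneg (h.init_pos i).le hpos
        rw [norm_one, mul_one, mul_one]
        exact mul_le_mul_of_nonneg_right (by nlinarith) this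
    have happ' : ‖∑ i, p i * (q i x * P i j) - 1 * a‖ ≤ 7 * pertSize β * ‖(1 : ℂ)‖ * a := by
      simpa using happ
    have hnl := le_norm_of_norm_sub_le ((by positivity : (0 : ℝ) ≤ β * S).trans hlow) happ'
    rw [norm_one, mul_one] at hnl
    set v := ∑ i, p i * (q i x * P i j) with hv
    rw [hfwd, fwd_zero, pow_zero, one_mul, Complex.norm_real, Real.norm_of_nonneg hD.le]
    have hsplit : p j - ((β * S)⁻¹ : ℝ) * v
        = (p j - p₀ j) + ((p₀ j - (β * S)⁻¹ * a : ℝ) : ℂ) - ((β * S)⁻¹ : ℝ) * (v - a) := by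
      push_cast; ring
    have hmid : ‖((p₀ j - (β * S)⁻¹ * a : ℝ) : ℂ)‖ ≤ (1 - β ^ 2) * ((β * S)⁻¹ * a) := by
      rw [Complex.norm_real, Real.norm_of_nonpos (by linarith [h.init_le_one j])]
      have := h.le_init j
      nlinarith
    calc ‖p j - ((β * S)⁻¹ : ℝ) * v‖
        ≤ pertSize β * ((β * S)⁻¹ * a) + (1 - β ^ 2) * ((β * S)⁻¹ * a)
          + (β * S)⁻¹ * (7 * pertSize β * a) := by
          rw [hsplit]
          refine (norm_sub_le _ _).trans (add_le_add ((norm_add_le _ _).trans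
            (add_le_add ?_ hmid)) ?_)
          · refine (hp.init j).trans (mul_le_mul_of_nonneg_left ?_ hδ0.le)
            linarith [h.init_le_one j]
          · rw [norm_mul, Complex.norm_real, Real.norm_of_nonneg hD.le]
            exact mul_le_mul_of_nonneg_left happ hD.le
      _ = (1 - β ^ 2 + 8 * pertSize β) * ((β * S)⁻¹ * a) := by ring
      _ ≤ ((1 - β ^ 2 / 2) * (1 - 7 * pertSize β)) * ((β * S)⁻¹ * a) := by
          refine mul_le_mul_of_nonneg_right ?_ (by linarith)
          have : β ^ 3 ≤ β ^ 2 := pow_le_pow_of_le_one h.pos.le hβ1 (by norm_num)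
          nlinarith
      _ = (1 - β ^ 2 / 2) * (β * S)⁻¹ * ((1 - 7 * pertSize β) * a) := by ring
      _ ≤ (1 - β ^ 2 / 2) * (β * S)⁻¹ * ‖v‖ := by
          have : 0 ≤ 1 - β ^ 2 / 2 := by linarith
          gcongr
  | succ n ih =>
    obtain ⟨d, hd, hdu⟩ := ih (Fin.init z)
    obtain ⟨c, hc, hcu⟩ := exists_near_fwd h hp (n + 1) (Fin.init z)
    rw [Fin.tail_init_eq_init_tail] at hdu
    have hpow : (1 - β ^ 3 / 8) ^ n ≤ 1 := pow_le_one₀ hρ0 hρ1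
    have hpow0 : 0 ≤ (1 - β ^ 3 / 8) ^ n := by positivity
    have ht0 : 0 ≤ (1 - β ^ 3 / 8) ^ n * (1 - β ^ 2 / 2) :=
      mul_nonneg hpow0 (by linarith)
    have ht1 : (1 - β ^ 3 / 8) ^ n * (1 - β ^ 2 / 2) ≤ 1 - β ^ 2 / 2 :=
      mul_le_of_le_one_left (by linarith) hpow
    have hM : ∀ i j, ‖fwd p P q (n + 1) (Fin.init z) i * (q i (z (Fin.last (n + 1))) * P i j)
        - c * (fwd p₀ P₀ q₀ (n + 1) (Fin.init z) i
          * (q₀ i (z (Fin.last (n + 1))) * P₀ i j) : ℝ)‖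
        ≤ β ^ 3 / 8 * ‖c‖ * (fwd p₀ P₀ q₀ (n + 1) (Fin.init z) i
          * (q₀ i (z (Fin.last (n + 1))) * P₀ i j)) := fun i j => by
      have hpos : 0 ≤ q₀ i (z (Fin.last (n + 1))) * P₀ i j :=
        mul_nonneg (h.density_pos i _).le (h.transition_pos i j).le
      refine (norm_mul_sub_mul_le (h.fwd_pos (n + 1) (Fin.init z) i).le hpos (hcu i)
        (hp.norm_density_mul_transition_sub_le h hδ0.le hδ1 i j _) (by positivity)).trans ?_
      have := h.fwd_pos (n + 1) (Fin.init z) i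
      gcongr
      nlinarith
    -- The condition of `exists_contraction` with `σ = β ^ 3 / 8` and `ρ = 1 - β ^ 3 / 8`. A
    -- distance of at most `1 - β ^ 2 / 2` gives the slack `β ^ 3 / 2` in the last factor.
    have hρ : 1 - β + 2 * (β ^ 3 / 8) ≤ (1 - β ^ 3 / 8) * (1 - β ^ 3 / 8) *
        (1 - β * ((1 - β ^ 3 / 8) ^ n * (1 - β ^ 2 / 2))) := by
      calc 1 - β + 2 * (β ^ 3 / 8) ≤ (1 - β ^ 3 / 4) * (1 - β * (1 - β ^ 2 / 2)) := by
            have : β ^ 3 ≤ β ^ 1 := pow_le_pow_of_le_one h.pos.le hβ1 (by norm_num)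
            nlinarith
        _ ≤ _ := by
            refine mul_le_mul (by nlinarith) ?_ (by nlinarith) (by positivity)
            gcongr
    obtain ⟨d', hd', hd'u⟩ := exists_contraction
      (M := fun i j => q i (z (Fin.last (n + 1))) * P i j)
      (w := fun i => q₀ i (z (Fin.last (n + 1))))
      (h.fwd_pos (n + 1) (Fin.init z)) (fun i => h.density_pos i _) h.pos h.le_transition
      h.transition_le_one (by positivity) (by linarith) hc hd hM ht0
      (by linarith) hdu hρ0 hρ
    refine ⟨d', hd', fun j => ?_⟩
    rw [pow_succ', mul_assoc (1 - β ^ 3 / 8)]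
    exact hd'u j

/-- The conditional density of the last output, given the previous ones. -/
noncomputable def condDens (p : ι → ℂ) (P : Matrix ι ι ℂ) (q : ι → ℝ → ℂ) (n : ℕ)
    (z : Fin (n + 1) → ℝ) : ℂ :=
  dens p P q n z / ∑ i, fwd p P q n (Fin.init z) i

include h hp in
-- A single `c` serves the summands of both numerator and denominator of `condDens`, so it
-- disappears from the quotient.
theorem exists_near_dens (n : ℕ) (z : Fin (n + 1) → ℝ) : ∃ c : ℂ, c ≠ 0 ∧
    (∀ i, ‖fwd p P q n (Fin.init z) i - c * fwd p₀ P₀ q₀ n (Fin.init z) i‖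
      ≤ β ^ 3 / 8 * ‖c‖ * fwd p₀ P₀ q₀ n (Fin.init z) i) ∧
    (∀ i, ‖fwd p P q n (Fin.init z) i * q i (z (Fin.last n))
      - c * (fwd p₀ P₀ q₀ n (Fin.init z) i * q₀ i (z (Fin.last n)) : ℝ)‖
      ≤ β ^ 3 / 8 * ‖c‖ * (fwd p₀ P₀ q₀ n (Fin.init z) i * q₀ i (z (Fin.last n)))) := by
  obtain ⟨c, hc, hcu⟩ := exists_near_fwd h hp n (Fin.init z)
  have hβ := h.pos
  have hδ := h.pertSize_le
  have hδ0 := h.pertSize_pos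
  have h3 := h.pow_le_one 3
  have hβ3 : 0 < β ^ 3 := by positivity
  have hf := fun i => h.fwd_pos n (Fin.init z) i
  have hq := fun i => h.density_pos i (z (Fin.last n))
  refine ⟨c, hc, fun i => (hcu i).trans ?_, fun i => ?_⟩
  · have := hf i
    gcongr
    norm_num
  · refine (norm_mul_sub_mul_le (hf i).le (hq i).le (hcu i) (hp.density i _)
      (by positivity)).trans ?_
    have := hf i
    have := hq i
    gcongr
    nlinarith

include h hp in
theorem norm_condDens_sub_le (n : ℕ) (z : Fin (n + 1) → ℝ) :
    ‖condDens p P q n z - (dens p₀ P₀ q₀ n z / ∑ i, fwd p₀ P₀ q₀ n (Fin.init z) i : ℝ)‖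
      ≤ 1 / 2 * (dens p₀ P₀ q₀ n z / ∑ i, fwd p₀ P₀ q₀ n (Fin.init z) i) := by
  obtain ⟨c, hc, h1, h2⟩ := exists_near_dens h hp n z
  have h3 := h.pow_le_one 3
  exact norm_div_sub_le (h.dens_pos n z) (h.sum_fwd_pos n _) (by linarith) hc
    (norm_sum_sub_le h2) (norm_sum_sub_le h1)

include h hp in
theorem condDens_re_pos (n : ℕ) (z : Fin (n + 1) → ℝ) : 0 < (condDens p P q n z).re :=
  re_pos_of_norm_sub_le (div_pos (h.dens_pos n z) (h.sum_fwd_pos n _))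
    (norm_condDens_sub_le h hp n z)

include h hp in
theorem norm_log_condDens_le (n : ℕ) (z : Fin (n + 1) → ℝ) :
    ‖Complex.log (condDens p P q n z)‖ ≤ 5 + ∑ i, |Real.log (q₀ i (z (Fin.last n)))| :=
  (norm_log_le_of_norm_sub_le (div_pos (h.dens_pos n z) (h.sum_fwd_pos n _))
    (norm_condDens_sub_le h hp n z)).trans (by linarith [h.abs_log_quotient_le n z])

include h hp in
theorem norm_log_condDens_tail_sub_le (n : ℕ) (z : Fin (n + 2) → ℝ)
    (hn : (1 - β ^ 3 / 8) ^ n ≤ 1 / 16) :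
    ‖Complex.log (condDens p P q n (Fin.tail z)) - Complex.log (condDens p P q (n + 1) z)‖
      ≤ 8 * (1 - β ^ 3 / 8) ^ n := by
  obtain ⟨c, hc, h1, h2⟩ := exists_near_dens h hp (n + 1) z
  obtain ⟨d, hd, hdu⟩ := exists_near_fwd_tail h hp n (Fin.init z)
  rw [Fin.tail_init_eq_init_tail] at hdu
  have hβ := h.pos
  have h3 := h.pow_le_one 3
  have h22 := h.pow_le_one 2
  have hβ2 : 0 < β ^ 2 := by positivity
  have hβ3 : 0 < β ^ 3 := by positivity
  have hρ0 : 0 ≤ 1 - β ^ 3 / 8 := by linarith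
  set t := (1 - β ^ 3 / 8) ^ n with ht
  have ht0 : 0 ≤ t := by positivity
  have hdu' : ∀ i, ‖fwd p P q n (Fin.init (Fin.tail z)) i - d * fwd p P q (n + 1) (Fin.init z) i‖
      ≤ t * ‖d‖ * ‖fwd p P q (n + 1) (Fin.init z) i‖ := fun i => (hdu i).trans <| by
    gcongr
    exact mul_le_of_le_one_right ht0 (by linarith)
  -- Coordinatewise closeness passes to sums because the summands of `x` lie in one narrow cone and
  -- cannot cancel. The loss is at most 2, as `1 + σ ≤ 2 * (1 - σ)` for `σ = β ^ 3 / 8`.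
  have aux : ∀ (x y : ι → ℂ) (b : ι → ℝ), (∀ i, 0 ≤ b i) →
      (∀ i, ‖x i - c * b i‖ ≤ β ^ 3 / 8 * ‖c‖ * b i) →
      (∀ i, ‖y i - d * x i‖ ≤ t * ‖d‖ * ‖x i‖) →
      ‖∑ i, y i - d * ∑ i, x i‖ ≤ 2 * t * ‖d‖ * ‖∑ i, x i‖ := fun x y b hb hx hy => by
    have hlow := le_norm_of_norm_sub_le (Finset.sum_nonneg fun i _ => hb i) (norm_sum_sub_le hx)
    have hB : 0 ≤ ∑ i, b i := Finset.sum_nonneg fun i _ => hb i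
    rw [Finset.mul_sum, ← Finset.sum_sub_distrib]
    calc _ ≤ ∑ i, t * ‖d‖ * ((1 + β ^ 3 / 8) * ‖c‖ * b i) := by
          refine (norm_sum_le _ _).trans (Finset.sum_le_sum fun i _ => (hy i).trans ?_)
          gcongr
          exact norm_le_of_norm_sub_le (hb i) (hx i)
      _ = t * ‖d‖ * ((1 + β ^ 3 / 8) * (‖c‖ * ∑ i, b i)) := by
          simp only [Finset.mul_sum]
          exact Finset.sum_congr rfl fun i _ => by ring
      _ ≤ t * ‖d‖ * ((2 * (1 - β ^ 3 / 8)) * (‖c‖ * ∑ i, b i)) := by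
          have : 1 + β ^ 3 / 8 ≤ 2 * (1 - β ^ 3 / 8) := by linarith
          gcongr
      _ = 2 * t * ‖d‖ * ((1 - β ^ 3 / 8) * ‖c‖ * ∑ i, b i) := by ring
      _ ≤ _ := by gcongr
  refine norm_log_sub_log_le ht0 hn hd (condDens_re_pos h hp (n + 1) z)
    (aux _ _ _ (fun i => mul_nonneg (h.fwd_pos _ _ i).le (h.density_pos _ _).le) h2 fun i => ?_)
    (aux _ _ _ (fun i => (h.fwd_pos _ _ i).le) h1 hdu')
  have hlast : Fin.tail z (Fin.last n) = z (Fin.last (n + 1)) := rfl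
  rw [hlast, ← mul_assoc, ← sub_mul, norm_mul, norm_mul, ← mul_assoc]
  exact mul_le_mul_of_nonneg_right (hdu' i) (norm_nonneg _)

end Perturbation

/-! ### Marginalization, integrable majorants and geometric convergence of `condInt`. -/

section Measure

variable {ι : Type*} [Fintype ι]

theorem continuous_fwd {R : Type*} [CommSemiring R] [TopologicalSpace R] [IsTopologicalSemiring R]
    (p : ι → R) (P : Matrix ι ι R) {q : ι → ℝ → R} (hq : ∀ i, Continuous (q i)) (n : ℕ) (j : ι) :
    Continuous fun z : Fin n → ℝ => fwd p P q n z j := by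
  induction n generalizing j with
  | zero => exact continuous_const
  | succ n ih =>
    have hinit : Continuous fun z : Fin (n + 1) → ℝ => (Fin.init z : Fin n → ℝ) :=
      continuous_pi fun i => continuous_apply _
    refine continuous_finsetSum _ fun i _ => ((ih i).comp hinit).mul ?_
    exact ((hq i).comp (continuous_apply _)).mul continuous_const

theorem continuous_dens {R : Type*} [CommSemiring R] [TopologicalSpace R] [IsTopologicalSemiring R]
    (p : ι → R) (P : Matrix ι ι R) {q : ι → ℝ → R} (hq : ∀ i, Continuous (q i)) (n : ℕ) :
    Continuous (dens p P q n) := by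
  have hinit : Continuous fun z : Fin (n + 1) → ℝ => (Fin.init z : Fin n → ℝ) :=
    continuous_pi fun i => continuous_apply _
  exact continuous_finsetSum _ fun i _ => ((continuous_fwd p P hq n i).comp hinit).mul
    ((hq i).comp (continuous_apply _))

theorem measurable_condDens (p : ι → ℂ) (P : Matrix ι ι ℂ) {q : ι → ℝ → ℂ}
    (hq : ∀ i, Continuous (q i)) (n : ℕ) : Measurable (condDens p P q n) := by
  have hinit : Continuous fun z : Fin (n + 1) → ℝ => (Fin.init z : Fin n → ℝ) :=
    continuous_pi fun i => continuous_apply _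
  exact (continuous_dens p P hq n).measurable.div (continuous_finsetSum _ fun i _ =>
    (continuous_fwd p P hq n i).comp hinit).measurable

section Product

variable {𝕜 : Type*} [RCLike 𝕜]

theorem integrable_mul_tail {n : ℕ} {f : ℝ → 𝕜} {φ : (Fin n → ℝ) → 𝕜} (hf : Integrable f)
    (hφ : Integrable φ) : Integrable fun z : Fin (n + 1) → ℝ => f (z 0) * φ (Fin.tail z) :=
  ((volume_preserving_piFinSuccAbove (fun _ : Fin (n + 1) => ℝ) 0).integrable_comp_emb
    (MeasurableEquiv.measurableEmbedding _)).2 (hf.mul_prod hφ)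

theorem integral_mul_tail {n : ℕ} (f : ℝ → 𝕜) (φ : (Fin n → ℝ) → 𝕜) :
    ∫ z : Fin (n + 1) → ℝ, f (z 0) * φ (Fin.tail z) = (∫ x, f x) * ∫ w, φ w := by
  rw [← integral_prod_mul]
  exact (volume_preserving_piFinSuccAbove (fun _ : Fin (n + 1) => ℝ) 0).integral_comp'
    (g := fun a : ℝ × (Fin n → ℝ) => f a.1 * φ a.2)

theorem integrable_mul_init {n : ℕ} {f : ℝ → 𝕜} {φ : (Fin n → ℝ) → 𝕜} (hf : Integrable f)
    (hφ : Integrable φ) :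
    Integrable fun z : Fin (n + 1) → ℝ => f (z (Fin.last n)) * φ (Fin.init z) := by
  have := ((volume_preserving_piFinSuccAbove (fun _ : Fin (n + 1) => ℝ)
    (Fin.last n)).integrable_comp_emb
    (MeasurableEquiv.measurableEmbedding _)).2 (hf.mul_prod hφ)
  refine this.congr (.of_forall fun z => ?_)
  simp [MeasurableEquiv.piFinSuccAbove, Fin.insertNthEquiv, Fin.removeNth_last]

theorem integral_mul_init {n : ℕ} (f : ℝ → 𝕜) (φ : (Fin n → ℝ) → 𝕜) :
    ∫ z : Fin (n + 1) → ℝ, f (z (Fin.last n)) * φ (Fin.init z) = (∫ x, f x) * ∫ w, φ w := by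
  rw [← integral_prod_mul]
  refine Eq.trans ?_ ((volume_preserving_piFinSuccAbove (fun _ : Fin (n + 1) => ℝ)
    (Fin.last n)).integral_comp' (g := fun a : ℝ × (Fin n → ℝ) => f a.1 * φ a.2))
  refine integral_congr_ae (.of_forall fun z => ?_)
  simp [MeasurableEquiv.piFinSuccAbove, Fin.insertNthEquiv, Fin.removeNth_last]

variable {p : ι → 𝕜} {P : Matrix ι ι 𝕜} {q : ι → ℝ → 𝕜}

theorem dens_succ_eq_sum (n : ℕ) (z : Fin (n + 2) → ℝ) : dens p P q (n + 1) z =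
    ∑ i, p i * (q i (z 0) * dens (P i) P q n (Fin.tail z)) := by
  have := dens_linear P q Finset.univ (fun i => p i * q i (z 0)) (fun i => P i) n (Fin.tail z)
  rw [dens_succ_tail]
  simp only [mul_assoc] at this
  exact this

/-- Marginalization of the first output of a stationary hidden Markov model. -/
theorem integral_dens_succ_mul_tail {n : ℕ} {φ : (Fin (n + 1) → ℝ) → 𝕜}
    (hq : ∀ i, Integrable (q i)) (hq1 : ∀ i, ∫ x, q i x = 1)
    (hp : ∀ j, ∑ i, p i * P i j = p j)
    (hφ : ∀ i, Integrable fun w => dens (P i) P q n w * φ w) :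
    ∫ z, dens p P q (n + 1) z * φ (Fin.tail z) = ∫ w, dens p P q n w * φ w := by
  -- Stationarity writes `p` as a mixture of the rows of `P`. These rows are the initial vectors
  -- left after the first output is integrated out.
  have hdens : ∀ w, dens p P q n w = ∑ i, p i * dens (P i) P q n w := fun w =>
    (congrArg (fun v => dens v P q n w) (funext fun j => (hp j).symm)).trans
      (dens_linear P q Finset.univ p (fun i => P i) n w)
  simp only [dens_succ_eq_sum, hdens, Finset.sum_mul]
  rw [integral_finsetSum _ fun i _ => ?_, integral_finsetSum _ fun i _ => ?_]
  · refine Finset.sum_congr rfl fun i _ => ?_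
    have := integral_mul_tail (q i) (fun w => dens (P i) P q n w * φ w)
    rw [hq1, one_mul] at this
    simp only [mul_assoc] at this ⊢
    rw [integral_const_mul, this, integral_const_mul]
  · simpa only [mul_assoc] using (hφ i).const_mul (p i)
  · simpa only [mul_assoc] using (integrable_mul_tail (hq i) (hφ i)).const_mul (p i)

/-- Marginalization of the last output of a hidden Markov model. -/
theorem integral_dens_succ_mul_init {n : ℕ} {φ : (Fin (n + 1) → ℝ) → 𝕜}
    (hq : ∀ i, Integrable (q i)) (hq1 : ∀ i, ∫ x, q i x = 1) (hP : ∀ i, ∑ j, P i j = 1)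
    (hφ : ∀ i, Integrable fun w => fwd p P q (n + 1) w i * φ w) :
    ∫ z, dens p P q (n + 1) z * φ (Fin.init z) = ∫ w, dens p P q n w * φ w := by
  simp only [← sum_fwd_succ p P q hP n, Finset.sum_mul]
  simp only [dens, Finset.sum_mul]
  have hcomm : ∀ (i : ι) (z : Fin (n + 2) → ℝ),
      fwd p P q (n + 1) (Fin.init z) i * q i (z (Fin.last (n + 1))) * φ (Fin.init z)
        = q i (z (Fin.last (n + 1))) * (fwd p P q (n + 1) (Fin.init z) i * φ (Fin.init z)) :=
    fun i z => by ring
  simp only [hcomm]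
  rw [integral_finsetSum _ fun i _ => ?_, integral_finsetSum _ fun i _ => hφ i]
  · refine Finset.sum_congr rfl fun i _ => ?_
    have := integral_mul_init (q i) (fun w => fwd p P q (n + 1) w i * φ w)
    rwa [hq1, one_mul] at this
  · exact integrable_mul_init (hq i) (hφ i)

theorem integrable_dens_succ_mul_init {n : ℕ} {φ : (Fin (n + 1) → ℝ) → 𝕜}
    (hq : ∀ i, Integrable (q i)) (hφ : ∀ i, Integrable fun w => fwd p P q (n + 1) w i * φ w) :
    Integrable fun z => dens p P q (n + 1) z * φ (Fin.init z) := by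
  simp only [dens, Finset.sum_mul]
  refine integrable_finsetSum _ fun i _ => (integrable_mul_init (hq i) (hφ i)).congr
    (.of_forall fun z => ?_)
  simp only
  ring

end Product

/-- The majorant of the one-letter entropy integrands. -/
noncomputable def dominant (q₀ : ι → ℝ → ℝ) (x : ℝ) : ℝ :=
  (∑ i, q₀ i x) * (1 + ∑ i, |Real.log (q₀ i x)|)

/-- The integrability properties of the output densities of the unperturbed model. -/
structure IsIntegrableChannel (q₀ : ι → ℝ → ℝ) : Prop where
  continuous : ∀ i, Continuous (q₀ i)
  integral_eq_one : ∀ i, ∫ x, q₀ i x = 1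
  dominant : Integrable (dominant q₀)

/-- The expected logarithm of the conditional density of the last output. -/
noncomputable def condInt (p : ι → ℂ) (P : Matrix ι ι ℂ) (q : ι → ℝ → ℂ) (n : ℕ) : ℂ :=
  ∫ z, dens p P q n z * Complex.log (condDens p P q n z)

variable {β δ : ℝ} {p₀ : ι → ℝ} {P₀ : Matrix ι ι ℝ} {q₀ : ι → ℝ → ℝ}
  {p : ι → ℂ} {P : Matrix ι ι ℂ} {q : ι → ℝ → ℂ}

theorem sum_abs_log_nonneg (q₀ : ι → ℝ → ℝ) (x : ℝ) : 0 ≤ ∑ i, |Real.log (q₀ i x)| :=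
  Finset.sum_nonneg fun _ _ => abs_nonneg _

variable (h : IsPositiveModel β p₀ P₀ q₀) (hI : IsIntegrableChannel q₀)

include h

theorem IsPositiveModel.sum_le_dominant (x : ℝ) : ∑ i, q₀ i x ≤ dominant q₀ x :=
  le_mul_of_one_le_right (h.sum_density_nonneg x) (by linarith [sum_abs_log_nonneg q₀ x])

theorem IsPositiveModel.dominant_nonneg (x : ℝ) : 0 ≤ dominant q₀ x :=
  (h.sum_density_nonneg x).trans (h.sum_le_dominant x)

/-- The logarithms involve only the coordinate `k`, so they fit into one factor of a product of
one-letter majorants. -/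
theorem IsPositiveModel.dens_mul_le (n : ℕ) (z : Fin (n + 1) → ℝ) (k : Fin (n + 1)) :
    dens p₀ P₀ q₀ n z * (1 + ∑ i, |Real.log (q₀ i (z k))|) ≤ ∏ k, dominant q₀ (z k) := by
  have hl := sum_abs_log_nonneg q₀ (z k)
  refine (mul_le_mul_of_nonneg_right (h.dens_le n z) (by linarith)).trans ?_
  rw [← Finset.prod_erase_mul _ _ (Finset.mem_univ k),
    ← Finset.prod_erase_mul (a := k) _ (fun k => dominant q₀ (z k)) (Finset.mem_univ k), mul_assoc]
  refine mul_le_mul_of_nonneg_right (Finset.prod_le_prod (fun _ _ => h.sum_density_nonneg _)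
    fun _ _ => h.sum_le_dominant _) (h.dominant_nonneg _)

theorem IsPositiveModel.dens_le_prod_dominant (n : ℕ) (z : Fin (n + 1) → ℝ) :
    dens p₀ P₀ q₀ n z ≤ ∏ k, dominant q₀ (z k) :=
  (h.dens_le n z).trans (Finset.prod_le_prod (fun _ _ => h.sum_density_nonneg _)
    fun _ _ => h.sum_le_dominant _)

include hI

theorem IsPositiveModel.integrable_density (i : ι) : Integrable (q₀ i) :=
  hI.dominant.mono' (hI.continuous i).aestronglyMeasurable (.of_forall fun x => by
    rw [Real.norm_of_nonneg (h.density_pos i x).le]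
    exact (Finset.single_le_sum (f := fun i => q₀ i x) (fun i _ => (h.density_pos i x).le)
      (Finset.mem_univ i)).trans (h.sum_le_dominant x))

omit h in
theorem IsIntegrableChannel.integrable_prod (n : ℕ) :
    Integrable fun z : Fin n → ℝ => ∏ k, HiddenMarkov.dominant q₀ (z k) :=
  Integrable.fintype_prod fun _ => hI.dominant

theorem IsPositiveModel.integrable_dens (n : ℕ) : Integrable (dens p₀ P₀ q₀ n) :=
  (hI.integrable_prod (n + 1)).mono' (continuous_dens _ _ hI.continuous n).aestronglyMeasurable
    (.of_forall fun z => by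
      rw [Real.norm_of_nonneg (h.dens_pos n z).le]
      exact h.dens_le_prod_dominant n z)

theorem IsPositiveModel.integral_dens (n : ℕ) : ∫ z, dens p₀ P₀ q₀ n z = 1 := by
  have hq := h.integrable_density hI
  induction n with
  | zero =>
    have : ∀ z : Fin 1 → ℝ, dens p₀ P₀ q₀ 0 z = ∑ i, q₀ i (z (Fin.last 0)) * p₀ i := fun z =>
      Finset.sum_congr rfl fun i _ => mul_comm _ _
    simp only [this]
    have hint : ∀ i, Integrable fun _ : Fin 0 → ℝ => p₀ i := fun i => by simp
    rw [integral_finsetSum _ fun i _ => integrable_mul_init (hq i) (hint i)]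
    have := fun i => integral_mul_init (q₀ i) (fun _ : Fin 0 → ℝ => p₀ i)
    simp only [this, hI.integral_eq_one, one_mul]
    have hvol : (volume : Measure (Fin 0 → ℝ)).real Set.univ = 1 := by
      simp [Measure.real, volume_pi]
    simp [hvol, h.sum_init]
  | succ n ih =>
    rw [← ih]
    have hfwd : ∀ i, Integrable fun w : Fin (n + 1) → ℝ => fwd p₀ P₀ q₀ (n + 1) w i * 1 :=
      fun i => by
        refine (hI.integrable_prod (n + 1)).mono'
          ((continuous_fwd _ _ hI.continuous (n + 1) i).mul continuous_const).aestronglyMeasurable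
          (.of_forall fun z => ?_)
        rw [mul_one, Real.norm_of_nonneg (h.fwd_pos _ z i).le]
        refine le_trans ?_ (h.dens_le_prod_dominant n z)
        rw [← sum_fwd_succ _ _ _ h.row_sum]
        exact Finset.single_le_sum (f := fun i => fwd p₀ P₀ q₀ (n + 1) z i)
          (fun i _ => (h.fwd_pos _ z i).le) (Finset.mem_univ i)
    have := integral_dens_succ_mul_init (n := n) (φ := fun _ => 1) hq hI.integral_eq_one
      h.row_sum hfwd
    simpa using this

variable (hp : IsPerturbation (pertSize β) p₀ P₀ q₀ p P q) (hq : ∀ i, Continuous (q i))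

omit hI in
include hp in
-- The weight starts from `v`, the logarithm from `p`: `v = p` serves `condInt`, and the rows of `P`
-- serve marginalization of the first output.
theorem norm_dens_mul_log_le {v : ι → ℂ} {K : ℝ} (hv : ∀ j, ‖v j‖ ≤ K * p₀ j) (n : ℕ)
    (z : Fin (n + 1) → ℝ) :
    ‖dens v P q n z * Complex.log (condDens p P q n z)‖
      ≤ 5 * (K * (1 + pertSize β) ^ (2 * n + 1)) * ∏ k, dominant q₀ (z k) := by
  have h1 := hp.norm_dens_le h hv n z
  have h2 := norm_log_condDens_le h hp n z
  have h3 := h.dens_mul_le n z (Fin.last n)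
  have h4 := h.dens_pos n z
  have hδ := h.pertSize_pos
  have hK : 0 ≤ K := by
    obtain ⟨i⟩ := h.nonempty
    exact nonneg_of_mul_nonneg_left ((norm_nonneg _).trans (hv i)) (h.init_pos i)
  have hl := sum_abs_log_nonneg q₀ (z (Fin.last n))
  rw [norm_mul]
  calc _ ≤ (K * (1 + pertSize β) ^ (2 * n + 1) * dens p₀ P₀ q₀ n z)
        * (5 * (1 + ∑ i, |Real.log (q₀ i (z (Fin.last n)))|)) := by
        gcongr
        linarith
    _ = 5 * (K * (1 + pertSize β) ^ (2 * n + 1)) * (dens p₀ P₀ q₀ n z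
        * (1 + ∑ i, |Real.log (q₀ i (z (Fin.last n)))|)) := by ring
    _ ≤ _ := by gcongr

include hp hq in
theorem integrable_dens_mul_log {v : ι → ℂ} {K : ℝ} (hv : ∀ j, ‖v j‖ ≤ K * p₀ j) (n : ℕ) :
    Integrable fun z => dens v P q n z * Complex.log (condDens p P q n z) :=
  ((hI.integrable_prod (n + 1)).const_mul _).mono'
    ((continuous_dens _ _ hq n).aestronglyMeasurable.mul
      (Complex.measurable_log.comp (measurable_condDens _ _ hq n)).aestronglyMeasurable)
    (.of_forall fun z => norm_dens_mul_log_le h hp hv n z)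

include hp in
theorem norm_condInt_le (n : ℕ) : ‖condInt p P q n‖
    ≤ 5 * ((1 + pertSize β) * (1 + pertSize β) ^ (2 * n + 1))
      * ∫ z : Fin (n + 1) → ℝ, ∏ k, dominant q₀ (z k) := by
  rw [← integral_const_mul]
  exact norm_integral_le_of_norm_le ((hI.integrable_prod (n + 1)).const_mul _)
    (.of_forall fun z => norm_dens_mul_log_le h hp (hp.norm_init_le h) n z)

/-- The rate of convergence of the expected conditional log-densities. -/
noncomputable def convRate (β : ℝ) : ℝ := (1 + pertSize β) ^ 2 * (1 - β ^ 3 / 8)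

omit hI in
theorem IsPositiveModel.convRate_nonneg : 0 ≤ convRate β := by
  have := h.pow_le_one 3
  have := h.pertSize_pos
  unfold convRate
  have : 0 ≤ 1 - β ^ 3 / 8 := by linarith
  positivity

omit hI in
-- The growth `3 * pertSize β ≤ 3 * β ^ 3 / 200` of the complex weights per letter is less than the
-- contraction `β ^ 3 / 8`.
theorem IsPositiveModel.convRate_lt_one : convRate β < 1 := by
  have h3 := h.pow_le_one 3
  have h0 := h.pertSize_pos
  have h1 := h.pertSize_le
  have hβ := h.pos
  have hβ3 : 0 < β ^ 3 := by positivity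
  unfold convRate
  calc (1 + pertSize β) ^ 2 * (1 - β ^ 3 / 8) ≤ (1 + 3 * pertSize β) * (1 - β ^ 3 / 8) := by
        refine mul_le_mul_of_nonneg_right ?_ (by linarith)
        nlinarith
    _ < 1 := by nlinarith

include hp hq in
theorem norm_condInt_succ_sub_le (hq1 : ∀ i, ∫ x, q i x = 1) (hstat : ∀ j, ∑ i, p i * P i j = p j)
    {n : ℕ} (hn : (1 - β ^ 3 / 8) ^ n ≤ 1 / 16) :
    ‖condInt p P q (n + 1) - condInt p P q n‖ ≤ 8 * (1 + pertSize β) ^ 4 * convRate β ^ n := by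
  have hδ := h.pertSize_pos
  have h3 := h.pow_le_one 3
  have hρ : 0 ≤ 1 - β ^ 3 / 8 := by linarith
  have hqi : ∀ i, Integrable (q i) := fun i =>
    ((h.integrable_density hI i).const_mul (1 + pertSize β)).mono' (hq i).aestronglyMeasurable
      (.of_forall fun x => hp.norm_density_le h i x)
  -- Stationarity moves the shorter window to the end of the longer one. Both integrals then carry
  -- the same weight, and only the logarithms differ.
  have hshift : condInt p P q n = ∫ z : Fin (n + 2) → ℝ,
      dens p P q (n + 1) z * Complex.log (condDens p P q n (Fin.tail z)) :=
    (integral_dens_succ_mul_tail hqi hq1 hstat fun i =>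
      integrable_dens_mul_log h hI hp hq (hp.norm_row_le h hδ.le i) n).symm
  have hbound : ∀ z : Fin (n + 2) → ℝ, ‖dens p P q (n + 1) z
      * (Complex.log (condDens p P q (n + 1) z) - Complex.log (condDens p P q n (Fin.tail z)))‖
      ≤ 8 * (1 + pertSize β) ^ 4 * convRate β ^ n * dens p₀ P₀ q₀ (n + 1) z := fun z => by
    have h1 := hp.norm_dens_le h (hp.norm_init_le h) (n + 1) z
    have h2 := norm_log_condDens_tail_sub_le h hp n z hn
    rw [norm_sub_rev] at h2
    have h4 := h.dens_pos (n + 1) z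
    rw [norm_mul]
    calc _ ≤ ((1 + pertSize β) * (1 + pertSize β) ^ (2 * (n + 1) + 1) * dens p₀ P₀ q₀ (n + 1) z)
          * (8 * (1 - β ^ 3 / 8) ^ n) := by gcongr
      _ = _ := by
        unfold convRate
        rw [mul_pow, ← pow_mul]
        ring
  have hint1 := integrable_dens_mul_log h hI hp hq (hp.norm_init_le h) (n + 1)
  have hint2 : Integrable fun z : Fin (n + 2) → ℝ => dens p P q (n + 1) z
      * (Complex.log (condDens p P q (n + 1) z) - Complex.log (condDens p P q n (Fin.tail z))) := by
    refine ((h.integrable_dens hI (n + 1)).const_mul _).mono' ?_ (.of_forall hbound)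
    have htail : Measurable fun z : Fin (n + 2) → ℝ => (Fin.tail z : Fin (n + 1) → ℝ) :=
      (continuous_pi fun i => continuous_apply _).measurable
    exact (continuous_dens _ _ hq _).aestronglyMeasurable.mul
      ((Complex.measurable_log.comp (measurable_condDens _ _ hq _)).sub
        (Complex.measurable_log.comp
          ((measurable_condDens _ _ hq _).comp htail))).aestronglyMeasurable
  have hdiff : condInt p P q (n + 1) - condInt p P q n = ∫ z : Fin (n + 2) → ℝ,
      dens p P q (n + 1) z
      * (Complex.log (condDens p P q (n + 1) z) - Complex.log (condDens p P q n (Fin.tail z))) := by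
    have hint3 : Integrable fun z : Fin (n + 2) → ℝ =>
        dens p P q (n + 1) z * Complex.log (condDens p P q n (Fin.tail z)) := by
      refine (hint1.sub hint2).congr (.of_forall fun z => ?_)
      simp only [Pi.sub_apply]
      ring
    rw [hshift, condInt, ← integral_sub hint1 hint3]
    exact integral_congr_ae (.of_forall fun z => by simp only; ring)
  rw [hdiff]
  refine (norm_integral_le_of_norm_le ((h.integrable_dens hI (n + 1)).const_mul _)
    (.of_forall hbound)).trans (le_of_eq ?_)
  rw [integral_const_mul, h.integral_dens hI, mul_one]

/-- The limit of the expected conditional log-densities. -/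
noncomputable def condLim (p : ι → ℂ) (P : Matrix ι ι ℂ) (q : ι → ℝ → ℂ) : ℂ :=
  limUnder atTop (condInt p P q)

/-- The shift `K` brings the contraction below `1 / 16`, where logarithms can be compared. It is
chosen before the perturbation, so convergence is uniform over all of them. -/
theorem exists_norm_condInt_sub_condLim_le : ∃ K : ℕ, ∀ (p : ι → ℂ) (P : Matrix ι ι ℂ)
    (q : ι → ℝ → ℂ), IsPerturbation (pertSize β) p₀ P₀ q₀ p P q → (∀ i, Continuous (q i)) →
    (∀ i, ∫ x, q i x = 1) → (∀ j, ∑ i, p i * P i j = p j) → ∀ n, ‖condInt p P q (n + K)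
      - condLim p P q‖ ≤ 8 * (1 + pertSize β) ^ 4 * convRate β ^ n / (1 - convRate β) := by
  have hβ := h.pos
  have h3 := h.pow_le_one 3
  have hβ3 : 0 < β ^ 3 := by positivity
  have hρ0 : 0 ≤ 1 - β ^ 3 / 8 := by linarith
  obtain ⟨K, hK⟩ := exists_pow_lt_of_lt_one (by norm_num : (0 : ℝ) < 1 / 16)
    (by linarith : 1 - β ^ 3 / 8 < 1)
  refine ⟨K, fun p P q hp hq hq1 hstat n => ?_⟩
  have hr0 := h.convRate_nonneg
  have hr1 := h.convRate_lt_one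
  have hδ := h.pertSize_pos
  have hd : ∀ n, dist (condInt p P q (n + K)) (condInt p P q (n + 1 + K))
      ≤ 8 * (1 + pertSize β) ^ 4 * convRate β ^ n := fun n => by
    have hnK : (1 - β ^ 3 / 8) ^ (n + K) ≤ 1 / 16 := by
      rw [pow_add]
      exact (mul_le_of_le_one_left (by positivity) (pow_le_one₀ hρ0 (by linarith))).trans hK.le
    rw [dist_comm, dist_eq_norm, Nat.add_right_comm]
    refine (norm_condInt_succ_sub_le h hI hp hq hq1 hstat hnK).trans ?_
    gcongr 8 * (1 + pertSize β) ^ 4 * ?_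
    exact pow_le_pow_of_le_one hr0 hr1.le (Nat.le_add_right n K)
  have hc := cauchySeq_of_le_geometric _ _ hr1 hd
  obtain ⟨L, hL⟩ := cauchySeq_tendsto_of_complete hc
  have hL' : Tendsto (condInt p P q) atTop (𝓝 L) := (tendsto_add_atTop_iff_nat K).1 hL
  have hlim : condLim p P q = L := hL'.limUnder_eq
  rw [hlim, ← dist_eq_norm]
  exact dist_le_of_le_geometric_of_tendsto _ _ hr1 hd hL n

end Measure

/-! ### Chain rule and entropy rate of real models. -/

section EntropyRate

theorem outputDensity_succ {l : ℕ} (p : Fin l → ℝ) (P : Matrix (Fin l) (Fin l) ℝ)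
    (q : Fin l → ℝ → ℝ) (n : ℕ) (z : Fin (n + 2) → ℝ) : outputDensity p P q (n + 1) z =
      outputDensity (fun j => ∑ i, p i * (q i (z 0) * P i j)) P q n (Fin.tail z) := by
  simp only [outputDensity, pathProb]
  rw [← (Fin.consEquiv fun _ : Fin (n + 2) => Fin l).sum_comp, Fintype.sum_prod_type_right]
  refine Finset.sum_congr rfl fun y _ => ?_
  rw [Finset.sum_mul, Finset.sum_mul]
  refine Finset.sum_congr rfl fun i _ => ?_
  rw [Fin.prod_univ_succ, Fin.prod_univ_succ (n := n + 1)]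
  simp only [Fin.consEquiv_apply, Fin.castSucc_zero, Fin.cons_zero, Fin.cons_succ, Fin.tail,
    ← Fin.succ_castSucc]
  ring

theorem outputDensity_eq_dens {l : ℕ} (p : Fin l → ℝ) (P : Matrix (Fin l) (Fin l) ℝ)
    (q : Fin l → ℝ → ℝ) (n : ℕ) : outputDensity p P q n = dens p P q n := by
  funext z
  induction n generalizing p with
  | zero =>
    simp only [outputDensity, pathProb, dens]
    rw [← (Equiv.funUnique (Fin 1) (Fin l)).symm.sum_comp]
    simp
  | succ n ih => rw [outputDensity_succ, dens_succ_tail, ih]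

variable {l : ℕ} {β : ℝ} {p₀ : Fin l → ℝ} {P₀ : Matrix (Fin l) (Fin l) ℝ} {q₀ : Fin l → ℝ → ℝ}
  {p : Fin l → ℝ} {P : Matrix (Fin l) (Fin l) ℝ} {q : Fin l → ℝ → ℝ}

/-- The expected logarithm of the conditional density of the last output of a real model. -/
noncomputable def realCondInt (p : Fin l → ℝ) (P : Matrix (Fin l) (Fin l) ℝ)
    (q : Fin l → ℝ → ℝ) (n : ℕ) : ℝ :=
  ∫ z, dens p P q n z * Real.log (dens p P q n z / ∑ i, fwd p P q n (Fin.init z) i)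

theorem IsPositiveModel.ofReal_integrand (h : IsPositiveModel β p P q) (n : ℕ)
    (z : Fin (n + 1) → ℝ) :
    dens (fun i => (p i : ℂ)) (fun i j => (P i j : ℂ)) (fun i x => (q i x : ℂ)) n z
      * Complex.log (condDens (fun i => (p i : ℂ)) (fun i j => (P i j : ℂ))
        (fun i x => (q i x : ℂ)) n z)
    = ((dens p P q n z * Real.log (dens p P q n z / ∑ i, fwd p P q n (Fin.init z) i) : ℝ) : ℂ) := by
  have h1 := dens_map p P q Complex.ofRealHom n z
  have h2 := fun i => fwd_map p P q Complex.ofRealHom n (Fin.init z) i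
  simp only [Complex.ofRealHom_eq_coe] at h1 h2
  unfold condDens
  rw [← h1]
  simp only [← h2]
  rw [← Complex.ofReal_sum, ← Complex.ofReal_div, ← Complex.ofReal_log, ← Complex.ofReal_mul]
  exact (div_pos (h.dens_pos n z) (h.sum_fwd_pos n _)).le

theorem IsPositiveModel.condInt_ofReal (h : IsPositiveModel β p P q) (n : ℕ) :
    condInt (fun i => (p i : ℂ)) (fun i j => (P i j : ℂ)) (fun i x => (q i x : ℂ)) n
      = realCondInt p P q n := by
  unfold condInt realCondInt
  refine Eq.trans ?_ integral_complex_ofReal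
  exact integral_congr_ae (.of_forall fun z => h.ofReal_integrand n z)

section Chain

variable (h : IsPositiveModel β p P q) (hq : ∀ i, Integrable (q i)) (hqc : ∀ i, Continuous (q i))
  (hint : ∀ n, Integrable fun z : Fin (n + 1) → ℝ =>
    dens p P q n z * Real.log (dens p P q n z / ∑ i, fwd p P q n (Fin.init z) i))

include h in
theorem IsPositiveModel.entropyIntegrand_zero (z : Fin 1 → ℝ) : entropyIntegrand p P q 0 z =
    dens p P q 0 z * Real.log (dens p P q 0 z / ∑ i, fwd p P q 0 (Fin.init z) i) := by
  rw [entropyIntegrand, outputDensity_eq_dens]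
  simp [h.sum_init]

include h in
-- The pointwise chain rule: the denominator of the quotient is the joint density of the earlier
-- outputs, by `sum_fwd_succ`.
theorem IsPositiveModel.entropyIntegrand_succ (n : ℕ) (z : Fin (n + 2) → ℝ) :
    entropyIntegrand p P q (n + 1) z =
    dens p P q (n + 1) z
      * Real.log (dens p P q (n + 1) z / ∑ i, fwd p P q (n + 1) (Fin.init z) i)
    + dens p P q (n + 1) z * Real.log (dens p P q n (Fin.init z)) := by
  rw [entropyIntegrand, outputDensity_eq_dens, sum_fwd_succ _ _ _ h.row_sum,
    Real.log_div (h.dens_pos _ _).ne' (h.dens_pos _ _).ne']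
  ring

include h hqc in
theorem IsPositiveModel.integrable_fwd_mul_log (n : ℕ)
    (hn : Integrable (entropyIntegrand p P q n)) (i : Fin l) :
    Integrable fun w : Fin (n + 1) → ℝ => fwd p P q (n + 1) w i * Real.log (dens p P q n w) := by
  refine hn.norm.mono' ((continuous_fwd _ _ hqc _ i).aestronglyMeasurable.mul
    (Real.measurable_log.comp (continuous_dens _ _ hqc n).measurable).aestronglyMeasurable)
    (.of_forall fun w => ?_)
  rw [entropyIntegrand, outputDensity_eq_dens, norm_mul, norm_mul,
    Real.norm_of_nonneg (h.dens_pos _ _).le, Real.norm_of_nonneg (h.fwd_pos _ _ _).le]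
  refine mul_le_mul_of_nonneg_right ?_ (norm_nonneg _)
  rw [← sum_fwd_succ _ _ _ h.row_sum]
  exact Finset.single_le_sum (f := fun i => fwd p P q (n + 1) w i)
    (fun i _ => (h.fwd_pos _ w i).le) (Finset.mem_univ i)

include h hq hqc hint in
theorem IsPositiveModel.integrable_entropyIntegrand (n : ℕ) :
    Integrable (entropyIntegrand p P q n) := by
  induction n with
  | zero => exact (hint 0).congr (.of_forall fun z => (h.entropyIntegrand_zero z).symm)
  | succ n ih =>
    have := integrable_dens_succ_mul_init hq (h.integrable_fwd_mul_log hqc n ih)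
    exact ((hint (n + 1)).add this).congr
      (.of_forall fun z => (h.entropyIntegrand_succ n z).symm)

include h hq hqc hint in
theorem IsPositiveModel.blockEntropy_eq (hq1 : ∀ i, ∫ x, q i x = 1) (n : ℕ) :
    blockEntropy p P q n = -∑ k ∈ Finset.range (n + 1), realCondInt p P q k := by
  induction n with
  | zero =>
    simp only [blockEntropy, zero_add, Finset.sum_range_one, realCondInt]
    congr 1
    exact integral_congr_ae (.of_forall fun z => h.entropyIntegrand_zero z)
  | succ n ih =>
    have hφ := h.integrable_fwd_mul_log hqc n (h.integrable_entropyIntegrand hq hqc hint n)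
    have hmarg := integral_dens_succ_mul_init hq hq1 h.row_sum hφ
    have hent : ∫ w, dens p P q n w * Real.log (dens p P q n w) = -blockEntropy p P q n := by
      simp only [blockEntropy, neg_neg, entropyIntegrand, outputDensity_eq_dens]
    rw [Finset.sum_range_succ, neg_add, ← ih, blockEntropy]
    simp only [h.entropyIntegrand_succ]
    rw [integral_add (hint (n + 1)) (integrable_dens_succ_mul_init hq hφ), hmarg, hent,
      realCondInt]
    ring

end Chain

theorem hasEntropyRate_of_isPerturbation (h : IsPositiveModel β p₀ P₀ q₀)
    (hI : IsIntegrableChannel q₀)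
    (hp : IsPerturbation (pertSize β) p₀ P₀ q₀ (fun i => (p i : ℂ)) (fun i j => (P i j : ℂ))
      (fun i x => (q i x : ℂ)))
    (hq : ∀ i, Continuous (q i)) (hq1 : ∀ i, ∫ x, q i x = 1)
    (hstat : ∀ j, ∑ i, p i * P i j = p j) (hrow : ∀ i, ∑ j, P i j = 1) (hsum : ∑ i, p i = 1) :
    HasEntropyRate p P q (-(condLim (fun i => (p i : ℂ)) (fun i j => (P i j : ℂ))
      (fun i x => (q i x : ℂ))).re) := by
  have hδ := h.pertSize_pos
  have hδ2 : pertSize β ≤ 1 / 200 := by linarith [h.pertSize_le, h.pow_le_one 3]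
  have hlow : ∀ {x y : ℝ}, 0 ≤ y → ‖(x : ℂ) - y‖ ≤ pertSize β * y → y / 2 ≤ x :=
    fun {x y} hy hxy => by
      rw [← Complex.ofReal_sub, Complex.norm_real, Real.norm_eq_abs, abs_le] at hxy
      nlinarith
  -- A real perturbation loses at most half of each entry, so it is a positive model itself and
  -- obeys the chain rule.
  have hpos : IsPositiveModel (β / 2) p P q :=
    { pos := half_pos h.pos
      le_transition := fun i j => by
        have := hlow (h.transition_pos i j).le (hp.transition i j)
        linarith [h.le_transition i j]
      row_sum := hrow
      stationary := hstat
      sum_init := hsum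
      init_nonneg := fun i => by
        have := hlow (h.init_pos i).le (hp.init i)
        linarith [h.init_pos i]
      density_pos := fun i x => by
        have := hlow (h.density_pos i x).le (hp.density i x)
        linarith [h.density_pos i x] }
  have hqc : ∀ i, Continuous fun x => (q i x : ℂ) := fun i =>
    Complex.continuous_ofReal.comp (hq i)
  -- The integral of a non-integrable function is `0` by convention, so the value `1` forces
  -- integrability.
  have hqi : ∀ i, Integrable (q i) := fun i => by
    by_contra hni
    have := hq1 i
    rw [integral_undef hni] at this
    exact zero_ne_one this
  have hint : ∀ n, Integrable fun z : Fin (n + 1) → ℝ =>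
      dens p P q n z * Real.log (dens p P q n z / ∑ i, fwd p P q n (Fin.init z) i) := fun n => by
    have := integrable_dens_mul_log h hI hp hqc (hp.norm_init_le h) n
    simp only [hpos.ofReal_integrand] at this
    simpa using this.re
  refine ⟨hpos.integrable_entropyIntegrand hqi hq hint, ?_⟩
  obtain ⟨K, hK⟩ := exists_norm_condInt_sub_condLim_le h hI
  have hKp := hK _ _ _ hp hqc (fun i => by rw [integral_complex_ofReal, hq1, Complex.ofReal_one])
    fun j => by exact_mod_cast hstat j
  have hr0 := h.convRate_nonneg
  have hr1 := h.convRate_lt_one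
  have htend : Tendsto (condInt (fun i => (p i : ℂ)) (fun i j => (P i j : ℂ))
      (fun i x => (q i x : ℂ))) atTop (𝓝 (condLim (fun i => (p i : ℂ)) (fun i j => (P i j : ℂ))
      (fun i x => (q i x : ℂ)))) := by
    rw [← tendsto_add_atTop_iff_nat K, tendsto_iff_norm_sub_tendsto_zero]
    refine squeeze_zero (fun _ => norm_nonneg _) hKp ?_
    have := ((tendsto_pow_atTop_nhds_zero_of_lt_one hr0 hr1).const_mul
      (8 * (1 + pertSize β) ^ 4)).div_const (1 - convRate β)
    simpa using this
  have hre := (Complex.continuous_re.tendsto _).comp htend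
  simp only [Function.comp_def, hpos.condInt_ofReal, Complex.ofReal_re] at hre
  -- The block with index `n` has `n + 1` letters, hence the shift of the Cesàro means.
  have hces := (hre.cesaro.comp (tendsto_add_atTop_nat 1)).neg
  refine hces.congr fun n => ?_
  rw [hpos.blockEntropy_eq hqi hq hint hq1 n]
  simp only [Function.comp_apply, Nat.cast_add, Nat.cast_one]
  rw [neg_div, inv_mul_eq_div]

end EntropyRate

/-! ### Analytic dependence of the limit on complex parameters. -/

section Parameters

variable {ι : Type*} [Fintype ι] {E : Type*} [NormedAddCommGroup E] [NormedSpace ℂ E]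

theorem differentiableOn_fwd {U : Set E} {p : E → ι → ℂ} {P : E → Matrix ι ι ℂ}
    {q : E → ι → ℝ → ℂ} (hp : ∀ i, DifferentiableOn ℂ (fun x => p x i) U)
    (hP : ∀ i j, DifferentiableOn ℂ (fun x => P x i j) U)
    (hq : ∀ i z, DifferentiableOn ℂ (fun x => q x i z) U) (n : ℕ) (z : Fin n → ℝ) (j : ι) :
    DifferentiableOn ℂ (fun x => fwd (p x) (P x) (q x) n z j) U := by
  induction n generalizing j with
  | zero => exact hp j
  | succ n ih =>
    exact DifferentiableOn.fun_sum fun i _ => (ih _ i).mul ((hq i _).mul (hP i j))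

theorem differentiableOn_dens {U : Set E} {p : E → ι → ℂ} {P : E → Matrix ι ι ℂ}
    {q : E → ι → ℝ → ℂ} (hp : ∀ i, DifferentiableOn ℂ (fun x => p x i) U)
    (hP : ∀ i j, DifferentiableOn ℂ (fun x => P x i j) U)
    (hq : ∀ i z, DifferentiableOn ℂ (fun x => q x i z) U) (n : ℕ) (z : Fin (n + 1) → ℝ) :
    DifferentiableOn ℂ (fun x => dens (p x) (P x) (q x) n z) U :=
  DifferentiableOn.fun_sum fun i _ => (differentiableOn_fwd hp hP hq n _ i).mul (hq i _)

/-- The limit of the expected conditional log-densities depends analytically on the parameters of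
a holomorphic family of perturbations of a positive model. -/
theorem analyticAt_condLim [FiniteDimensional ℂ E] {β : ℝ} {p₀ : ι → ℝ} {P₀ : Matrix ι ι ℝ}
    {q₀ : ι → ℝ → ℝ} (h : IsPositiveModel β p₀ P₀ q₀) (hI : IsIntegrableChannel q₀) {x₀ : E}
    {R : ℝ} (hR : 0 < R) {p : E → ι → ℂ} {P : E → Matrix ι ι ℂ} {q : E → ι → ℝ → ℂ}
    (hp : ∀ i, DifferentiableOn ℂ (fun x => p x i) (Metric.ball x₀ R))
    (hP : ∀ i j, DifferentiableOn ℂ (fun x => P x i j) (Metric.ball x₀ R))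
    (hq : ∀ i z, DifferentiableOn ℂ (fun x => q x i z) (Metric.ball x₀ R))
    (hpert : ∀ x ∈ Metric.ball x₀ R, IsPerturbation (pertSize β) p₀ P₀ q₀ (p x) (P x) (q x))
    (hqc : ∀ x ∈ Metric.ball x₀ R, ∀ i, Continuous (q x i))
    (hq1 : ∀ x ∈ Metric.ball x₀ R, ∀ i, ∫ z, q x i z = 1)
    (hstat : ∀ x ∈ Metric.ball x₀ R, ∀ j, ∑ i, p x i * P x i j = p x j) :
    AnalyticAt ℂ (fun x => condLim (p x) (P x) (q x)) x₀ := by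
  obtain ⟨K, hK⟩ := exists_norm_condInt_sub_condLim_le h hI
  have hr0 := h.convRate_nonneg
  have hr1 := h.convRate_lt_one
  have hGH : ∀ n, GateauxHolomorphicOn (fun x => condInt (p x) (P x) (q x) n)
      (Metric.ball x₀ R) := fun n => by
    refine GateauxHolomorphicOn.integral
      (f := fun x z => dens (p x) (P x) (q x) n z * Complex.log (condDens (p x) (P x) (q x) n z))
      Metric.isOpen_ball (fun z => ?_)
      (fun x hx => (integrable_dens_mul_log h hI (hpert x hx) (hqc x hx)
        ((hpert x hx).norm_init_le h) n).aestronglyMeasurable)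
      (fun x hx z => norm_dens_mul_log_le h (hpert x hx) ((hpert x hx).norm_init_le h) n z)
      ((hI.integrable_prod (n + 1)).const_mul _)
    have hcond : ∀ x ∈ Metric.ball x₀ R, 0 < (condDens (p x) (P x) (q x) n z).re :=
      fun x hx => condDens_re_pos h (hpert x hx) n z
    refine (differentiableOn_dens hp hP hq n z).mul (DifferentiableOn.clog ?_ fun x hx => ?_)
    · simp only [condDens, div_eq_mul_inv]
      -- A vanishing denominator would make `condDens` equal to `0`, contradicting its positive real
      -- part.
      refine (differentiableOn_dens hp hP hq n z).mul (DifferentiableOn.inv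
        (DifferentiableOn.fun_sum fun i _ => differentiableOn_fwd hp hP hq n _ i)
        fun x hx h0 => ?_)
      have := hcond x hx
      rw [condDens, h0, div_zero] at this
      simp at this
    · exact Or.inl (hcond x hx)
  have hlim : TendstoUniformlyOn (fun n x => condInt (p x) (P x) (q x) (n + K))
      (fun x => condLim (p x) (P x) (q x)) atTop (Metric.ball x₀ R) := by
    rw [Metric.tendstoUniformlyOn_iff]
    intro ε hε
    have htend : Tendsto (fun n => 8 * (1 + pertSize β) ^ 4 * convRate β ^ n / (1 - convRate β))
        atTop (𝓝 0) := by
      have := ((tendsto_pow_atTop_nhds_zero_of_lt_one hr0 hr1).const_mul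
        (8 * (1 + pertSize β) ^ 4)).div_const (1 - convRate β)
      simpa using this
    filter_upwards [htend.eventually_lt_const hε] with n hn x hx
    rw [dist_comm, dist_eq_norm]
    exact (hK _ _ _ (hpert x hx) (hqc x hx) (hq1 x hx) (hstat x hx) n).trans_lt hn
  -- The bound needed for analyticity of the limit is that of `condInt` at index `K` plus the
  -- uniform distance from there to the limit.
  refine GateauxHolomorphicOn.analyticAt hR
    (GateauxHolomorphicOn.of_tendstoUniformlyOn Metric.isOpen_ball (fun n => hGH (n + K)) hlim)
    (M := 5 * ((1 + pertSize β) * (1 + pertSize β) ^ (2 * K + 1))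
      * (∫ z : Fin (K + 1) → ℝ, ∏ k, dominant q₀ (z k))
      + 8 * (1 + pertSize β) ^ 4 * convRate β ^ 0 / (1 - convRate β)) fun x hx => ?_
  have h1 := norm_condInt_le h hI (hpert x hx) K
  have h2 := hK _ _ _ (hpert x hx) (hqc x hx) (hq1 x hx) (hstat x hx) 0
  rw [zero_add, norm_sub_rev] at h2
  have h3 := norm_add_le (condInt (p x) (P x) (q x) K)
    (condLim (p x) (P x) (q x) - condInt (p x) (P x) (q x) K)
  rw [add_sub_cancel] at h3
  exact h3.trans (add_le_add h1 h2)

end Parameters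

/-! ### The stationary vector as a holomorphic function of the matrix. -/

section Stationary

variable {ι : Type*} [Fintype ι] [DecidableEq ι] {K : Type*} [Field K]

/-- The matrix of the linear system that determines the stationary vector. -/
def statMatrix (P : Matrix ι ι K) : Matrix ι ι K := 1 - P + Matrix.of fun _ _ => 1

/-- The stationary vector of `P`, normalized to have sum one. -/
noncomputable def statVec (P : Matrix ι ι K) : ι → K :=
  Matrix.vecMul (fun _ => 1) (statMatrix P)⁻¹

/-- For `v` of sum one, stationarity is equivalent to this product being the all-ones vector, a
linear system solved by Cramer's rule. -/
theorem vecMul_statMatrix (P : Matrix ι ι K) (v : ι → K) (j : ι) :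
    Matrix.vecMul v (statMatrix P) j = v j - ∑ i, v i * P i j + ∑ i, v i := by
  rw [statMatrix, Matrix.vecMul_add, Matrix.vecMul_sub, Matrix.vecMul_one]
  simp [Matrix.vecMul, dotProduct]

omit [DecidableEq ι] in
theorem sum_sum_mul_eq {P : Matrix ι ι K} (hP : ∀ i, ∑ j, P i j = 1) (v : ι → K) :
    ∑ j, ∑ i, v i * P i j = ∑ i, v i := by
  rw [Finset.sum_comm]
  exact Finset.sum_congr rfl fun i _ => by rw [← Finset.mul_sum, hP, mul_one]

theorem statVec_stationary [CharZero K] [Nonempty ι] {P : Matrix ι ι K}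
    (hP : ∀ i, ∑ j, P i j = 1) (hdet : (statMatrix P).det ≠ 0) (j : ι) :
    ∑ i, statVec P i * P i j = statVec P j := by
  set v := statVec P with hv
  have h1 : Matrix.vecMul v (statMatrix P) = fun _ => 1 := by
    rw [hv, statVec, Matrix.vecMul_vecMul, Matrix.nonsing_inv_mul _ (isUnit_iff_ne_zero.2 hdet),
      Matrix.vecMul_one]
  have h2 : ∀ j, v j - ∑ i, v i * P i j + ∑ i, v i = 1 := fun j => by
    rw [← vecMul_statMatrix, h1]
  -- Summing over `j` cancels the first two terms, as the rows of `P` sum to one, and leaves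
  -- `Fintype.card ι` times each side.
  have h3 : ∑ i, v i = 1 := by
    have := Finset.sum_congr (rfl : (Finset.univ : Finset ι) = Finset.univ) fun j _ => h2 j
    rw [Finset.sum_add_distrib, Finset.sum_sub_distrib, sum_sum_mul_eq hP, sub_self, zero_add,
      Finset.sum_const, Finset.sum_const, nsmul_eq_mul, nsmul_eq_mul] at this
    exact mul_left_cancel₀ (by simp) this
  have := h2 j
  rw [h3] at this
  linear_combination -this

theorem eq_statVec {P : Matrix ι ι K} (hdet : (statMatrix P).det ≠ 0) {v : ι → K}
    (hv : ∀ j, ∑ i, v i * P i j = v j) (hsum : ∑ i, v i = 1) : v = statVec P := by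
  have h1 : Matrix.vecMul v (statMatrix P) = fun _ => 1 := funext fun j => by
    rw [vecMul_statMatrix, hv, hsum, sub_self, zero_add]
  rw [statVec, ← h1, Matrix.vecMul_vecMul, Matrix.mul_nonsing_inv _ (isUnit_iff_ne_zero.2 hdet),
    Matrix.vecMul_one]

/-- A vector in the left kernel has sum zero and is fixed by `P`, hence also by `P - β`. That
nonnegative matrix has row sums below one and strictly shrinks nonzero vectors in the `ℓ¹` norm. -/
theorem det_statMatrix_ne_zero [Nonempty ι] {P : Matrix ι ι ℝ} (hP : ∀ i, ∑ j, P i j = 1) {β : ℝ}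
    (hβ : 0 < β) (hβP : ∀ i j, β ≤ P i j) : (statMatrix P).det ≠ 0 := by
  intro h0
  obtain ⟨v, hv0, hv⟩ := Matrix.exists_vecMul_eq_zero_iff.2 h0
  have h2 : ∀ j, v j - ∑ i, v i * P i j + ∑ i, v i = 0 := fun j => by
    rw [← vecMul_statMatrix, hv, Pi.zero_apply]
  have h3 : ∑ i, v i = 0 := by
    have := Finset.sum_congr (rfl : (Finset.univ : Finset ι) = Finset.univ) fun j _ => h2 j
    rw [Finset.sum_add_distrib, Finset.sum_sub_distrib, sum_sum_mul_eq hP, sub_self, zero_add,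
      Finset.sum_const, Finset.sum_const_zero, nsmul_eq_mul] at this
    exact (mul_eq_zero.1 this).resolve_left (by simp)
  have h4 : ∀ j, |v j| ≤ ∑ i, |v i| * (P i j - β) := fun j => by
    have : v j = ∑ i, v i * (P i j - β) := by
      simp only [mul_sub, Finset.sum_sub_distrib, ← Finset.sum_mul, h3]
      have := h2 j
      rw [h3] at this
      linarith
    rw [this]
    refine (Finset.abs_sum_le_sum_abs _ _).trans (Finset.sum_le_sum fun i _ => ?_)
    rw [abs_mul, abs_of_nonneg (sub_nonneg.2 (hβP i j))]
  have h5 : ∑ j, |v j| ≤ (1 - Fintype.card ι * β) * ∑ i, |v i| := by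
    refine (Finset.sum_le_sum fun j _ => h4 j).trans (le_of_eq ?_)
    rw [Finset.sum_comm, Finset.mul_sum]
    refine Finset.sum_congr rfl fun i _ => ?_
    rw [← Finset.mul_sum, Finset.sum_sub_distrib, hP]
    simp
    ring
  have hcard : 0 < (Fintype.card ι : ℝ) * β := mul_pos (by exact_mod_cast Fintype.card_pos) hβ
  have h6 : ∑ j, |v j| ≤ 0 := by nlinarith
  refine hv0 (funext fun i => ?_)
  have h7 := Finset.single_le_sum (f := fun i => |v i|) (fun i _ => abs_nonneg _)
    (Finset.mem_univ i)
  exact abs_nonpos_iff.1 (h7.trans h6)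

omit [Fintype ι] in
theorem statMatrix_map (P : Matrix ι ι ℝ) :
    statMatrix (P.map Complex.ofRealHom) = (statMatrix P).map Complex.ofRealHom := by
  ext i j
  simp only [statMatrix, Matrix.map_apply, Matrix.add_apply, Matrix.sub_apply, Matrix.of_apply,
    map_add, map_sub, map_one, Matrix.one_apply]
  split_ifs <;> simp

variable {E : Type*} [NormedAddCommGroup E] [NormedSpace ℂ E]

theorem differentiableAt_det {M : E → Matrix ι ι ℂ} {x : E}
    (hM : ∀ i j, DifferentiableAt ℂ (fun x => M x i j) x) :
    DifferentiableAt ℂ (fun x => (M x).det) x := by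
  simp only [Matrix.det_apply]
  refine DifferentiableAt.fun_sum fun σ _ => DifferentiableAt.const_smul ?_ _
  exact (HasFDerivAt.finsetProd fun i _ => (hM _ _).hasFDerivAt).differentiableAt

omit [Fintype ι] in
theorem differentiableAt_statMatrix {M : E → Matrix ι ι ℂ} {x : E}
    (hM : ∀ i j, DifferentiableAt ℂ (fun x => M x i j) x) (i j : ι) :
    DifferentiableAt ℂ (fun x => statMatrix (M x) i j) x := by
  simp only [statMatrix, Matrix.add_apply, Matrix.sub_apply]
  exact ((differentiableAt_const _).sub (hM i j)).add (differentiableAt_const _)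

theorem differentiableAt_statVec {M : E → Matrix ι ι ℂ} {x : E}
    (hM : ∀ i j, DifferentiableAt ℂ (fun x => M x i j) x) (hdet : (statMatrix (M x)).det ≠ 0)
    (j : ι) : DifferentiableAt ℂ (fun x => statVec (M x) j) x := by
  have hS := differentiableAt_statMatrix hM
  simp only [statVec, Matrix.vecMul, dotProduct, one_mul, Matrix.inv_def, Ring.inverse_eq_inv',
    Matrix.smul_apply, smul_eq_mul, Matrix.adjugate_apply]
  refine DifferentiableAt.fun_sum fun i _ => ((differentiableAt_det hS).inv hdet).mul
    (differentiableAt_det fun k m => ?_)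
  by_cases hk : k = j
  · subst hk
    simp only [Matrix.updateRow_self]
    exact differentiableAt_const _
  · simp only [Matrix.updateRow_ne hk]
    exact hS k m

/-- Correction of the rows of a matrix so that they sum to one. -/
noncomputable def normRows (A : ι → ι → ℂ) : Matrix ι ι ℂ :=
  fun i j => A i j + (1 - ∑ k, A i k) / Fintype.card ι

omit [DecidableEq ι] in
theorem sum_normRows [Nonempty ι] (A : ι → ι → ℂ) (i : ι) : ∑ j, normRows A i j = 1 := by
  have : (Fintype.card ι : ℂ) ≠ 0 := by simp
  simp only [normRows, Finset.sum_add_distrib, Finset.sum_const, Finset.card_univ, nsmul_eq_mul]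
  field_simp
  ring

omit [DecidableEq ι] in
theorem normRows_eq {A : ι → ι → ℂ} (hA : ∀ i, ∑ j, A i j = 1) : normRows A = A := by
  funext i j
  simp [normRows, hA]

end Stationary

/-! ### Integrability and complex extension of the output densities. -/

section Channel

theorem ofReal_max_le_abs {a : ℝ} {b : EReal} (h : (a : EReal) ≤ b) :
    ENNReal.ofReal (max a 0) ≤ b.abs := by
  induction b with
  | bot => simp at h
  | top => simp
  | coe r =>
    rw [EReal.abs_def]
    refine ENNReal.ofReal_le_ofReal (max_le ?_ (abs_nonneg r))
    exact (EReal.coe_le_coe_iff.1 h).trans (le_abs_self r)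

theorem ofReal_max_neg_le_abs {a : ℝ} {b : EReal} (h : b ≤ (a : EReal)) :
    ENNReal.ofReal (max (-a) 0) ≤ b.abs := by
  rw [← EReal.abs_neg]
  refine ofReal_max_le_abs ?_
  rw [EReal.coe_neg]
  exact EReal.neg_le_neg_iff.2 h

/-- The positive part of `log g` is controlled by the upper envelope `S`, the negative part by the
lower envelope `J`. -/
theorem integrable_mul_abs_log {f g : ℝ → ℝ} {S J : ℝ → ENNReal} (hf : Continuous f)
    (hg : Continuous g) (hg0 : ∀ x, 0 < g x) (hfS : ∀ x, ‖f x‖ₑ ≤ S x)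
    (hgS : ∀ x, ENNReal.ofReal (g x) ≤ S x) (hJg : ∀ x, J x ≤ ENNReal.ofReal (g x))
    (hJ : ∫⁻ x, S x * (ENNReal.log (J x)).abs < ⊤)
    (hS : ∫⁻ x, S x * (ENNReal.log (S x)).abs < ⊤) :
    Integrable fun x => f x * |Real.log (g x)| := by
  have hlog : Continuous fun x => Real.log (g x) := hg.log fun x => (hg0 x).ne'
  have h1 : Integrable fun x => f x * max (Real.log (g x)) 0 := by
    refine ⟨(hf.mul (hlog.max continuous_const)).aestronglyMeasurable,
      (lintegral_mono fun x => ?_).trans_lt hS⟩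
    rw [enorm_mul, Real.enorm_of_nonneg (le_max_right _ _)]
    refine mul_le_mul' (hfS x) (ofReal_max_le_abs ?_)
    rw [← ENNReal.log_ofReal_of_pos (hg0 x)]
    exact ENNReal.log_le_log (hgS x)
  have h2 : Integrable fun x => f x * max (-Real.log (g x)) 0 := by
    refine ⟨(hf.mul (hlog.neg.max continuous_const)).aestronglyMeasurable,
      (lintegral_mono fun x => ?_).trans_lt hJ⟩
    rw [enorm_mul, Real.enorm_of_nonneg (le_max_right _ _)]
    refine mul_le_mul' (hfS x) (ofReal_max_neg_le_abs ?_)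
    rw [← ENNReal.log_ofReal_of_pos (hg0 x)]
    exact ENNReal.log_le_log (hJg x)
  refine (h1.add h2).congr (.of_forall fun x => ?_)
  simp only [Pi.add_apply, ← mul_add]
  congr 1
  rcases le_total 0 (Real.log (g x)) with h | h
  · rw [abs_of_nonneg h, max_eq_left h, max_eq_right (by linarith), add_zero]
  · rw [abs_of_nonpos h, max_eq_right h, max_eq_left (by linarith), zero_add]

variable {l m : ℕ} {qc : EuclideanSpace ℂ (Fin m) → Fin l → ℝ → ℂ}
  {q : EuclideanSpace ℝ (Fin m) → Fin l → ℝ → ℝ} {θ₀ : EuclideanSpace ℝ (Fin m)} {r : ℝ}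

theorem RegularOn.continuous_apply (hreg : RegularOn qc θ₀ r) {θ : EuclideanSpace ℂ (Fin m)}
    (hθ : θ ∈ Metric.ball (toComplex θ₀) r) (y : Fin l) : Continuous (qc θ y) :=
  (hreg.continuous y).comp_continuous (f := fun z : ℝ => (z, θ)) (by fun_prop)
    fun z => ⟨Set.mem_univ _, hθ⟩

theorem RegularOn.isIntegrableChannel (hreg : RegularOn qc θ₀ r) (hr : 0 < r)
    (hqc : ∀ y z, qc (toComplex θ₀) y z = q θ₀ y z) (hpos : ∀ y z, 0 < q θ₀ y z)
    (hq : ∀ y, IsDensity (q θ₀ y)) : IsIntegrableChannel (q θ₀) := by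
  have hmem : toComplex θ₀ ∈ Metric.ball (toComplex θ₀) r := Metric.mem_ball_self hr
  have hcont : ∀ y, Continuous (q θ₀ y) := fun y => by
    have := Complex.continuous_re.comp (hreg.continuous_apply hmem y)
    refine this.congr fun z => ?_
    simp [hqc]
  have hval : ∀ y z, ‖qc (toComplex θ₀) y z‖ₑ = ENNReal.ofReal (q θ₀ y z) := fun y z => by
    rw [hqc, ← ofReal_norm, Complex.norm_real, Real.norm_of_nonneg (hpos y z).le]
  have hS : ∀ y z, ENNReal.ofReal (q θ₀ y z) ≤ qSup qc θ₀ r z := fun y z => by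
    rw [← hval]
    exact le_iSup_of_le y (le_iSup₂_of_le _ hmem le_rfl)
  have hJ : ∀ y z, qInf qc θ₀ r z ≤ ENNReal.ofReal (q θ₀ y z) := fun y z => by
    rw [← hval]
    exact iInf_le_of_le y (iInf₂_le_of_le _ hmem le_rfl)
  refine ⟨hcont, fun y => (hq y).2.2, ?_⟩
  have hprod : ∀ i j, Integrable fun x => q θ₀ i x * |Real.log (q θ₀ j x)| := fun i j =>
    integrable_mul_abs_log (hcont i) (hcont j) (hpos j)
      (fun x => by rw [Real.enorm_of_nonneg (hpos i x).le]; exact hS i x) (hS j) (hJ j)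
      hreg.sup_log_inf_finite hreg.sup_log_sup_finite
  have : dominant (q θ₀) = fun x => ∑ i, (q θ₀ i x + ∑ j, q θ₀ i x * |Real.log (q θ₀ j x)|) := by
    funext x
    rw [dominant, Finset.sum_mul]
    exact Finset.sum_congr rfl fun i _ => by rw [mul_add, mul_one, Finset.mul_sum]
  rw [this]
  exact integrable_finsetSum _ fun i _ => (hq i).2.1.add
    (integrable_finsetSum _ fun j _ => hprod i j)

/-- This is `‖exp w - 1‖ ≤ 2 * ‖w‖` for `w = log (a / b)`; the factor 2 explains the `δ / 2`. -/
theorem norm_sub_le_of_norm_log_div_le {a : ℂ} {b δ : ℝ} (ha : a ≠ 0) (hb : 0 < b)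
    (hδ : δ ≤ 1) (h : ‖Complex.log (a / b)‖ ≤ δ / 2) : ‖a - b‖ ≤ δ * b := by
  have hb0 : (b : ℂ) ≠ 0 := by exact_mod_cast hb.ne'
  have h1 := Complex.norm_exp_sub_one_le (h.trans (by linarith : δ / 2 ≤ 1))
  rw [Complex.exp_log (div_ne_zero ha hb0)] at h1
  have h2 : a - b = (a / b - 1) * b := by field_simp
  rw [h2, norm_mul, Complex.norm_real, Real.norm_of_nonneg hb.le]
  exact mul_le_mul_of_nonneg_right (by linarith) hb.le

/-- The inclusion of `ℝᵐ` in `ℂᵐ` as a continuous real-linear map. -/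
noncomputable def toComplexL (m : ℕ) : EuclideanSpace ℝ (Fin m) →L[ℝ] EuclideanSpace ℂ (Fin m) :=
  LinearMap.toContinuousLinearMap
    { toFun := toComplex
      map_add' := fun x y => by ext i; simp [toComplex]
      map_smul' := fun c x => by ext i; simp [toComplex] }

theorem analyticAt_toComplex (x : EuclideanSpace ℝ (Fin m)) :
    AnalyticAt ℝ (toComplex : EuclideanSpace ℝ (Fin m) → EuclideanSpace ℂ (Fin m)) x :=
  (toComplexL m).analyticAt x

theorem dist_toComplex (x y : EuclideanSpace ℝ (Fin m)) :
    dist (toComplex x) (toComplex y) = dist x y := by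
  rw [EuclideanSpace.dist_eq, EuclideanSpace.dist_eq]
  congr 1
  refine Finset.sum_congr rfl fun i _ => ?_
  simp [toComplex, dist_eq_norm, ← Complex.ofReal_sub, Complex.norm_real]

/-- The holomorphic extension of a real analytic function is an extension on the whole ball on
which it is holomorphic. -/
theorem eq_extension_of_mem_ball {F : EuclideanSpace ℂ (Fin m) → ℂ}
    {f : EuclideanSpace ℝ (Fin m) → ℝ} (hr : 0 < r)
    (hF : AnalyticOnNhd ℂ F (Metric.ball (toComplex θ₀) r))
    (hf : AnalyticOnNhd ℝ f (Metric.ball θ₀ r)) (hext : IsComplexExtensionAt f F θ₀)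
    {θ : EuclideanSpace ℝ (Fin m)} (hθ : θ ∈ Metric.ball θ₀ r) : F (toComplex θ) = f θ := by
  have h1 : AnalyticOnNhd ℝ (fun θ => F (toComplex θ)) (Metric.ball θ₀ r) := fun θ hθ =>
    AnalyticAt.fun_comp (g := F) (hF _ (by
      rw [Metric.mem_ball, dist_toComplex]; exact hθ)).restrictScalars (analyticAt_toComplex θ)
  have h2 : AnalyticOnNhd ℝ (fun θ => (f θ : ℂ)) (Metric.ball θ₀ r) := fun θ hθ =>
    AnalyticAt.fun_comp (g := fun x : ℝ => (x : ℂ)) (Complex.ofRealCLM.analyticAt _) (hf θ hθ)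
  exact h1.eqOn_of_preconnected_of_eventuallyEq h2 (convex_ball θ₀ r).isPreconnected
    (Metric.mem_ball_self hr) hext.2 hθ

/-- A Gateaux holomorphic function on a complex ball that equals one on its real points equals one
everywhere. -/
theorem eq_one_of_eq_one_on_real {F : EuclideanSpace ℂ (Fin m) → ℂ}
    (hF : GateauxHolomorphicOn F (Metric.ball (toComplex θ₀) r))
    (h1 : ∀ θ ∈ Metric.ball θ₀ r, F (toComplex θ) = 1) {θ : EuclideanSpace ℂ (Fin m)}
    (hθ : θ ∈ Metric.ball (toComplex θ₀) r) : F θ = 1 := by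
  -- The complex line `t ↦ a + t • b` has real points at real `t` and passes through `θ` at `t = I`.
  -- Its part in the ball is convex, so the one-variable identity theorem carries the value from
  -- small real `t` to `I`.
  let a : EuclideanSpace ℝ (Fin m) := WithLp.toLp 2 fun i => (θ i).re
  let b : EuclideanSpace ℝ (Fin m) := WithLp.toLp 2 fun i => (θ i).im
  have hab : toComplex a + Complex.I • toComplex b = θ := by
    ext i
    simp only [toComplex, a, b, PiLp.add_apply, PiLp.smul_apply, smul_eq_mul]
    rw [mul_comm]
    exact Complex.re_add_im _
  have ha : a ∈ Metric.ball θ₀ r := by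
    rw [Metric.mem_ball] at hθ ⊢
    refine lt_of_le_of_lt ?_ hθ
    rw [EuclideanSpace.dist_eq, EuclideanSpace.dist_eq]
    refine Real.sqrt_le_sqrt (Finset.sum_le_sum fun i _ => ?_)
    refine pow_le_pow_left₀ dist_nonneg ?_ 2
    have := Complex.abs_re_le_norm (θ i - (θ₀ i : ℂ))
    simpa [a, toComplex, dist_eq_norm] using this
  set V : Set ℂ := {t : ℂ | toComplex a + t • toComplex b ∈ Metric.ball (toComplex θ₀) r} with hV
  have hVo : IsOpen V := Metric.isOpen_ball.preimage (by fun_prop)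
  have hreal : ∀ t : ℝ, toComplex a + (t : ℂ) • toComplex b = toComplex (a + t • b) := fun t => by
    ext i; simp [toComplex]
  have hVc : IsPreconnected V := by
    have : Convex ℝ V := by
      have hconv := convex_ball (toComplex θ₀) r
      intro s hs t ht c d hc hd hcd
      have := hconv hs ht hc hd hcd
      simp only [hV, Set.mem_ofPred_eq]
      convert this using 1
      ext i
      have hcd' : (c : ℂ) + d = 1 := by exact_mod_cast hcd
      simp only [PiLp.add_apply, PiLp.smul_apply, smul_eq_mul, Complex.real_smul]
      linear_combination (-(toComplex a i)) * hcd'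
    exact this.isPreconnected
  have h0V : (0 : ℂ) ∈ V := by
    simp only [hV, Set.mem_ofPred_eq, zero_smul, add_zero, Metric.mem_ball, dist_toComplex]
    exact ha
  have hIV : Complex.I ∈ V := by
    simp only [hV, Set.mem_ofPred_eq, hab]
    exact hθ
  have hfreq : ∃ᶠ t in 𝓝[≠] (0 : ℂ), F (toComplex a + t • toComplex b) = 1 := by
    let s : ℕ → ℂ := fun n => ((1 / ((n : ℝ) + 1) : ℝ) : ℂ)
    have hs0 : ∀ n, s n ≠ 0 := fun n => by
      simp only [s]
      exact_mod_cast (by positivity : 1 / ((n : ℝ) + 1) ≠ 0)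
    have hs : Tendsto s atTop (𝓝[≠] 0) := by
      refine tendsto_nhdsWithin_iff.2 ⟨?_, .of_forall hs0⟩
      have := (Complex.continuous_ofReal.tendsto 0).comp tendsto_one_div_add_atTop_nhds_zero_nat
      simpa only [s, Function.comp_def, Complex.ofReal_zero] using this
    refine hs.frequently (Eventually.frequently ?_)
    have hev : ∀ᶠ n in atTop, s n ∈ V :=
      (hs.mono_right nhdsWithin_le_nhds).eventually (hVo.mem_nhds h0V)
    filter_upwards [hev] with n hn
    have hn' : toComplex a + s n • toComplex b ∈ Metric.ball (toComplex θ₀) r := hn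
    simp only [s] at hn' ⊢
    rw [hreal] at hn' ⊢
    refine h1 _ ?_
    rwa [Metric.mem_ball, dist_toComplex] at hn'
  have := ((hF (toComplex a) (toComplex b)).analyticOnNhd hVo).eqOn_of_preconnected_of_frequently_eq
    (analyticOnNhd_const (v := (1 : ℂ))) hVc h0V hfreq hIV
  simpa [hab] using this

/-- Marginalization at complex parameters needs total mass exactly one. It persists by the identity
theorem, the majorant `2 * q θ₀ y z` making the integral holomorphic on lines. -/
theorem integral_extension_eq_one {r₁ : ℝ} (hr : 0 < r) (hr₁ : r ≤ r₁) (hreg : RegularOn qc θ₀ r₁)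
    (hbound : ∀ θ ∈ Metric.ball (toComplex θ₀) r, ∀ y z, ‖qc θ y z‖ ≤ 2 * q θ₀ y z)
    (hreal : ∀ θ ∈ Metric.ball θ₀ r, ∀ y z, qc (toComplex θ) y z = q θ y z)
    (hq : ∀ θ ∈ Metric.ball θ₀ r, ∀ y, IsDensity (q θ y)) {θ : EuclideanSpace ℂ (Fin m)}
    (hθ : θ ∈ Metric.ball (toComplex θ₀) r) (y : Fin l) : ∫ z, qc θ y z = 1 := by
  refine eq_one_of_eq_one_on_real (θ₀ := θ₀) (r := r) (F := fun θ => ∫ z, qc θ y z) ?_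
    (fun θ hθ => ?_) hθ
  · exact GateauxHolomorphicOn.integral (f := fun θ z => qc θ y z) (g := fun z => 2 * q θ₀ y z)
      Metric.isOpen_ball (fun z => ((hreg.analytic y z).mono
        (Metric.ball_subset_ball hr₁)).differentiableOn)
      (fun θ hθ => (hreg.continuous_apply (Metric.ball_subset_ball hr₁ hθ) y).aestronglyMeasurable)
      (fun θ hθ z => hbound θ hθ y z) ((hq θ₀ (Metric.mem_ball_self hr) y).2.1.const_mul 2)
  · simp only [hreal θ hθ]
    rw [integral_complex_ofReal, (hq θ hθ y).2.2, Complex.ofReal_one]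

end Channel

/-! ### The holomorphic family with free transition matrix. -/

section Family

variable {l m : ℕ}

theorem differentiable_normRows (i j : Fin l) :
    Differentiable ℂ fun x : (Fin l → Fin l → ℂ) × EuclideanSpace ℂ (Fin m) =>
      normRows x.1 i j := by
  simp only [normRows]
  fun_prop

variable {β : ℝ} {p₀ : Fin l → ℝ} {P₀ : Matrix (Fin l) (Fin l) ℝ} {q₀ : Fin l → ℝ → ℝ}

theorem IsPositiveModel.normRows_eq (h : IsPositiveModel β p₀ P₀ q₀) :
    normRows (fun i j => (P₀ i j : ℂ)) = P₀.map Complex.ofRealHom :=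
  HiddenMarkov.normRows_eq fun i => by exact_mod_cast h.row_sum i

theorem IsPositiveModel.det_statMatrix_ne_zero (h : IsPositiveModel β p₀ P₀ q₀) :
    (statMatrix (normRows fun i j => (P₀ i j : ℂ))).det ≠ 0 := by
  have := h.nonempty
  rw [h.normRows_eq, statMatrix_map, ← RingHom.mapMatrix_apply, ← RingHom.map_det]
  exact Complex.ofReal_ne_zero.2
    (HiddenMarkov.det_statMatrix_ne_zero h.row_sum h.pos h.le_transition)

theorem IsPositiveModel.statVec_eq (h : IsPositiveModel β p₀ P₀ q₀) (i : Fin l) :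
    statVec (normRows fun i j => (P₀ i j : ℂ)) i = p₀ i := by
  have := eq_statVec (v := fun i => (p₀ i : ℂ)) h.det_statMatrix_ne_zero (fun j => by
    rw [h.normRows_eq]
    simp only [Matrix.map_apply, Complex.ofRealHom_eq_coe]
    exact_mod_cast h.stationary j) (by exact_mod_cast h.sum_init)
  exact (congrFun this i).symm

/-- The complex stationary model with transition matrix `normRows x.1` and output densities
`qc x.2` is close to a given positive model near the parameter of the latter. -/
theorem IsPositiveModel.eventually_isPerturbation (h : IsPositiveModel β p₀ P₀ q₀)
    {qc : EuclideanSpace ℂ (Fin m) → Fin l → ℝ → ℂ} {θ₀ : EuclideanSpace ℂ (Fin m)} {r : ℝ}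
    (hr : 0 < r)
    (hqp : ∀ θ ∈ Metric.ball θ₀ r, ∀ y z, ‖qc θ y z - q₀ y z‖ ≤ pertSize β * q₀ y z)
    {x₀ : (Fin l → Fin l → ℂ) × EuclideanSpace ℂ (Fin m)}
    (hx₀ : x₀ = ((fun i j => (P₀ i j : ℂ)), θ₀)) :
    ∀ᶠ x in 𝓝 x₀, x.2 ∈ Metric.ball θ₀ r ∧ (statMatrix (normRows x.1)).det ≠ 0 ∧
        IsPerturbation (pertSize β) p₀ P₀ q₀ (statVec (normRows x.1)) (normRows x.1)
          (qc x.2) := by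
  have hδ := h.pertSize_pos
  have hN := differentiable_normRows (l := l) (m := m)
  have hdet0 : (statMatrix (normRows x₀.1)).det ≠ 0 := by
    rw [hx₀]
    exact h.det_statMatrix_ne_zero
  have hdetc : ContinuousAt (fun x : (Fin l → Fin l → ℂ) × EuclideanSpace ℂ (Fin m) =>
      (statMatrix (normRows x.1)).det) x₀ :=
    (differentiableAt_det (differentiableAt_statMatrix fun i j => hN i j x₀)).continuousAt
  have hvc : ∀ i, ContinuousAt (fun x : (Fin l → Fin l → ℂ) × EuclideanSpace ℂ (Fin m) =>
      statVec (normRows x.1) i) x₀ := fun i =>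
    (differentiableAt_statVec (fun i j => hN i j x₀) hdet0 i).continuousAt
  have hclose : ∀ {f : (Fin l → Fin l → ℂ) × EuclideanSpace ℂ (Fin m) → ℂ} {c : ℝ},
      ContinuousAt f x₀ → f x₀ = c → 0 < c → ∀ᶠ x in 𝓝 x₀, ‖f x - c‖ ≤ pertSize β * c :=
    fun {f c} hf hfc hc => by
      have := Metric.continuousAt_iff'.1 hf (pertSize β * c) (by positivity)
      filter_upwards [this] with x hx
      rw [dist_eq_norm, hfc] at hx
      exact hx.le
  have h1 : ∀ᶠ x in 𝓝 x₀, x.2 ∈ Metric.ball θ₀ r := by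
    rw [hx₀]
    exact continuousAt_snd.preimage_mem_nhds (Metric.ball_mem_nhds _ hr)
  have h2 : ∀ᶠ x in 𝓝 x₀, ∀ i, ‖statVec (normRows x.1) i - p₀ i‖ ≤ pertSize β * p₀ i :=
    eventually_all.2 fun i => hclose (hvc i)
      (by rw [hx₀]; exact h.statVec_eq i) (h.init_pos i)
  have h3 : ∀ᶠ x in 𝓝 x₀, ∀ i j, ‖normRows x.1 i j - P₀ i j‖ ≤ pertSize β * P₀ i j :=
    eventually_all.2 fun i => eventually_all.2 fun j =>
      hclose (hN i j).continuous.continuousAt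
        (by rw [hx₀, h.normRows_eq]; rfl) (h.transition_pos i j)
  filter_upwards [h1, h2, h3, hdetc.eventually_ne hdet0] with x hx1 hx2 hx3 hx4
  exact ⟨hx1, hx4, hx2, hx3, hqp _ hx1⟩

/-- The matrix entries range over a full complex neighbourhood. `normRows` and `statVec` make every
point of it a stationary complex model, as `analyticAt_condLim` requires. -/
theorem analyticAt_condLim_statVec (h : IsPositiveModel β p₀ P₀ q₀) (hI : IsIntegrableChannel q₀)
    {qc : EuclideanSpace ℂ (Fin m) → Fin l → ℝ → ℂ} {θ₀ : EuclideanSpace ℂ (Fin m)} {r : ℝ}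
    (hqa : ∀ y z, DifferentiableOn ℂ (fun θ => qc θ y z) (Metric.ball θ₀ r))
    (hqc : ∀ θ ∈ Metric.ball θ₀ r, ∀ y, Continuous (qc θ y))
    (hq1 : ∀ θ ∈ Metric.ball θ₀ r, ∀ y, ∫ z, qc θ y z = 1)
    {x₀ : (Fin l → Fin l → ℂ) × EuclideanSpace ℂ (Fin m)}
    (hev : ∀ᶠ x in 𝓝 x₀, x.2 ∈ Metric.ball θ₀ r ∧ (statMatrix (normRows x.1)).det ≠ 0 ∧
        IsPerturbation (pertSize β) p₀ P₀ q₀ (statVec (normRows x.1)) (normRows x.1) (qc x.2)) :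
    AnalyticAt ℂ (fun x => condLim (statVec (normRows x.1)) (normRows x.1) (qc x.2)) x₀ := by
  have := h.nonempty
  have hN := differentiable_normRows (l := l) (m := m)
  obtain ⟨R, hR, hball⟩ := Metric.eventually_nhds_iff_ball.1 hev
  have hvd : ∀ i, DifferentiableOn ℂ (fun x : (Fin l → Fin l → ℂ) × EuclideanSpace ℂ (Fin m) =>
      statVec (normRows x.1) i) (Metric.ball x₀ R) := fun i x hx =>
    (differentiableAt_statVec (fun i j => hN i j x) (hball x hx).2.1 i).differentiableWithinAt
  have hqd : ∀ i z, DifferentiableOn ℂ (fun x : (Fin l → Fin l → ℂ) × EuclideanSpace ℂ (Fin m) =>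
      qc x.2 i z) (Metric.ball x₀ R) := fun i z =>
    (hqa i z).comp differentiableOn_snd fun x hx => (hball x hx).1
  have hst : ∀ x ∈ Metric.ball x₀ R, ∀ j,
      ∑ i, statVec (normRows x.1) i * normRows x.1 i j = statVec (normRows x.1) j :=
    fun x hx j => statVec_stationary (sum_normRows x.1) (hball x hx).2.1 j
  exact analyticAt_condLim h hI hR hvd
    (fun i j => (hN i j).differentiableOn) hqd
    (fun x hx => (hball x hx).2.2) (fun x hx => hqc _ (hball x hx).1)
    (fun x hx => hq1 _ (hball x hx).1) hst

end Family

end HiddenMarkov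

/-! ### The main theorem. -/

open HiddenMarkov in
theorem theorem4 {l m₁ m₂ : ℕ} (hl : 1 ≤ l)
    (Ω₁ : Set (EuclideanSpace ℝ (Fin m₁))) (Ω₂ : Set (EuclideanSpace ℝ (Fin m₂)))
    (hΩ₁_open : IsOpen Ω₁) (hΩ₁_conn : IsConnected Ω₁) (hΩ₁_bdd : Bornology.IsBounded Ω₁)
    (hΩ₂_open : IsOpen Ω₂) (hΩ₂_conn : IsConnected Ω₂) (hΩ₂_bdd : Bornology.IsBounded Ω₂)
    -- the input Markov chain: transition matrix and stationary vector
    (P : EuclideanSpace ℝ (Fin m₁) → Matrix (Fin l) (Fin l) ℝ)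
    (p : EuclideanSpace ℝ (Fin m₁) → Fin l → ℝ)
    (hP_stoch : ∀ ε ∈ Ω₁, P ε ∈ Matrix.rowStochastic ℝ (Fin l))
    (hP_analytic : ∀ i j, AnalyticOnNhd ℝ (fun ε => P ε i j) Ω₁)
    (hp : ∀ ε ∈ Ω₁, HiddenMarkov.IsStationary (P ε) (p ε))
    -- the channel: `q θ y z` is the density of the output `z`, given the input `y`
    (q : EuclideanSpace ℝ (Fin m₂) → Fin l → ℝ → ℝ)
    (hq_density : ∀ θ ∈ Ω₂, ∀ y, HiddenMarkov.IsDensity (q θ y))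
    (hq_analytic : ∀ y z, AnalyticOnNhd ℝ (fun θ => q θ y z) Ω₂)
    (ε₀ : EuclideanSpace ℝ (Fin m₁)) (hε₀ : ε₀ ∈ Ω₁)
    (θ₀ : EuclideanSpace ℝ (Fin m₂)) (hθ₀ : θ₀ ∈ Ω₂)
    -- the complex extension of the channel densities near `θ₀`
    (qc : EuclideanSpace ℂ (Fin m₂) → Fin l → ℝ → ℂ)
    (hqc : ∀ y z,
      HiddenMarkov.IsComplexExtensionAt (fun θ => q θ y z) (fun θ => qc θ y z) θ₀)
    (ha : ∀ i j, 0 < P ε₀ i j)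
    (hb : ∀ y z, 0 < q θ₀ y z)
    (hc : ∃ r > 0, HiddenMarkov.RegularOn qc θ₀ r)
    (hdom : ∀ δ : ℝ, 0 < δ → ∃ r > 0, ∀ y z,
      ∀ θ ∈ Metric.ball (HiddenMarkov.toComplex θ₀) r,
        |(qc θ y z).im| < δ * |(qc θ y z).re| ∧
        ‖Complex.log (qc θ y z / (q θ₀ y z : ℂ))‖ ≤ δ) :
    (∀ᶠ x : EuclideanSpace ℝ (Fin m₁) × EuclideanSpace ℝ (Fin m₂) in 𝓝 (ε₀, θ₀),
      HiddenMarkov.HasEntropyRate (p x.1) (P x.1) (q x.2)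
        (HiddenMarkov.entropyRate (p x.1) (P x.1) (q x.2))) ∧
    AnalyticAt ℝ
      (fun x : EuclideanSpace ℝ (Fin m₁) × EuclideanSpace ℝ (Fin m₂) =>
        HiddenMarkov.entropyRate (p x.1) (P x.1) (q x.2)) (ε₀, θ₀) := by
  have : NeZero l := ⟨by omega⟩
  obtain ⟨r₁, hr₁, hreg⟩ := hc
  have hmem₁ : toComplex θ₀ ∈ Metric.ball (toComplex θ₀) r₁ := Metric.mem_ball_self hr₁
  have hqc0 : ∀ y z, qc (toComplex θ₀) y z = q θ₀ y z := fun y z => (hqc y z).2.self_of_nhds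
  -- The smallest transition probability at `ε₀` serves as `β`.
  obtain ⟨a, ha'⟩ := Finite.exists_min fun a : Fin l × Fin l => P ε₀ a.1 a.2
  have hrow : ∀ ε ∈ Ω₁, ∀ i, ∑ j, P ε i j = 1 := fun ε hε i =>
    Matrix.sum_row_of_mem_rowStochastic (hP_stoch ε hε) i
  have hstat : ∀ ε ∈ Ω₁, ∀ j, ∑ i, p ε i * P ε i j = p ε j := fun ε hε j =>
    congrFun (hp ε hε).2 j
  have h : IsPositiveModel (P ε₀ a.1 a.2) (p ε₀) (P ε₀) (q θ₀) :=
    { pos := ha _ _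
      le_transition := fun i j => ha' (i, j)
      row_sum := hrow ε₀ hε₀
      stationary := hstat ε₀ hε₀
      sum_init := (hp ε₀ hε₀).1.2
      init_nonneg := (hp ε₀ hε₀).1.1
      density_pos := hb }
  have hI := hreg.isIntegrableChannel hr₁ hqc0 hb (hq_density θ₀ hθ₀)
  set β := P ε₀ a.1 a.2
  have hδ := h.pertSize_pos
  have hδ1 : pertSize β ≤ 1 := by linarith [h.pertSize_le, h.pow_le_one 3]
  obtain ⟨r₂, hr₂, hdom₂⟩ := hdom (pertSize β / 2) (by positivity)
  obtain ⟨r₃, hr₃, hΩ₃⟩ := Metric.isOpen_iff.1 hΩ₂_open θ₀ hθ₀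
  set r := min r₁ (min r₂ r₃)
  have hr : 0 < r := lt_min hr₁ (lt_min hr₂ hr₃)
  have hrr₁ : r ≤ r₁ := min_le_left _ _
  have hrr₂ : r ≤ r₂ := (min_le_right _ _).trans (min_le_left _ _)
  have hrΩ : Metric.ball θ₀ r ⊆ Ω₂ :=
    (Metric.ball_subset_ball ((min_le_right _ _).trans (min_le_right _ _))).trans hΩ₃
  have hqp : ∀ θ ∈ Metric.ball (toComplex θ₀) r, ∀ y z,
      ‖qc θ y z - q θ₀ y z‖ ≤ pertSize β * q θ₀ y z := fun θ hθ y z => by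
    obtain ⟨him, hlog⟩ := hdom₂ y z θ (Metric.ball_subset_ball hrr₂ hθ)
    refine norm_sub_le_of_norm_log_div_le (fun h0 => ?_) (hb y z) hδ1 hlog
    -- The strict bound on the imaginary part excludes zeros of `qc`. The logarithmic bound alone
    -- would not, since `Complex.log 0 = 0`.
    simp [h0] at him
  have hreal : ∀ θ ∈ Metric.ball θ₀ r, ∀ y z, qc (toComplex θ) y z = q θ y z :=
    fun θ hθ y z => eq_extension_of_mem_ball (F := fun θ => qc θ y z) (f := fun θ => q θ y z) hr
      ((hreg.analytic y z).mono (Metric.ball_subset_ball hrr₁)) ((hq_analytic y z).mono hrΩ)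
      (hqc y z) hθ
  have hqcont : ∀ θ ∈ Metric.ball (toComplex θ₀) r, ∀ y, Continuous (qc θ y) := fun θ hθ y =>
    hreg.continuous_apply (Metric.ball_subset_ball hrr₁ hθ) y
  have hq1 : ∀ θ ∈ Metric.ball (toComplex θ₀) r, ∀ y, ∫ z, qc θ y z = 1 := fun θ hθ y =>
    integral_extension_eq_one hr hrr₁ hreg (fun θ hθ y z => by
      have h1 := norm_le_of_norm_sub_le (c := 1) (hb y z).le (by simpa using hqp θ hθ y z)
      rw [norm_one, mul_one] at h1
      exact h1.trans (mul_le_mul_of_nonneg_right (by linarith) (hb y z).le))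
      hreal (fun θ hθ => hq_density θ (hrΩ hθ)) hθ y
  have hev := h.eventually_isPerturbation hr hqp
    (x₀ := ((fun i j => (P ε₀ i j : ℂ)), toComplex θ₀)) rfl
  have hana := analyticAt_condLim_statVec h hI
    (fun y z => ((hreg.analytic y z).mono (Metric.ball_subset_ball hrr₁)).differentiableOn)
    hqcont hq1 hev
  -- Only this map involves `ε`. It is real analytic, so no complex extension of `P` in `ε` is
  -- needed.
  let Φ : EuclideanSpace ℝ (Fin m₁) × EuclideanSpace ℝ (Fin m₂) →
      (Fin l → Fin l → ℂ) × EuclideanSpace ℂ (Fin m₂) :=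
    fun x => ((fun i j => (P x.1 i j : ℂ)), toComplex x.2)
  have hΦ : AnalyticAt ℝ Φ (ε₀, θ₀) := by
    refine AnalyticAt.prod (AnalyticAt.pi fun i => AnalyticAt.pi fun j => ?_) ?_
    · exact AnalyticAt.fun_comp (g := fun t : ℝ => (t : ℂ)) (Complex.ofRealCLM.analyticAt _)
        (AnalyticAt.fun_comp (g := fun ε => P ε i j) (hP_analytic i j ε₀ hε₀) analyticAt_fst)
    · exact AnalyticAt.fun_comp (g := toComplex) (analyticAt_toComplex θ₀) analyticAt_snd
  have hrate : ∀ᶠ x : EuclideanSpace ℝ (Fin m₁) × EuclideanSpace ℝ (Fin m₂) in 𝓝 (ε₀, θ₀),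
      HasEntropyRate (p x.1) (P x.1) (q x.2)
        (-(condLim (statVec (normRows (Φ x).1)) (normRows (Φ x).1) (qc (Φ x).2)).re) := by
    have h1 : ∀ᶠ x : EuclideanSpace ℝ (Fin m₁) × EuclideanSpace ℝ (Fin m₂) in 𝓝 (ε₀, θ₀),
        x.1 ∈ Ω₁ := continuousAt_fst.preimage_mem_nhds (hΩ₁_open.mem_nhds hε₀)
    filter_upwards [h1, hΦ.continuousAt.eventually hev] with x hx1 hx
    obtain ⟨hx2, hxdet, hxp⟩ := hx
    have hθ : x.2 ∈ Metric.ball θ₀ r := by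
      rwa [Metric.mem_ball, ← dist_toComplex]
    have hNx : normRows (Φ x).1 = fun i j => (P x.1 i j : ℂ) :=
      normRows_eq fun i => by
        simp only [Φ]
        exact_mod_cast hrow x.1 hx1 i
    have hvx : statVec (normRows (Φ x).1) = fun i => (p x.1 i : ℂ) :=
      (eq_statVec hxdet (fun j => by
        rw [hNx]
        simp only
        exact_mod_cast hstat x.1 hx1 j) (by exact_mod_cast (hp x.1 hx1).1.2)).symm
    have hqx : qc (Φ x).2 = fun y z => (q x.2 y z : ℂ) :=
      funext fun y => funext fun z => hreal x.2 hθ y z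
    rw [hvx, hNx, hqx] at hxp ⊢
    refine hasEntropyRate_of_isPerturbation h hI hxp (fun y => ?_)
      (fun y => (hq_density x.2 (hrΩ hθ) y).2.2) (hstat x.1 hx1) (hrow x.1 hx1) (hp x.1 hx1).1.2
    refine (Complex.continuous_re.comp (hqcont _ hx2 y)).congr fun z => ?_
    simp [hqx]
  have hval : ∀ᶠ x : EuclideanSpace ℝ (Fin m₁) × EuclideanSpace ℝ (Fin m₂) in 𝓝 (ε₀, θ₀),
      -(condLim (statVec (normRows (Φ x).1)) (normRows (Φ x).1) (qc (Φ x).2)).re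
        = entropyRate (p x.1) (P x.1) (q x.2) := by
    filter_upwards [hrate] with x hx using hx.2.limUnder_eq.symm
  refine ⟨?_, AnalyticAt.congr ?_ hval⟩
  · filter_upwards [hrate, hval] with x hx hx'
    rwa [hx'] at hx
  · refine AnalyticAt.neg ?_
    exact AnalyticAt.fun_comp (g := Complex.re) (Complex.reCLM.analyticAt _)
      (AnalyticAt.fun_comp (g := fun x : (Fin l → Fin l → ℂ) × EuclideanSpace ℂ (Fin m₂) =>
        condLim (statVec (normRows x.1)) (normRows x.1) (qc x.2)) (f := Φ)
        hana.restrictScalars hΦ)
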